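/- Let $d_1,d_2\in\mathbb R$, let $0<a<1$ and $f_a(u)=u(u-a)(u-1)$, and for $\varepsilon>0$ put $$A_\varepsilon u(x)=\frac1{\varepsilon^2}\bigl[d_1\bigl(u(x+\varepsilon)-2u(x)+u(x-\varepsilon)\bigr)+d_2\bigl(u(x+2\varepsilon)-2u(x)+u(x-2\varepsilon)\bigr)\bigr].$$ Assume that $d:=d_1+4d_2>0$. Let $(c_0,\phi_0)$, with $c_0\in\mathbb R$ and $\phi_0\in C^2(\mathbb R)$, be a solution (it is unique up to translation of $\phi_0$) of $$c\,u'-d\,u''+f_a(u)=0\ \text{ on }\mathbb R,\qquad u(-\infty)=0,\quad u(\infty)=1,$$ and suppose that $c_0\neq0$. Then there exists $\varepsilon^*>0$ such that for every $\varepsilon\in(0,\varepsilon^*)$ the problem $$c\,u'-A_\varepsilon u+f_a(u)=0\ \text{ on }\mathbb R,\qquad u(-\infty)=0,\quad u(\infty)=1,$$ has a solution $(c_\varepsilon,\phi_\varepsilon)$, with $c_\varepsilon\in\mathbb R$, $\phi_\varepsilon\in C^1(\mathbb R)$ and $\phi_\varepsilon-\phi_0\in H^1(\mathbb R)$, such that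 $$\lim_{\varepsilon\to0^+}c_\varepsilon=c_0\qquad\text{and}\qquad\lim_{\varepsilon\to0^+}\|\phi_\varepsilon-\phi_0\|_{H^1(\mathbb R)}=0.$$ -/

import Mathlib

open MeasureTheory Filter Topology
open scoped ENNReal ContDiff

noncomputable section

/-- The cubic nonlinearity `f_a(u) = u (u - a) (u - 1)`. -/
def cubic (a u : ℝ) : ℝ := u * (u - a) * (u - 1)

/-- The scaled difference operator
`(A_ε u)(x) = ε⁻² [d₁ (u(x+ε) - 2u(x) + u(x-ε)) + d₂ (u(x+2ε) - 2u(x) + u(x-2ε))]`. -/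
def latticeOp (d₁ d₂ ε : ℝ) (u : ℝ → ℝ) (x : ℝ) : ℝ :=
  1 / ε ^ 2 * (d₁ * (u (x + ε) - 2 * u x + u (x - ε))
    + d₂ * (u (x + 2 * ε) - 2 * u x + u (x - 2 * ε)))

/-- `(c, u)` is a (classical) solution of the lattice front problem
`c u' - A_ε u + f_a(u) = 0` on `ℝ`, `u(-∞) = 0`, `u(∞) = 1`. -/
structure IsLatticeFront (a d₁ d₂ ε c : ℝ) (u : ℝ → ℝ) : Prop where
  contDiff : ContDiff ℝ 1 u
  equation : ∀ x, c * deriv u x - latticeOp d₁ d₂ ε u x + cubic a (u x) = 0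
  tendsto_atBot : Tendsto u atBot (𝓝 0)
  tendsto_atTop : Tendsto u atTop (𝓝 1)

/-- `(c, u)` is a (classical) solution of the PDE front problem
`c u' - d u'' + f_a(u) = 0` on `ℝ`, `u(-∞) = 0`, `u(∞) = 1`. -/
structure IsPDEFront (a d c : ℝ) (u : ℝ → ℝ) : Prop where
  contDiff : ContDiff ℝ 2 u
  equation : ∀ x, c * deriv u x - d * deriv (deriv u) x + cubic a (u x) = 0
  tendsto_atBot : Tendsto u atBot (𝓝 0)
  tendsto_atTop : Tendsto u atTop (𝓝 1)

/-- `g` is a weak derivative of `w` on `ℝ`: both are locally integrable and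
`∫ w θ' = - ∫ g θ` for every smooth compactly supported `θ`. -/
def IsWeakDeriv (w g : ℝ → ℝ) : Prop :=
  LocallyIntegrable w volume ∧ LocallyIntegrable g volume ∧
    ∀ θ : ℝ → ℝ, ContDiff ℝ ∞ θ → HasCompactSupport θ →
      ∫ x, w x * deriv θ x = - ∫ x, g x * θ x

/-- Membership in the Sobolev space `H¹(ℝ)`. -/
def MemH1 (w : ℝ → ℝ) : Prop :=
  MemLp w 2 volume ∧ ∃ g : ℝ → ℝ, IsWeakDeriv w g ∧ MemLp g 2 volume

/-- The `H¹(ℝ)` norm `(‖w‖²_{L²} + ‖w'‖²_{L²})^{1/2}`, with values in `[0, ∞]`, where `w'` is the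
weak derivative. The weak derivative is unique almost everywhere, so the infimum is over equal
numbers; it is `∞` if there is no weak derivative. -/
def eH1Norm (w : ℝ → ℝ) : ℝ≥0∞ :=
  ⨅ (g : ℝ → ℝ) (_ : IsWeakDeriv w g),
    (eLpNorm w 2 volume ^ 2 + eLpNorm g 2 volume ^ 2) ^ (1 / 2 : ℝ)

end

/-! ### Exponential decay from a logarithmic derivative -/

/-! Write d = d₁ + 4d₂, k = (2d)^(-1/2) and b = 1 - 2a. The argument perturbs from the limit front
φ, with the speed correction γ as an extra unknown.

The limit front is explicit. Comparing u' with κ u (1 - u) gives a first order linear equation for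
the defect whose modes grow at both ends, so a bounded defect with non-negative source must vanish.
This forces c₀ = d k b and φ' = k φ (1 - φ) (`speed_eq`, `isLogistic`). Since 2dk² = 1, the
linearised operator then factors: c₀ ∂ - d ∂² + f_a'(φ) = -d (∂ + k(1 - 2φ - b)) (∂ - k(1 - 2φ)).
The second factor is solvable in L² for every source. The first is solvable when the source is
orthogonal to ψ = e^(-kbx) φ (1 - φ), which is square integrable because |b| < 1. As ∫ ψ φ' > 0,
adding a term γ φ' restores solvability (`exists_linearised_solution`).

The passage to the lattice is singular, because A_ε is bounded and d ∂² is not. It becomes regular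
after putting u = φ + T_ε h and c = c₀ + γ with T_ε = (1 + c₀ ∂ - A_ε)⁻¹, which turns the problem
into h + B T_ε h + γ φ' = R_ε - γ ∂T_ε h - N(T_ε h) on L². Here B is multiplication by f_a'(φ) - 1,
R_ε = A_ε φ - d φ'' is the residual, and N collects the quadratic and cubic terms. Only d > 0 is
known, so the symbol of A_ε may have the wrong sign at high frequency. The imaginary part c₀ · 2πξ
of the denominator controls that range, and this is where c₀ ≠ 0 is needed: T_ε tends to T₀ in
operator norm and ∂T_ε stays bounded (`eventually_norm_inv_latticeDenom_sub_le`, `norm_mul_inv_le`).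

A bounded right inverse at ε = 0 (`exists_rightInverse`) and the contraction principle
(`exists_bordered_solution`) then solve the equation for small ε. Since R_ε = O(ε) in L², both the
speed error and the H¹ error are O(ε). The solution is classical because the equation, divided by
the nonzero speed, expresses u' through continuous functions. -/

theorem eventually_le_exp_of_logDeriv {ψ q : ℝ → ℝ} {L : ℝ}
    (hψ : ∀ x, HasDerivAt ψ (q x * ψ x) x) (hpos : ∀ x, 0 < ψ x)
    (hq : Tendsto q atTop (𝓝 L)) (hL : L < 0) :
    ∃ σ > 0, ∃ C, ∀ᶠ x in atTop, ψ x ≤ C * Real.exp (-σ * x) := by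
  obtain ⟨X, hX⟩ := eventually_atTop.1 (hq.eventually_le_const (show L < L / 2 by linarith))
  -- Beyond `X` the rate is at most `L / 2`, so ψ(x) e^(-Lx/2) is nonincreasing there; the constant
  -- is its value at `X`.
  refine ⟨-(L / 2), by linarith, ψ X * Real.exp (-(L / 2) * X), eventually_atTop.2 ⟨X, fun x hx => ?_⟩⟩
  have hd : ∀ y, HasDerivAt (fun y => ψ y * Real.exp (-(L / 2) * y))
      ((q y - L / 2) * (ψ y * Real.exp (-(L / 2) * y))) y := fun y => by
    have h1 : HasDerivAt (fun y : ℝ => Real.exp (-(L / 2) * y))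
        (Real.exp (-(L / 2) * y) * (-(L / 2) * 1)) y :=
      ((hasDerivAt_id y).const_mul _).exp
    refine ((hψ y).mul h1).congr_deriv ?_
    ring
  have hanti : AntitoneOn (fun y => ψ y * Real.exp (-(L / 2) * y)) (Set.Ici X) := by
    apply antitoneOn_of_deriv_nonpos (convex_Ici X)
    · exact fun y _ => (hd y).continuousAt.continuousWithinAt
    · exact fun y _ => (hd y).differentiableAt.differentiableWithinAt
    · intro y hy
      rw [interior_Ici] at hy
      rw [(hd y).deriv]
      exact mul_nonpos_of_nonpos_of_nonneg (by linarith [hX y hy.le])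
        (mul_pos (hpos y) (Real.exp_pos _)).le
  have h := hanti (Set.mem_Ici.2 le_rfl) hx hx
  simp only at h
  have h2 : Real.exp (-(L / 2) * x) * Real.exp (-(-(L / 2)) * x) = 1 := by
    rw [← Real.exp_add, show -(L / 2) * x + -(-(L / 2)) * x = 0 by ring, Real.exp_zero]
  calc ψ x = ψ x * Real.exp (-(L / 2) * x) * Real.exp (-(-(L / 2)) * x) := by
        rw [mul_assoc, h2, mul_one]
    _ ≤ _ := mul_le_mul_of_nonneg_right h (Real.exp_pos _).le

theorem tendsto_zero_atTop_of_logDeriv {ψ q : ℝ → ℝ} {L : ℝ}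
    (hψ : ∀ x, HasDerivAt ψ (q x * ψ x) x) (hpos : ∀ x, 0 < ψ x)
    (hq : Tendsto q atTop (𝓝 L)) (hL : L < 0) : Tendsto ψ atTop (𝓝 0) := by
  obtain ⟨σ, hσ, C, hC⟩ := eventually_le_exp_of_logDeriv hψ hpos hq hL
  refine tendsto_of_tendsto_of_tendsto_of_le_of_le' tendsto_const_nhds ?_
    (Eventually.of_forall fun x => (hpos x).le) hC
  have : Tendsto (fun x => Real.exp (-σ * x)) atTop (𝓝 0) := by
    apply Real.tendsto_exp_atBot.comp
    exact tendsto_id.const_mul_atTop_of_neg (by linarith)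
  simpa using this.const_mul C

theorem integrableOn_Ioi_of_logDeriv {ψ q : ℝ → ℝ} {L : ℝ}
    (hψ : ∀ x, HasDerivAt ψ (q x * ψ x) x) (hpos : ∀ x, 0 < ψ x)
    (hq : Tendsto q atTop (𝓝 L)) (hL : L < 0) (b : ℝ) : IntegrableOn ψ (Set.Ioi b) := by
  obtain ⟨σ, hσ, C, hC⟩ := eventually_le_exp_of_logDeriv hψ hpos hq hL
  have hcont : Continuous ψ := continuous_iff_continuousAt.2 fun x => (hψ x).continuousAt
  refine integrable_of_isBigO_exp_neg hσ hcont.continuousOn ?_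
  refine Asymptotics.IsBigO.of_bound C ?_
  filter_upwards [hC] with x hx
  rwa [Real.norm_of_nonneg (hpos x).le, Real.norm_of_nonneg (Real.exp_pos _).le]

theorem hasDerivAt_comp_neg_logDeriv {ψ q : ℝ → ℝ} (hψ : ∀ x, HasDerivAt ψ (q x * ψ x) x) (x : ℝ) :
    HasDerivAt (fun x => ψ (-x)) ((-q (-x)) * ψ (-x)) x := by
  refine ((hψ (-x)).comp x (hasDerivAt_neg x)).congr_deriv ?_
  ring

theorem tendsto_zero_atBot_of_logDeriv {ψ q : ℝ → ℝ} {L : ℝ}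
    (hψ : ∀ x, HasDerivAt ψ (q x * ψ x) x) (hpos : ∀ x, 0 < ψ x)
    (hq : Tendsto q atBot (𝓝 L)) (hL : 0 < L) : Tendsto ψ atBot (𝓝 0) := by
  have := tendsto_zero_atTop_of_logDeriv (hasDerivAt_comp_neg_logDeriv hψ) (fun x => hpos (-x))
    (hq.comp tendsto_neg_atTop_atBot).neg (by linarith)
  simpa [Function.comp_def] using this.comp tendsto_neg_atBot_atTop

theorem integrable_of_logDeriv {ψ q : ℝ → ℝ} {L M : ℝ}
    (hψ : ∀ x, HasDerivAt ψ (q x * ψ x) x) (hpos : ∀ x, 0 < ψ x)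
    (hq : Tendsto q atTop (𝓝 L)) (hL : L < 0) (hq' : Tendsto q atBot (𝓝 M)) (hM : 0 < M) :
    Integrable ψ := by
  have h1 := integrableOn_Ioi_of_logDeriv hψ hpos hq hL 0
  have h2 := integrableOn_Ioi_of_logDeriv (hasDerivAt_comp_neg_logDeriv hψ) (fun x => hpos (-x))
    (hq'.comp tendsto_neg_atTop_atBot).neg (by linarith) 0
  have h3 : IntegrableOn ψ (Set.Iio 0) := by
    have := IntegrableOn.comp_neg_Iio (c := 0) (f := fun x => ψ (-x)) (by rwa [neg_zero])
    simpa only [neg_neg] using this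
  rw [← integrableOn_univ, ← Set.Iic_union_Ioi (a := (0 : ℝ))]
  exact ((integrableOn_Iic_iff_integrableOn_Iio).2 h3).union h1

theorem exists_logDeriv_eq {q : ℝ → ℝ} (hq : Continuous q) :
    ∃ η : ℝ → ℝ, (∀ x, 0 < η x) ∧ ∀ x, HasDerivAt η (q x * η x) x := by
  refine ⟨fun x => Real.exp (∫ t in (0 : ℝ)..x, q t), fun x => Real.exp_pos _, fun x => ?_⟩
  have := (intervalIntegral.integral_hasDerivAt_right (hq.intervalIntegrable 0 x)
    (hq.stronglyMeasurableAtFilter _ _) hq.continuousAt).exp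
  rwa [mul_comm] at this

/-- A bounded solution of `V' = q V + r` with `r ≥ 0`, where `q` is positive near `∞` and negative
near `-∞`, vanishes identically. -/
theorem eq_zero_of_bounded_of_growing {V q r : ℝ → ℝ} {L M C : ℝ} (hq : Continuous q)
    (hV : ∀ x, HasDerivAt V (q x * V x + r x) x) (hr : ∀ x, 0 ≤ r x) (hb : ∀ x, |V x| ≤ C)
    (hqt : Tendsto q atTop (𝓝 L)) (hL : 0 < L) (hqb : Tendsto q atBot (𝓝 M)) (hM : M < 0) :
    ∀ x, V x = 0 := by
  -- The integrating factor η = exp(-∫ q) tends to 0 at both ends. Hence η V is monotone, since (η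
  -- V)' = η r ≥ 0, and has limit 0 at both ends.
  obtain ⟨η, hη, hηd⟩ := exists_logDeriv_eq hq.fun_neg
  have ht : Tendsto η atTop (𝓝 0) := tendsto_zero_atTop_of_logDeriv hηd hη hqt.neg (by linarith)
  have hbt : Tendsto η atBot (𝓝 0) := tendsto_zero_atBot_of_logDeriv hηd hη hqb.neg (by linarith)
  have hd : ∀ x, HasDerivAt (fun x => η x * V x) (η x * r x) x := fun x => by
    refine ((hηd x).mul (hV x)).congr_deriv ?_
    ring
  have hmono : Monotone fun x => η x * V x := by
    apply monotone_of_deriv_nonneg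
    · exact fun x => (hd x).differentiableAt
    · intro x
      rw [(hd x).deriv]
      exact mul_nonneg (hη x).le (hr x)
  have hbdd : ∀ l : Filter ℝ, Tendsto η l (𝓝 0) → Tendsto (fun x => η x * V x) l (𝓝 0) := by
    intro l hl
    refine hl.zero_mul_isBoundedUnder_le (isBoundedUnder_of ⟨C, fun x => ?_⟩)
    simpa using hb x
  intro x
  have h1 : η x * V x ≤ 0 := hmono.ge_of_tendsto (hbdd _ ht) x
  have h2 : 0 ≤ η x * V x := hmono.le_of_tendsto (hbdd _ hbt) x
  have h3 : η x * V x = 0 := le_antisymm h1 h2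
  exact (mul_eq_zero.1 h3).resolve_left (hη x).ne'

/-! ### Classification of the PDE fronts -/

/-- An increasing solution of the logistic equation `φ' = k φ (1 - φ)` connecting `0` to `1`. -/
structure IsLogistic (k : ℝ) (φ : ℝ → ℝ) : Prop where
  hasDerivAt : ∀ x, HasDerivAt φ (k * (φ x * (1 - φ x))) x
  pos : ∀ x, 0 < φ x
  lt_one : ∀ x, φ x < 1
  tendsto_atBot : Tendsto φ atBot (𝓝 0)
  tendsto_atTop : Tendsto φ atTop (𝓝 1)

namespace IsPDEFront

variable {a d c : ℝ} {u : ℝ → ℝ}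

theorem hasDerivAt (h : IsPDEFront a d c u) (x : ℝ) : HasDerivAt u (deriv u x) x :=
  (h.contDiff.differentiable (by norm_num) x).hasDerivAt

theorem hasDerivAt_deriv (h : IsPDEFront a d c u) (x : ℝ) :
    HasDerivAt (deriv u) (deriv (deriv u) x) x := by
  have h2 : ContDiff ℝ 1 (deriv u) := (contDiff_succ_iff_deriv (n := 1)).1 (by
    simpa [one_add_one_eq_two] using h.contDiff) |>.2.2
  exact (h2.differentiable (by norm_num) x).hasDerivAt

theorem continuous (h : IsPDEFront a d c u) : Continuous u := h.contDiff.continuous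

/-- A continuous function with finite limits at both ends that exceeds both limits somewhere
attains its maximum. -/
theorem _root_.exists_forall_le_of_tendsto {f : ℝ → ℝ} {l m x₀ : ℝ} (hf : Continuous f)
    (hl : Tendsto f atBot (𝓝 l)) (hm : Tendsto f atTop (𝓝 m)) (h1 : l < f x₀) (h2 : m < f x₀) :
    ∃ x, ∀ y, f y ≤ f x := by
  apply hf.exists_forall_ge' x₀
  rw [cocompact_eq_atBot_atTop]
  exact eventually_sup.2 ⟨hl.eventually_le_const h1, hm.eventually_le_const h2⟩

/-- Maximum principle: at a maximum above 1 the equation gives d u'' = f_a(u) > 0. The point is then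
also a local minimum, so u is locally constant there and u'' = 0, a contradiction. -/
theorem le_one (hd : 0 < d) (ha₁ : a < 1) (h : IsPDEFront a d c u) (x : ℝ) : u x ≤ 1 := by
  by_contra! hx
  obtain ⟨y, hy⟩ := exists_forall_le_of_tendsto h.continuous h.tendsto_atBot h.tendsto_atTop
    (by linarith : 0 < u x) hx
  have hy1 : 1 < u y := hx.trans_le (hy x)
  have hmax : IsLocalMax u y := Eventually.of_forall hy
  have h0 : deriv u y = 0 := hmax.deriv_eq_zero
  have heq := h.equation y
  have hpos : 0 < deriv (deriv u) y := by
    have hf : 0 < cubic a (u y) := by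
      unfold cubic
      exact mul_pos (mul_pos (by linarith) (by linarith)) (by linarith)
    rw [h0] at heq
    by_contra! hn
    nlinarith
  have hmin := isLocalMin_of_deriv_deriv_pos hpos h0 h.continuous.continuousAt
  have hconst : u =ᶠ[𝓝 y] fun _ => u y := by
    filter_upwards [hmin] with z hz
    exact le_antisymm (hy z) hz
  have : deriv (deriv u) y = 0 := by
    have h1 : deriv u =ᶠ[𝓝 y] deriv fun _ => u y := hconst.deriv
    rw [h1.deriv_eq]
    simp
  linarith

/-- Reflection `u ↦ 1 - u(-·)` exchanges `a` with `1 - a` and `c` with `-c`. -/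
theorem reflect (h : IsPDEFront a d c u) : IsPDEFront (1 - a) d (-c) (fun x => 1 - u (-x)) := by
  have h1 : ∀ x, HasDerivAt (fun x => 1 - u (-x)) (deriv u (-x)) x := fun x => by
    refine (((h.hasDerivAt (-x)).comp x (hasDerivAt_neg x)).const_sub 1).congr_deriv ?_
    ring
  have h1' : deriv (fun x => 1 - u (-x)) = fun x => deriv u (-x) := funext fun x => (h1 x).deriv
  have h2 : ∀ x, HasDerivAt (fun x => deriv u (-x)) (-deriv (deriv u) (-x)) x := fun x => by
    refine ((h.hasDerivAt_deriv (-x)).comp x (hasDerivAt_neg x)).congr_deriv ?_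
    ring
  refine ⟨contDiff_const.sub (h.contDiff.comp contDiff_neg), fun x => ?_, ?_, ?_⟩
  · rw [h1', (h2 x).deriv]
    have := h.equation (-x)
    unfold cubic at *
    linear_combination (-1) * this
  · simpa using (h.tendsto_atTop.comp tendsto_neg_atBot_atTop).const_sub 1
  · simpa using (h.tendsto_atBot.comp tendsto_neg_atTop_atBot).const_sub 1

theorem nonneg (hd : 0 < d) (ha₀ : 0 < a) (h : IsPDEFront a d c u) (x : ℝ) : 0 ≤ u x := by
  have := h.reflect.le_one hd (by linarith) (-x)
  simp only [neg_neg] at this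
  linarith

/-- The function d u' - c u has derivative f_a(u), which is bounded by 1 because 0 ≤ u ≤ 1. The mean
value theorem supplies a point of (x, x + 1) where |u'| ≤ 1, and the bound is carried from there to
x. -/
theorem exists_abs_deriv_le (hd : 0 < d) (ha₀ : 0 < a) (ha₁ : a < 1) (h : IsPDEFront a d c u) :
    ∃ C, ∀ x, |deriv u x| ≤ C := by
  have hu : ∀ x, 0 ≤ u x ∧ u x ≤ 1 := fun x => ⟨h.nonneg hd ha₀ x, h.le_one hd ha₁ x⟩
  have hG : ∀ x, HasDerivAt (fun x => d * deriv u x - c * u x) (cubic a (u x)) x := fun x => by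
    refine (((h.hasDerivAt_deriv x).const_mul d).sub ((h.hasDerivAt x).const_mul c)).congr_deriv ?_
    linarith [h.equation x]
  have hf : ∀ x, |cubic a (u x)| ≤ 1 := fun x => by
    obtain ⟨h0, h1⟩ := hu x
    unfold cubic
    rw [abs_mul, abs_mul]
    have e1 : |u x| ≤ 1 := abs_le.2 ⟨by linarith, h1⟩
    have e2 : |u x - a| ≤ 1 := abs_le.2 ⟨by linarith, by linarith⟩
    have e3 : |u x - 1| ≤ 1 := abs_le.2 ⟨by linarith, by linarith⟩
    have e4 := mul_le_one₀ e1 (abs_nonneg _) e2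
    exact mul_le_one₀ e4 (abs_nonneg _) e3
  refine ⟨(d + 2 * |c| + 1) / d, fun x => ?_⟩
  obtain ⟨y, hy, hslope⟩ := exists_deriv_eq_slope u (show x < x + 1 by linarith)
    h.continuous.continuousOn (fun z _ => (h.hasDerivAt z).differentiableAt.differentiableWithinAt)
  have hgg := Convex.norm_image_sub_le_of_norm_hasDerivWithin_le (s := Set.univ) (C := 1)
    (fun z _ => (hG z).hasDerivWithinAt) (fun z _ => hf z) convex_univ (Set.mem_univ y)
    (Set.mem_univ x)
  have hxy : ‖x - y‖ ≤ 1 := by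
    rw [Real.norm_eq_abs, abs_le]
    constructor <;> linarith [hy.1, hy.2]
  have hgg' : |d * deriv u x - c * u x - (d * deriv u y - c * u y)| ≤ 1 := by
    rw [← Real.norm_eq_abs]
    linarith
  have hdy : |deriv u y| ≤ 1 := by
    rw [hslope, add_sub_cancel_left, div_one, abs_le]
    constructor <;> linarith [(hu x).1, (hu x).2, (hu (x + 1)).1, (hu (x + 1)).2]
  have hcu : |c * (u x - u y)| ≤ |c| := by
    rw [abs_mul]
    refine mul_le_of_le_one_right (abs_nonneg _) ?_
    rw [abs_le]
    constructor <;> linarith [(hu x).1, (hu x).2, (hu y).1, (hu y).2]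
  rw [le_div_iff₀ hd]
  have : |deriv u x * d| ≤ 1 + d + |c| := by
    have e : deriv u x * d = (d * deriv u x - c * u x - (d * deriv u y - c * u y)) + d * deriv u y
        + c * (u x - u y) := by ring
    rw [e]
    refine (abs_add_le _ _).trans (add_le_add ((abs_add_le _ _).trans (add_le_add hgg' ?_)) hcu)
    rw [abs_mul, abs_of_pos hd]
    exact mul_le_of_le_one_right hd.le hdy
  rw [abs_mul, abs_of_pos hd] at this
  linarith [abs_nonneg c]

/-- The defect `V = u' - κ u (1 - u)` satisfies a linear first order equation. -/
theorem hasDerivAt_defect (hd : 0 < d) (h : IsPDEFront a d c u) (κ x : ℝ) :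
    HasDerivAt (fun x => deriv u x - κ * (u x * (1 - u x)))
      (((c - d * κ * (1 - 2 * u x)) / d) * (deriv u x - κ * (u x * (1 - u x)))
        + u x * (1 - u x) * (c * κ + a - d * κ ^ 2 + (2 * d * κ ^ 2 - 1) * u x) / d) x := by
  have h1 := h.hasDerivAt x
  refine ((h.hasDerivAt_deriv x).sub ((h1.mul (h1.const_sub 1)).const_mul κ)).congr_deriv ?_
  have h2 : deriv (deriv u) x = (c * deriv u x + cubic a (u x)) / d := by
    field_simp
    linarith [h.equation x]
  rw [h2]
  unfold cubic
  field_simp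
  ring

theorem exists_abs_defect_le (hd : 0 < d) (ha₀ : 0 < a) (ha₁ : a < 1) (h : IsPDEFront a d c u)
    (κ : ℝ) : ∃ C, ∀ x, |deriv u x - κ * (u x * (1 - u x))| ≤ C := by
  obtain ⟨C, hC⟩ := h.exists_abs_deriv_le hd ha₀ ha₁
  refine ⟨C + |κ|, fun x => (abs_sub _ _).trans (add_le_add (hC x) ?_)⟩
  rw [abs_mul]
  refine mul_le_of_le_one_right (abs_nonneg _) ?_
  have h0 := h.nonneg hd ha₀ x
  have h1 := h.le_one hd ha₁ x
  rw [abs_le]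
  constructor <;> nlinarith

/-- If the source term of the defect equation is non-negative, the defect vanishes. -/
theorem defect_eq_zero (hd : 0 < d) (ha₀ : 0 < a) (ha₁ : a < 1) (h : IsPDEFront a d c u) {κ : ℝ}
    (h1 : c < d * κ) (h2 : -c < d * κ)
    (hr : ∀ x, 0 ≤ u x * (1 - u x) * (c * κ + a - d * κ ^ 2 + (2 * d * κ ^ 2 - 1) * u x)) (x : ℝ) :
    deriv u x - κ * (u x * (1 - u x)) = 0 := by
  -- The rate tends to (c + dκ)/d at +∞ and to (c - dκ)/d at -∞; the two hypotheses on `κ` make the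
  -- first positive and the second negative.
  obtain ⟨C, hC⟩ := h.exists_abs_defect_le hd ha₀ ha₁ κ
  refine eq_zero_of_bounded_of_growing (L := (c - d * κ * (1 - 2 * 1)) / d)
    (M := (c - d * κ * (1 - 2 * 0)) / d) ?_ (h.hasDerivAt_defect hd κ)
    (fun x => div_nonneg (hr x) hd.le) hC ?_ ?_ ?_ ?_ x
  · have := h.continuous
    fun_prop
  · exact (((h.tendsto_atTop.const_mul 2).const_sub 1).const_mul _).const_sub c |>.div_const d
  · apply div_pos _ hd
    linarith
  · exact (((h.tendsto_atBot.const_mul 2).const_sub 1).const_mul _).const_sub c |>.div_const d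
  · apply div_neg_of_neg_of_pos _ hd
    linarith

theorem exists_eq_half (h : IsPDEFront a d c u) : ∃ x, u x = 1 / 2 := by
  obtain ⟨x, hx⟩ := (h.tendsto_atBot.eventually_lt_const (show (0 : ℝ) < 1 / 2 by norm_num)).exists
  obtain ⟨y, hy⟩ := (h.tendsto_atTop.eventually_const_lt (show (1 / 2 : ℝ) < 1 by norm_num)).exists
  exact mem_range_of_exists_le_of_exists_ge h.continuous ⟨x, hx.le⟩ ⟨y, hy.le⟩

/-- The front speed is at most the explicit one. -/
theorem speed_le (hd : 0 < d) (ha₀ : 0 < a) (ha₁ : a < 1) (h : IsPDEFront a d c u) {k : ℝ}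
    (hk : 0 < k) (hk2 : 2 * d * k ^ 2 = 1) : c ≤ d * k * (1 - 2 * a) := by
  by_contra! hc
  have hdk : 0 < d * k := mul_pos hd hk
  have hck : 0 < c * k + a - d * k ^ 2 := by nlinarith
  -- Take κ slightly above max(k, c/d). The quantity cκ + a - dκ² is positive at k because c is too
  -- large, and at c/d because it equals a there.
  obtain ⟨κ, hκ1, hκ2, hκ3⟩ : ∃ κ, k < κ ∧ c < d * κ ∧ 0 < c * κ + a - d * κ ^ 2 := by
    set κ₀ := max k (c / d) with hκ₀
    have hpos : 0 < c * κ₀ + a - d * κ₀ ^ 2 := by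
      rcases max_choice k (c / d) with e | e
      · rw [hκ₀, e]; exact hck
      · rw [hκ₀, e]
        field_simp
        nlinarith
    have hcont : Continuous fun κ : ℝ => c * κ + a - d * κ ^ 2 := by fun_prop
    have ev : ∀ᶠ κ in 𝓝[>] κ₀, 0 < c * κ + a - d * κ ^ 2 :=
      (hcont.tendsto κ₀).mono_left nhdsWithin_le_nhds |>.eventually_const_lt hpos
    obtain ⟨κ, h1, h2⟩ := (ev.and self_mem_nhdsWithin).exists
    have h3 : c / d < κ := (le_max_right _ _).trans_lt h2
    rw [div_lt_iff₀ hd] at h3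
    exact ⟨κ, (le_max_left _ _).trans_lt h2, by linarith, h1⟩
  have hkk : 1 ≤ 2 * d * κ ^ 2 := by
    have : k ^ 2 ≤ κ ^ 2 := by gcongr
    nlinarith
  have hbr : ∀ x, 0 < c * κ + a - d * κ ^ 2 + (2 * d * κ ^ 2 - 1) * u x := fun x => by
    have := mul_nonneg (sub_nonneg.2 hkk) (h.nonneg hd ha₀ x)
    linarith
  have hdκ : d * k < d * κ := by gcongr
  have hr : ∀ x, 0 ≤ u x * (1 - u x) * (c * κ + a - d * κ ^ 2 + (2 * d * κ ^ 2 - 1) * u x) :=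
    fun x => mul_nonneg (mul_nonneg (h.nonneg hd ha₀ x) (by linarith [h.le_one hd ha₁ x])) (hbr x).le
  have hz := h.defect_eq_zero hd ha₀ ha₁ hκ2 (by nlinarith) hr
  -- The defect vanishes identically, so its equation forces the source to vanish too; but the
  -- source is positive where u = 1/2.
  obtain ⟨x, hx⟩ := h.exists_eq_half
  have h1 := (h.hasDerivAt_defect hd κ x)
  have h2 : (fun x => deriv u x - κ * (u x * (1 - u x))) = fun _ => 0 := funext hz
  rw [hz x, h2] at h1
  have h3 := h1.unique (hasDerivAt_const x 0)
  have h4 := hbr x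
  rw [hx] at h3 h4
  have : 0 < 0 + 1 / 2 * (1 - 1 / 2) * (c * κ + a - d * κ ^ 2 + (2 * d * κ ^ 2 - 1) * (1 / 2)) / d := by
    rw [zero_add]
    positivity
  linarith

/-- The reverse inequality is the upper bound for the reflected front, whose parameters are 1 - a
and -c. -/
theorem speed_eq (hd : 0 < d) (ha₀ : 0 < a) (ha₁ : a < 1) (h : IsPDEFront a d c u) {k : ℝ}
    (hk : 0 < k) (hk2 : 2 * d * k ^ 2 = 1) : c = d * k * (1 - 2 * a) := by
  refine le_antisymm (h.speed_le hd ha₀ ha₁ hk hk2) ?_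
  have := h.reflect.speed_le hd (by linarith) (by linarith) hk hk2
  linarith

/-- Such a function is a constant multiple of a positive exponential, and the limit 1 decides the
sign of the constant. -/
theorem _root_.pos_of_logDeriv_of_tendsto {f q : ℝ → ℝ} {l : Filter ℝ} [l.NeBot]
    (hq : Continuous q) (hf : ∀ x, HasDerivAt f (q x * f x) x) (h1 : Tendsto f l (𝓝 1)) (x : ℝ) :
    0 < f x := by
  obtain ⟨g, hg, hgd⟩ := exists_logDeriv_eq hq
  have hconst : ∀ x y, f x / g x = f y / g y := by
    have hdd : ∀ x, HasDerivAt (fun x => f x / g x) 0 x := fun x => by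
      refine ((hf x).div (hgd x) (hg x).ne').congr_deriv ?_
      ring
    exact is_const_of_deriv_eq_zero (fun x => (hdd x).differentiableAt) fun x => (hdd x).deriv
  obtain ⟨y, hy⟩ := (h1.eventually_const_lt (show (0 : ℝ) < 1 by norm_num)).exists
  have h2 : 0 < f x / g x := by
    rw [hconst x y]
    exact div_pos hy (hg y)
  exact (div_pos_iff_of_pos_right (hg x)).1 h2

/-- Every front of the PDE is a logistic profile, with the explicit speed. -/
theorem isLogistic (hd : 0 < d) (ha₀ : 0 < a) (ha₁ : a < 1) (h : IsPDEFront a d c u) {k : ℝ}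
    (hk : 0 < k) (hk2 : 2 * d * k ^ 2 = 1) : IsLogistic k u := by
  have hc := h.speed_eq hd ha₀ ha₁ hk hk2
  have hdk : 0 < d * k := mul_pos hd hk
  -- At κ = k both coefficients in the source of the defect equation vanish.
  have hbr : c * k + a - d * k ^ 2 = 0 := by rw [hc]; linear_combination (-a) * hk2
  have hz := h.defect_eq_zero hd ha₀ ha₁ (κ := k) (by nlinarith) (by nlinarith) (fun x => by
    rw [hbr, hk2]; simp)
  have hu : ∀ x, HasDerivAt u (k * (u x * (1 - u x))) x := fun x => by
    rw [← sub_eq_zero.1 (hz x)]; exact h.hasDerivAt x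
  have hcont := h.continuous
  refine ⟨hu, ?_, ?_, h.tendsto_atBot, h.tendsto_atTop⟩
  · refine pos_of_logDeriv_of_tendsto (q := fun x => k * (1 - u x)) (by fun_prop) (fun x => ?_)
      h.tendsto_atTop
    exact (hu x).congr_deriv (by ring)
  · have : ∀ x, 0 < 1 - u x := by
      refine pos_of_logDeriv_of_tendsto (q := fun x => - (k * u x)) (l := atBot) (by fun_prop)
        (fun x => ?_) ?_
      · exact ((hu x).const_sub 1).congr_deriv (by ring)
      · simpa using h.tendsto_atBot.const_sub 1
    exact fun x => by linarith [this x]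

end IsPDEFront

/-! ### Energy estimates for first order equations -/

/-- Energy method: F will be a weight times z². Its boundary values are kept, to be sent to zero or
discarded by sign. -/
theorem intervalIntegral_sq_le_of_deriv_le {F F' z r : ℝ → ℝ} {δ K a b : ℝ} (hab : a ≤ b)
    (hF : ∀ x, HasDerivAt F (F' x) x) (hF' : Continuous F') (hz : Continuous z)
    (hr : Continuous r)
    (hle : ∀ x ∈ Set.Icc a b, F' x ≤ -δ * z x ^ 2 + K * r x ^ 2) :
    δ * ∫ x in a..b, z x ^ 2 ≤ K * (∫ x in a..b, r x ^ 2) + (F a - F b) := by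
  have h1 := intervalIntegral.integral_eq_sub_of_hasDerivAt (fun x _ => hF x)
    (hF'.intervalIntegrable a b)
  have i1 : IntervalIntegrable (fun x => -δ * z x ^ 2) volume a b :=
    (by fun_prop : Continuous fun x => -δ * z x ^ 2).intervalIntegrable a b
  have i2 : IntervalIntegrable (fun x => K * r x ^ 2) volume a b :=
    (by fun_prop : Continuous fun x => K * r x ^ 2).intervalIntegrable a b
  have h2 := intervalIntegral.integral_mono_on hab (hF'.intervalIntegrable a b) (i1.add i2) hle
  rw [h1, intervalIntegral.integral_add i1 i2, intervalIntegral.integral_const_mul,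
    intervalIntegral.integral_const_mul] at h2
  linarith

/-- The error e(R) carries the boundary terms of the energy estimate; it disappears in the limit, so
the final bound is M itself. -/
theorem integrable_of_intervalIntegral_le_add {f e : ℝ → ℝ} {M : ℝ} (hf : Continuous f)
    (hf0 : ∀ x, 0 ≤ f x) (he : Tendsto e atTop (𝓝 0))
    (h : ∀ᶠ R in atTop, ∫ x in -R..R, f x ≤ M + e R) : Integrable f ∧ ∫ x, f x ≤ M := by
  have hint : Integrable f := by
    refine integrable_of_intervalIntegral_norm_bounded (M + 1)
      (fun R => (hf.integrableOn_Ioc)) tendsto_neg_atTop_atBot tendsto_id ?_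
    filter_upwards [h, he.eventually_le_const (show (0 : ℝ) < 1 by norm_num)] with R h1 h2
    simp only [Real.norm_of_nonneg (hf0 _), id]
    linarith
  refine ⟨hint, ?_⟩
  have h1 := intervalIntegral_tendsto_integral hint tendsto_neg_atTop_atBot tendsto_id
  have h2 : Tendsto (fun R => M + e R) atTop (𝓝 (M + 0)) := he.const_add M
  rw [add_zero] at h2
  exact le_of_tendsto_of_tendsto h1 h2 h

theorem intervalIntegral_sq_le_integral {r : ℝ → ℝ} (hr : Integrable fun x => r x ^ 2) {a b : ℝ}
    (hab : a ≤ b) : ∫ x in a..b, r x ^ 2 ≤ ∫ x, r x ^ 2 := by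
  rw [intervalIntegral.integral_of_le hab]
  exact setIntegral_le_integral hr (Eventually.of_forall fun x => sq_nonneg _)

theorem integrable_mul_of_sq {f g : ℝ → ℝ} (hf : Continuous f) (hg : Continuous g)
    (hf2 : Integrable fun x => f x ^ 2) (hg2 : Integrable fun x => g x ^ 2) :
    Integrable fun x => f x * g x := by
  refine (hf2.add hg2).mono' (hf.mul hg).aestronglyMeasurable (Eventually.of_forall fun x => ?_)
  rw [Real.norm_eq_abs, abs_le]
  simp only [Pi.add_apply]
  constructor <;> nlinarith [sq_nonneg (f x + g x), sq_nonneg (f x - g x)]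

theorem sq_integral_mul_le {f g : ℝ → ℝ} (hf : Continuous f) (hg : Continuous g)
    (hf2 : Integrable fun x => f x ^ 2) (hg2 : Integrable fun x => g x ^ 2) :
    (∫ x, f x * g x) ^ 2 ≤ (∫ x, f x ^ 2) * ∫ x, g x ^ 2 := by
  have hfg := integrable_mul_of_sq hf hg hf2 hg2
  have key : ∀ s : ℝ, 0 ≤ (∫ x, f x ^ 2) * (s * s) + (2 * ∫ x, f x * g x) * s + ∫ x, g x ^ 2 := by
    intro s
    have h0 : 0 ≤ ∫ x, (s * f x + g x) ^ 2 := integral_nonneg fun x => sq_nonneg _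
    have e : (fun x => (s * f x + g x) ^ 2)
        = fun x => (s * s) * f x ^ 2 + (2 * s) * (f x * g x) + g x ^ 2 := by
      funext x; ring
    have i1 : Integrable fun x => (s * s) * f x ^ 2 := hf2.const_mul _
    have i2 : Integrable fun x => (2 * s) * (f x * g x) := hfg.const_mul _
    have i3 : Integrable fun x => (s * s) * f x ^ 2 + (2 * s) * (f x * g x) := i1.add i2
    rw [e, integral_add i3 hg2, integral_add i1 i2, integral_const_mul,
      integral_const_mul] at h0
    linarith
  have := discrim_le_zero key
  unfold discrim at this
  nlinarith

/-! ### The two first order factors of the linearised operator. -/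

namespace IsLogistic

variable {k b : ℝ} {φ : ℝ → ℝ}

theorem continuous (h : IsLogistic k φ) : Continuous φ :=
  continuous_iff_continuousAt.2 fun x => (h.hasDerivAt x).continuousAt

theorem hasDerivAt_mul_one_sub (h : IsLogistic k φ) (x : ℝ) :
    HasDerivAt (fun x => φ x * (1 - φ x)) (k * (1 - 2 * φ x) * (φ x * (1 - φ x))) x :=
  ((h.hasDerivAt x).mul ((h.hasDerivAt x).const_sub 1)).congr_deriv (by ring)

theorem mul_one_sub_pos (h : IsLogistic k φ) (x : ℝ) : 0 < φ x * (1 - φ x) :=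
  mul_pos (h.pos x) (by linarith [h.lt_one x])

/-- The kernel of the adjoint of the linearised operator: `e^{-kbx} φ (1 - φ)`. -/
theorem hasDerivAt_adjointKernel (h : IsLogistic k φ) (b x : ℝ) :
    HasDerivAt (fun x => Real.exp (-(k * b) * x) * (φ x * (1 - φ x)))
      (k * (1 - 2 * φ x - b) * (Real.exp (-(k * b) * x) * (φ x * (1 - φ x)))) x := by
  have h1 : HasDerivAt (fun y : ℝ => Real.exp (-(k * b) * y))
      (Real.exp (-(k * b) * x) * (-(k * b) * 1)) x := ((hasDerivAt_id x).const_mul _).exp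
  exact (h1.mul (h.hasDerivAt_mul_one_sub x)).congr_deriv (by ring)

theorem adjointKernel_pos (h : IsLogistic k φ) (b x : ℝ) :
    0 < Real.exp (-(k * b) * x) * (φ x * (1 - φ x)) :=
  mul_pos (Real.exp_pos _) (h.mul_one_sub_pos x)

theorem tendsto_rate_atTop (h : IsLogistic k φ) (b : ℝ) :
    Tendsto (fun x => k * (1 - 2 * φ x - b)) atTop (𝓝 (k * (1 - 2 * 1 - b))) :=
  (((h.tendsto_atTop.const_mul 2).const_sub 1).sub_const b).const_mul k

theorem tendsto_rate_atBot (h : IsLogistic k φ) (b : ℝ) :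
    Tendsto (fun x => k * (1 - 2 * φ x - b)) atBot (𝓝 (k * (1 - 2 * 0 - b))) :=
  (((h.tendsto_atBot.const_mul 2).const_sub 1).sub_const b).const_mul k

/-- The logarithmic derivative of the kernel tends to k(-1 - b) at +∞ and to k(1 - b) at -∞; |b| < 1
makes these negative and positive, hence exponential decay at both ends. -/
theorem integrable_adjointKernel_sq (h : IsLogistic k φ) (hk : 0 < k) (hb : |b| < 1) :
    Integrable fun x => (Real.exp (-(k * b) * x) * (φ x * (1 - φ x))) ^ 2 := by
  obtain ⟨hb1, hb2⟩ := abs_lt.1 hb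
  refine integrable_of_logDeriv (q := fun x => 2 * (k * (1 - 2 * φ x - b))) (fun x => ?_)
    (fun x => pow_pos (h.adjointKernel_pos b x) 2)
    ((h.tendsto_rate_atTop b).const_mul 2) ?_ ((h.tendsto_rate_atBot b).const_mul 2) ?_
  · exact ((h.hasDerivAt_adjointKernel b x).pow 2).congr_deriv (by norm_num; ring)
  · nlinarith
  · nlinarith

theorem integrable_mul_one_sub_sq (h : IsLogistic k φ) (hk : 0 < k) :
    Integrable fun x => (φ x * (1 - φ x)) ^ 2 := by
  simpa using h.integrable_adjointKernel_sq (b := 0) hk (by norm_num)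

theorem continuous_adjointKernel (h : IsLogistic k φ) (b : ℝ) :
    Continuous fun x => Real.exp (-(k * b) * x) * (φ x * (1 - φ x)) := by
  have := h.continuous
  fun_prop

/-- `y' + k (1 - 2φ - b) y = r` has a square integrable solution when `r` is orthogonal to the
adjoint kernel, with an a priori bound. -/
theorem exists_sq_integrable_solution_of_orthogonal (h : IsLogistic k φ) (hk : 0 < k)
    (hb : |b| < 1) : ∃ K, 0 ≤ K ∧ ∀ r : ℝ → ℝ, Continuous r → Tendsto r atBot (𝓝 0) →
      Tendsto r atTop (𝓝 0) → Integrable (fun x => r x ^ 2) →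
      ∫ x, (Real.exp (-(k * b) * x) * (φ x * (1 - φ x))) * r x = 0 →
      ∃ y : ℝ → ℝ, (∀ x, HasDerivAt y (r x - k * (1 - 2 * φ x - b) * y x) x) ∧
        Integrable (fun x => y x ^ 2) ∧ ∫ x, y x ^ 2 ≤ K * ∫ x, r x ^ 2 := by
  obtain ⟨hb1, hb2⟩ := abs_lt.1 hb
  have hφ := h.continuous
  set ψ : ℝ → ℝ := fun x => Real.exp (-(k * b) * x) * (φ x * (1 - φ x)) with hψdef
  have hψd : ∀ x, HasDerivAt ψ (k * (1 - 2 * φ x - b) * ψ x) x := h.hasDerivAt_adjointKernel b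
  have hψ0 : ∀ x, 0 < ψ x := h.adjointKernel_pos b
  have hψc : Continuous ψ := h.continuous_adjointKernel b
  have hψ2 : Integrable fun x => ψ x ^ 2 := h.integrable_adjointKernel_sq hk hb
  have htopneg : k * (1 - 2 * 1 - b) < 0 := by nlinarith
  have hbotpos : 0 < k * (1 - 2 * 0 - b) := by nlinarith
  have hψt : Tendsto ψ atTop (𝓝 0) :=
    tendsto_zero_atTop_of_logDeriv hψd hψ0 (h.tendsto_rate_atTop b) htopneg
  have hψb : Tendsto ψ atBot (𝓝 0) :=
    tendsto_zero_atBot_of_logDeriv hψd hψ0 (h.tendsto_rate_atBot b) hbotpos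
  set β := 1 - |b| with hβ
  have hβ0 : 0 < β := by linarith
  -- With t = 1 - 2φ and F = (t - b) y², the quadratic part of F' is -2k ((t - b)² + (1 - t²)/4) y².
  -- The bracket stays positive because |b| < 1 keeps the second term away from 0 when t is near b.
  have hquad : ∀ t : ℝ, |t| ≤ 1 → β ^ 2 / 8 ≤ (t - b) ^ 2 + (1 - t ^ 2) / 4 := by
    intro t ht
    have ht2 : t ^ 2 ≤ |t| := by rw [← sq_abs]; nlinarith [abs_nonneg t]
    have hβ1 : β ≤ 1 := by linarith [abs_nonneg b]
    rcases le_total (β / 2) |t - b| with h1 | h1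
    · have : (β / 2) ^ 2 ≤ (t - b) ^ 2 := by rw [← sq_abs (t - b)]; gcongr
      nlinarith
    · have h2 : |t| ≤ |b| + |t - b| := by
        have := abs_add_le b (t - b)
        rwa [add_sub_cancel] at this
      nlinarith [sq_nonneg (t - b)]
  set δ := k * (β ^ 2 / 8) with hδ
  have hδ0 : 0 < δ := by positivity
  refine ⟨4 / δ / δ, by positivity, fun r hr hrb hrt hr2 horth => ?_⟩
  have hψr : Integrable fun x => ψ x * r x := integrable_mul_of_sq hψc hr hψ2 hr2
  have hψrc : Continuous fun x => ψ x * r x := hψc.mul hr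
  -- N(x) is the integral of ψ r over (-∞, x]. It vanishes at -∞ by construction and at +∞ by
  -- orthogonality, and y = N / ψ is the solution.
  set N : ℝ → ℝ := fun x => (∫ u in Set.Iic 0, ψ u * r u) + ∫ u in (0 : ℝ)..x, ψ u * r u with hN
  have hNd : ∀ x, HasDerivAt N (ψ x * r x) x := fun x =>
    (intervalIntegral.integral_hasDerivAt_right (hψrc.intervalIntegrable 0 x)
      (hψrc.stronglyMeasurableAtFilter _ _) hψrc.continuousAt).const_add _
  have hNb : Tendsto N atBot (𝓝 0) := by
    have h1 := intervalIntegral_tendsto_integral_Iic 0 hψr.integrableOn tendsto_id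
    have h2 := h1.const_sub (∫ u in Set.Iic 0, ψ u * r u)
    rw [sub_self] at h2
    refine h2.congr fun x => ?_
    rw [hN, intervalIntegral.integral_symm 0 (id x), sub_eq_add_neg]
    simp
  have hNt : Tendsto N atTop (𝓝 0) := by
    have h1 := intervalIntegral_tendsto_integral_Ioi 0 hψr.integrableOn tendsto_id
    have h2 := h1.const_add (∫ u in Set.Iic 0, ψ u * r u)
    rw [intervalIntegral.integral_Iic_add_Ioi hψr.integrableOn hψr.integrableOn, horth] at h2
    exact h2
  set y : ℝ → ℝ := fun x => N x / ψ x with hy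
  have hyd : ∀ x, HasDerivAt y (r x - k * (1 - 2 * φ x - b) * y x) x := fun x => by
    refine ((hNd x).div (hψd x) (hψ0 x).ne').congr_deriv ?_
    have := (hψ0 x).ne'
    simp only [hy]
    field_simp
  -- By l'Hôpital, N / ψ has the limit of N' / ψ' = r / (k(1 - 2φ - b)), which is 0. This removes
  -- the boundary terms of F.
  have hyt : Tendsto y atTop (𝓝 0) := by
    refine HasDerivAt.lhopital_zero_atTop (Eventually.of_forall hNd) (Eventually.of_forall hψd) ?_
      hNt hψt ?_
    · filter_upwards [(h.tendsto_rate_atTop b).eventually_lt_const htopneg] with x hx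
      exact mul_ne_zero hx.ne (hψ0 x).ne'
    · have := hrt.div (h.tendsto_rate_atTop b) htopneg.ne
      rw [zero_div] at this
      refine this.congr fun x => ?_
      rw [mul_comm (ψ x), mul_div_mul_right _ _ (hψ0 x).ne']
      rfl
  have hyb : Tendsto y atBot (𝓝 0) := by
    refine HasDerivAt.lhopital_zero_atBot (Eventually.of_forall hNd) (Eventually.of_forall hψd) ?_
      hNb hψb ?_
    · filter_upwards [(h.tendsto_rate_atBot b).eventually_const_lt hbotpos] with x hx
      exact mul_ne_zero hx.ne' (hψ0 x).ne'
    · have := hrb.div (h.tendsto_rate_atBot b) hbotpos.ne'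
      rw [zero_div] at this
      refine this.congr fun x => ?_
      rw [mul_comm (ψ x), mul_div_mul_right _ _ (hψ0 x).ne']
      rfl
  have hyc : Continuous y := continuous_iff_continuousAt.2 fun x => (hyd x).continuousAt
  set F : ℝ → ℝ := fun x => (1 - 2 * φ x - b) * y x ^ 2 with hF
  have hFd : ∀ x, HasDerivAt F (-(2 * (k * (φ x * (1 - φ x)))) * y x ^ 2
      + (1 - 2 * φ x - b) * (2 * y x * (r x - k * (1 - 2 * φ x - b) * y x))) x := fun x => by
    refine (((((h.hasDerivAt x).const_mul 2).const_sub 1).sub_const b).mul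
      ((hyd x).pow 2)).congr_deriv ?_
    norm_num
  have hFlim : Tendsto (fun R => (F (-R) - F R) / δ) atTop (𝓝 0) := by
    have h1 : Tendsto F atTop (𝓝 0) := by
      have := (((h.tendsto_atTop.const_mul 2).const_sub 1).sub_const b).mul (hyt.pow 2)
      simpa using this
    have h2 : Tendsto F atBot (𝓝 0) := by
      have := (((h.tendsto_atBot.const_mul 2).const_sub 1).sub_const b).mul (hyb.pow 2)
      simpa using this
    simpa using ((h2.comp tendsto_neg_atTop_atBot).sub h1).div_const δ
  have hres := integrable_of_intervalIntegral_le_add (M := 4 / δ / δ * ∫ x, r x ^ 2) (f := fun x => y x ^ 2)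
    (by fun_prop) (fun x => sq_nonneg _) hFlim ?_
  · exact ⟨y, hyd, hres⟩
  filter_upwards [eventually_ge_atTop 0] with R hR
  have h1 := intervalIntegral_sq_le_of_deriv_le (show -R ≤ R by linarith) hFd (by fun_prop) hyc hr
    (δ := δ) (K := 4 / δ) fun x _ => by
      have hp := h.pos x
      have hl := h.lt_one x
      have hq := hquad (1 - 2 * φ x) (abs_le.2 ⟨by linarith, by linarith⟩)
      set τ := 1 - 2 * φ x - b with hτ
      have hτ2 : τ ^ 2 ≤ 4 := by
        have e1 : -2 ≤ τ := by linarith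
        have e2 : τ ≤ 2 := by linarith
        nlinarith
      have hy2 := sq_nonneg (y x)
      have e1 : δ * y x ^ 2 ≤ k * (τ ^ 2 + φ x * (1 - φ x)) * y x ^ 2 := by
        refine mul_le_mul_of_nonneg_right ?_ hy2
        rw [hδ]
        refine mul_le_mul_of_nonneg_left ?_ hk.le
        nlinarith
      -- Young's inequality spends one of the two copies of δ y² supplied by the coercivity.
      have e2 : 2 * (τ * y x * r x) ≤ δ * y x ^ 2 + 4 / δ * r x ^ 2 := by
        have e3 : 2 * (τ * y x * r x) ≤ δ * y x ^ 2 + (τ * r x) ^ 2 / δ := by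
          have : 0 ≤ (δ * y x - τ * r x) ^ 2 / δ := by positivity
          have e4 : (δ * y x - τ * r x) ^ 2 / δ
              = δ * y x ^ 2 - 2 * (τ * y x * r x) + (τ * r x) ^ 2 / δ := by
            field_simp
            ring
          linarith
        have e5 : (τ * r x) ^ 2 / δ ≤ 4 / δ * r x ^ 2 := by
          rw [mul_pow, div_mul_eq_mul_div]
          gcongr
        linarith
      nlinarith
  have h2 := intervalIntegral_sq_le_integral hr2 (show -R ≤ R by linarith)
  have h3 : ∫ x in -R..R, y x ^ 2 ≤ (4 / δ * (∫ x in -R..R, r x ^ 2) + (F (-R) - F R)) / δ := by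
    rw [le_div_iff₀ hδ0]
    linarith
  refine h3.trans ?_
  rw [add_div, mul_div_right_comm]
  gcongr

theorem exists_eq_half (h : IsLogistic k φ) : ∃ x, φ x = 1 / 2 := by
  obtain ⟨x, hx⟩ := (h.tendsto_atBot.eventually_lt_const (show (0 : ℝ) < 1 / 2 by norm_num)).exists
  obtain ⟨y, hy⟩ := (h.tendsto_atTop.eventually_const_lt (show (1 / 2 : ℝ) < 1 by norm_num)).exists
  exact mem_range_of_exists_le_of_exists_ge h.continuous ⟨x, hx.le⟩ ⟨y, hy.le⟩

theorem monotone (h : IsLogistic k φ) (hk : 0 < k) : Monotone φ := by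
  apply monotone_of_deriv_nonneg (fun x => (h.hasDerivAt x).differentiableAt)
  intro x
  rw [(h.hasDerivAt x).deriv]
  exact mul_nonneg hk.le (h.mul_one_sub_pos x).le

/-- `z' - k (1 - 2φ) z = y` has a square integrable solution, with an a priori bound. -/
theorem exists_sq_integrable_solution (h : IsLogistic k φ) (hk : 0 < k) :
    ∃ K, 0 ≤ K ∧ ∀ y : ℝ → ℝ, Continuous y → Integrable (fun x => y x ^ 2) →
      ∃ z : ℝ → ℝ, (∀ x, HasDerivAt z (y x + k * (1 - 2 * φ x) * z x) x) ∧
        Integrable (fun x => z x ^ 2) ∧ ∫ x, z x ^ 2 ≤ K * ∫ x, y x ^ 2 := by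
  obtain ⟨x₀, hx₀⟩ := h.exists_eq_half
  have hφ := h.continuous
  have hmono := h.monotone hk
  refine ⟨2 * (36 / k / (k / 4)), by positivity, fun y hy hy2 => ?_⟩
  set p : ℝ → ℝ := fun x => φ x * (1 - φ x) with hp
  have hp0 : ∀ x, 0 < p x := h.mul_one_sub_pos
  have hpc : Continuous p := by fun_prop
  have hqc : Continuous fun x => y x / p x := hy.div hpc fun x => (hp0 x).ne'
  -- Variation of constants with the homogeneous solution φ(1 - φ), which decays at both ends, so no
  -- orthogonality is needed. Starting where φ = 1/2 gives z = 0 at the point where the rate changes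
  -- sign.
  set z : ℝ → ℝ := fun x => p x * ∫ u in x₀..x, y u / p u with hz
  have hzd : ∀ x, HasDerivAt z (y x + k * (1 - 2 * φ x) * z x) x := fun x => by
    refine ((h.hasDerivAt_mul_one_sub x).mul
      (intervalIntegral.integral_hasDerivAt_right (hqc.intervalIntegrable x₀ x)
      (hqc.stronglyMeasurableAtFilter _ _) hqc.continuousAt)).congr_deriv ?_
    have := (hp0 x).ne'
    simp only [hz]
    change _ + p x * _ = _
    field_simp
    ring
  have hz0 : z x₀ = 0 := by simp [hz]
  have hzc : Continuous z := continuous_iff_continuousAt.2 fun x => (hzd x).continuousAt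
  -- The weight is used with m = 2 to the right of x₀ and m = -2 to the left. It is then positive,
  -- respectively negative, so the outer boundary term has a favourable sign; the inner one vanishes
  -- with z(x₀).
  have hFd : ∀ m x, HasDerivAt (fun x => (m + (1 - 2 * φ x)) * z x ^ 2)
      (-(2 * (k * (φ x * (1 - φ x)))) * z x ^ 2
      + (m + (1 - 2 * φ x)) * (2 * z x * (y x + k * (1 - 2 * φ x) * z x))) x := fun m x => by
    refine (((((h.hasDerivAt x).const_mul 2).const_sub 1).const_add m).mul
      ((hzd x).pow 2)).congr_deriv ?_
    norm_num
  have young : ∀ τ t P A B : ℝ, |τ| ≤ 3 → k / 4 ≤ 2 * k * P - 2 * k * (τ * t) - k / 4 →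
      -(2 * (k * P)) * A ^ 2 + τ * (2 * A * (B + k * t * A)) ≤ -(k / 4) * A ^ 2 + 36 / k * B ^ 2 := by
    intro τ t P A B hτ hP
    have hτ2 : τ ^ 2 ≤ 9 := by
      rw [← sq_abs]
      nlinarith [abs_nonneg τ]
    have e1 : 2 * (τ * A * B) ≤ k / 4 * A ^ 2 + 36 / k * B ^ 2 := by
      have e2 : 0 ≤ (k / 2 * A - 2 * τ * B) ^ 2 / k := by positivity
      have e3 : (k / 2 * A - 2 * τ * B) ^ 2 / k
          = k / 4 * A ^ 2 - 2 * (τ * A * B) + 4 * τ ^ 2 / k * B ^ 2 := by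
        field_simp
        ring
      have e4 : 4 * τ ^ 2 / k * B ^ 2 ≤ 36 / k * B ^ 2 := by
        gcongr
        linarith
      linarith
    have e5 := mul_le_mul_of_nonneg_right hP (sq_nonneg A)
    nlinarith
  have half : ∀ u v : ℝ, u ≤ v → (k / 4 * ∫ x in u..v, z x ^ 2) ≤ 36 / k * (∫ x in u..v, y x ^ 2) →
      ∫ x in u..v, z x ^ 2 ≤ 36 / k / (k / 4) * ∫ x, y x ^ 2 := by
    intro u v huv hh
    have h2 := intervalIntegral_sq_le_integral hy2 huv
    have h3 : ∫ x in u..v, z x ^ 2 ≤ (36 / k * ∫ x in u..v, y x ^ 2) / (k / 4) := by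
      rw [le_div_iff₀ (by positivity)]
      linarith
    refine h3.trans ?_
    rw [mul_div_right_comm]
    gcongr
  have hres := integrable_of_intervalIntegral_le_add (M := 2 * (36 / k / (k / 4)) * ∫ x, y x ^ 2)
    (f := fun x => z x ^ 2) (by fun_prop) (fun x => sq_nonneg _) tendsto_const_nhds ?_
  · exact ⟨z, hzd, hres⟩
  filter_upwards [eventually_ge_atTop |x₀|] with R hR
  obtain ⟨hR1, hR2⟩ := abs_le.1 hR
  have hzi : ∀ u v, IntervalIntegrable (fun x => z x ^ 2) volume u v := fun u v =>
    (by fun_prop : Continuous fun x => z x ^ 2).intervalIntegrable u v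
  have hright := half x₀ R hR2 (by
    have := intervalIntegral_sq_le_of_deriv_le hR2 (hFd 2) (by fun_prop) hzc hy
      (δ := k / 4) (K := 36 / k) fun x hx => by
        have h1 : 1 / 2 ≤ φ x := hx₀ ▸ hmono hx.1
        have h2 := h.lt_one x
        refine young _ _ _ _ _ (abs_le.2 ⟨by linarith, by linarith⟩) ?_
        nlinarith [mul_nonneg (mul_nonneg hk.le (sub_nonneg.2 h1)) (sub_nonneg.2 h2.le)]
    rw [hz0] at this
    have h3 : 0 ≤ (2 + (1 - 2 * φ R)) * z R ^ 2 :=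
      mul_nonneg (by linarith [h.lt_one R]) (sq_nonneg _)
    linarith)
  have hleft := half (-R) x₀ hR1 (by
    have := intervalIntegral_sq_le_of_deriv_le hR1 (hFd (-2)) (by fun_prop) hzc hy
      (δ := k / 4) (K := 36 / k) fun x hx => by
        have h1 : φ x ≤ 1 / 2 := hx₀ ▸ hmono hx.2
        have h2 := h.pos x
        refine young _ _ _ _ _ (abs_le.2 ⟨by linarith, by linarith⟩) ?_
        nlinarith [mul_nonneg (mul_nonneg hk.le (sub_nonneg.2 h1)) h2.le]
    rw [hz0] at this
    have h3 : (-2 + (1 - 2 * φ (-R))) * z (-R) ^ 2 ≤ 0 :=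
      mul_nonpos_of_nonpos_of_nonneg (by linarith [h.pos (-R)]) (sq_nonneg _)
    linarith)
  rw [← intervalIntegral.integral_add_adjacent_intervals (hzi (-R) x₀) (hzi x₀ R)]
  linarith

end IsLogistic

/-! ### Solvability of the second order linearised equation. -/

namespace IsLogistic

variable {k d a : ℝ} {φ : ℝ → ℝ}

theorem integrable_sq_bdd_mul {f q : ℝ → ℝ} {C : ℝ} (hf : Continuous f) (hq : Continuous q)
    (hC : ∀ x, |q x| ≤ C) (hf2 : Integrable fun x => f x ^ 2) :
    Integrable fun x => (q x * f x) ^ 2 := by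
  refine (hf2.const_mul (C ^ 2)).mono' (by fun_prop) (Eventually.of_forall fun x => ?_)
  rw [Real.norm_of_nonneg (sq_nonneg _), mul_pow]
  have := hC x
  refine mul_le_mul_of_nonneg_right ?_ (sq_nonneg _)
  rw [← sq_abs]
  gcongr

theorem integrable_sq_add {f g : ℝ → ℝ} (hf : Continuous f) (hg : Continuous g)
    (hf2 : Integrable fun x => f x ^ 2) (hg2 : Integrable fun x => g x ^ 2) :
    Integrable fun x => (f x + g x) ^ 2 := by
  refine ((hf2.add hg2).const_mul 2).mono' (by fun_prop) (Eventually.of_forall fun x => ?_)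
  rw [Real.norm_of_nonneg (sq_nonneg _)]
  simp only [Pi.add_apply]
  nlinarith [sq_nonneg (f x - g x)]

/-- Solvability of the linearised equation `c z' - d z'' + f_a'(φ) z + γ φ' = g`. -/
theorem exists_linearised_solution (h : IsLogistic k φ) (hk : 0 < k) (hd : 0 < d)
    (hk2 : 2 * d * k ^ 2 = 1) (ha₀ : 0 < a) (ha₁ : a < 1) :
    ∃ C, 0 ≤ C ∧ ∀ g : ℝ → ℝ, Continuous g → HasCompactSupport g →
      ∃ (γ : ℝ) (z z₁ z₂ : ℝ → ℝ), (∀ x, HasDerivAt z (z₁ x) x) ∧ (∀ x, HasDerivAt z₁ (z₂ x) x) ∧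
        Continuous z₂ ∧ Integrable (fun x => z x ^ 2) ∧ Integrable (fun x => z₁ x ^ 2) ∧
        Integrable (fun x => z₂ x ^ 2) ∧
        (∀ x, d * k * (1 - 2 * a) * z₁ x - d * z₂ x
          + (3 * φ x ^ 2 - 2 * (1 + a) * φ x + a) * z x + γ * (k * (φ x * (1 - φ x))) = g x) ∧
        γ ^ 2 ≤ C * ∫ x, g x ^ 2 ∧ ∫ x, z x ^ 2 ≤ C * ∫ x, g x ^ 2 := by
  set b := 1 - 2 * a with hb
  have hb1 : |b| < 1 := abs_lt.2 ⟨by linarith, by linarith⟩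
  have hφ := h.continuous
  obtain ⟨K₁, hK₁, hS₁⟩ := h.exists_sq_integrable_solution_of_orthogonal hk hb1
  obtain ⟨K₂, hK₂, hS₂⟩ := h.exists_sq_integrable_solution hk
  set ψ : ℝ → ℝ := fun x => Real.exp (-(k * b) * x) * (φ x * (1 - φ x)) with hψdef
  have hψ0 : ∀ x, 0 < ψ x := h.adjointKernel_pos b
  have hψc : Continuous ψ := h.continuous_adjointKernel b
  have hψ2 : Integrable fun x => ψ x ^ 2 := h.integrable_adjointKernel_sq hk hb1
  set e : ℝ → ℝ := fun x => k * (φ x * (1 - φ x)) with he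
  have he0 : ∀ x, 0 < e x := fun x => mul_pos hk (h.mul_one_sub_pos x)
  have hec : Continuous e := by fun_prop
  have he2 : Integrable fun x => e x ^ 2 := by
    simp only [he, mul_pow k]
    exact (h.integrable_mul_one_sub_sq hk).const_mul _
  have hψe : Integrable fun x => ψ x * e x := integrable_mul_of_sq hψc hec hψ2 he2
  set I := ∫ x, ψ x * e x with hI
  have hI0 : 0 < I := by
    refine integral_pos_of_integrable_nonneg_nonzero (x := 0) (hψc.mul hec) hψe
      (fun x => (mul_pos (hψ0 x) (he0 x)).le) (mul_pos (hψ0 0) (he0 0)).ne'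
  set Cγ := (∫ x, ψ x ^ 2) / I ^ 2 with hCγ
  have hCγ0 : 0 ≤ Cγ := div_nonneg (integral_nonneg fun x => sq_nonneg _) (sq_nonneg _)
  set E := ∫ x, e x ^ 2 with hE
  have hE0 : 0 ≤ E := integral_nonneg fun x => sq_nonneg _
  refine ⟨Cγ + K₂ * (K₁ * (2 / d ^ 2 * (1 + Cγ * E))), by positivity, fun g hg hgs => ?_⟩
  have hg2 : Integrable fun x => g x ^ 2 := by
    have : HasCompactSupport fun x => g x ^ 2 := by
      simp_rw [sq]
      exact hgs.mul_right
    exact (by fun_prop : Continuous fun x => g x ^ 2).integrable_of_hasCompactSupport this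
  have hψg : Integrable fun x => ψ x * g x := integrable_mul_of_sq hψc hg hψ2 hg2
  -- This γ makes g - γ φ' orthogonal to ψ; Cauchy–Schwarz bounds it.
  set γ := (∫ x, ψ x * g x) / I with hγ
  have hγ2 : γ ^ 2 ≤ Cγ * ∫ x, g x ^ 2 := by
    rw [hγ, div_pow, hCγ, div_mul_eq_mul_div]
    gcongr
    exact sq_integral_mul_le hψc hg hψ2 hg2
  have hG0 : 0 ≤ ∫ x, g x ^ 2 := integral_nonneg fun x => sq_nonneg _
  -- The factorisation carries the prefactor -d, hence the source -(g - γ φ')/d for the first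
  -- factor.
  set r : ℝ → ℝ := fun x => (-1 / d) * (g x + (-γ) * e x) with hr
  have hrc : Continuous r := by fun_prop
  have hγe2 : Integrable fun x => ((-γ) * e x) ^ 2 := by
    simp only [mul_pow]; exact he2.const_mul _
  have hr2 : Integrable fun x => r x ^ 2 := by
    simp only [hr, mul_pow (-1 / d)]
    exact (integrable_sq_add hg (by fun_prop) hg2 hγe2).const_mul _
  -- Compact support of g is used here: the first factor requires a source that tends to 0 at both
  -- ends. General sources are reached later by density.
  have hrlim : ∀ l : Filter ℝ, l ≤ cocompact ℝ → Tendsto e l (𝓝 0) → Tendsto r l (𝓝 0) := by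
    intro l hl hel
    have h1 : Tendsto g l (𝓝 0) := hgs.is_zero_at_infty.mono_left hl
    simpa [hr] using (h1.add (hel.const_mul (-γ))).const_mul (-1 / d)
  have het : Tendsto e atTop (𝓝 0) := by
    simpa using (h.tendsto_atTop.mul (h.tendsto_atTop.const_sub 1)).const_mul k
  have heb : Tendsto e atBot (𝓝 0) := by
    simpa using (h.tendsto_atBot.mul (h.tendsto_atBot.const_sub 1)).const_mul k
  have horth : ∫ x, ψ x * r x = 0 := by
    have e1 : (fun x => ψ x * r x) = fun x => (-1 / d) * (ψ x * g x + (-γ) * (ψ x * e x)) := by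
      funext x; simp only [hr]; ring
    rw [e1, integral_const_mul, integral_add hψg (hψe.const_mul _), integral_const_mul, ← hI, hγ]
    have := hI0.ne'
    field_simp
    ring
  have hrint : ∫ x, r x ^ 2 ≤ 2 / d ^ 2 * (1 + Cγ * E) * ∫ x, g x ^ 2 := by
    have h1 : ∫ x, r x ^ 2 ≤ ∫ x, (2 / d ^ 2) * (g x ^ 2 + γ ^ 2 * e x ^ 2) := by
      refine integral_mono hr2 ((hg2.add (he2.const_mul _)).const_mul _) fun x => ?_
      simp only [hr]
      have e1 : (-1 / d * (g x + -γ * e x)) ^ 2 = 1 / d ^ 2 * (g x - γ * e x) ^ 2 := by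
        field_simp
        ring
      have e2 : 2 / d ^ 2 * (g x ^ 2 + γ ^ 2 * e x ^ 2)
          = 1 / d ^ 2 * (2 * (g x ^ 2 + γ ^ 2 * e x ^ 2)) := by ring
      rw [e1, e2]
      gcongr
      nlinarith [sq_nonneg (g x + γ * e x)]
    refine h1.trans ?_
    rw [integral_const_mul, integral_add hg2 (he2.const_mul _), integral_const_mul, mul_assoc]
    gcongr
    nlinarith
  obtain ⟨y, hyd, hy2, hyK⟩ := hS₁ r hrc
    (hrlim _ atBot_le_cocompact heb) (hrlim _ atTop_le_cocompact het) hr2 horth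
  have hyc : Continuous y := continuous_iff_continuousAt.2 fun x => (hyd x).continuousAt
  obtain ⟨z, hzd, hz2, hzK⟩ := hS₂ y hyc hy2
  have hzc : Continuous z := continuous_iff_continuousAt.2 fun x => (hzd x).continuousAt
  set z₁ : ℝ → ℝ := fun x => y x + k * (1 - 2 * φ x) * z x with hz₁
  have hz₁c : Continuous z₁ := by fun_prop
  have bd1 : ∀ x, |k * (1 - 2 * φ x)| ≤ k := fun x => by
    rw [abs_mul, abs_of_pos hk]
    refine mul_le_of_le_one_right hk.le (abs_le.2 ⟨?_, ?_⟩) <;> linarith [h.pos x, h.lt_one x]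
  have bd2 : ∀ x, |-(k * (1 - 2 * φ x - b))| ≤ k * 2 := fun x => by
    rw [abs_neg, abs_mul, abs_of_pos hk]
    refine mul_le_mul_of_nonneg_left (abs_le.2 ⟨?_, ?_⟩) hk.le <;> linarith [h.pos x, h.lt_one x]
  have bd3 : ∀ x, |-(2 * k * e x)| ≤ 2 * k * k := fun x => by
    have h0 := he0 x
    rw [abs_neg, abs_of_pos (by positivity)]
    refine mul_le_mul_of_nonneg_left ?_ (by positivity)
    simp only [he]
    refine mul_le_of_le_one_right hk.le ?_
    nlinarith [h.pos x, h.lt_one x]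
  have hz₁2 : Integrable fun x => z₁ x ^ 2 :=
    integrable_sq_add hyc (by fun_prop) hy2 (integrable_sq_bdd_mul hzc (by fun_prop) bd1 hz2)
  set z₂ : ℝ → ℝ := fun x => (r x + -(k * (1 - 2 * φ x - b)) * y x)
    + (k * -(2 * e x) * z x + k * (1 - 2 * φ x) * z₁ x) with hz₂
  have hz₁d : ∀ x, HasDerivAt z₁ (z₂ x) x := fun x => by
    refine ((hyd x).add (((((h.hasDerivAt x).const_mul 2).const_sub 1).const_mul k).mul
      (hzd x))).congr_deriv ?_
    simp only [hz₂, he]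
    ring
  refine ⟨γ, z, z₁, z₂, hzd, hz₁d, by fun_prop, hz2, hz₁2, ?_, ?_, ?_, ?_⟩
  · refine integrable_sq_add (by fun_prop) (by fun_prop) ?_ ?_
    · exact integrable_sq_add hrc (by fun_prop) hr2 (integrable_sq_bdd_mul hyc (by fun_prop) bd2 hy2)
    · refine integrable_sq_add (by fun_prop) (by fun_prop) ?_
        (integrable_sq_bdd_mul hz₁c (by fun_prop) bd1 hz₁2)
      have : ∀ x, k * -(2 * e x) = -(2 * k * e x) := fun x => by ring
      simp only [this]
      exact integrable_sq_bdd_mul hzc (by fun_prop) bd3 hz2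
  · intro x
    have e1 : d * r x = -(g x) + γ * e x := by
      simp only [hr]
      field_simp
      ring
    have e2 : d * z₂ x = d * r x + d * (-(k * (1 - 2 * φ x - b)) * y x
      + (k * -(2 * e x) * z x + k * (1 - 2 * φ x) * z₁ x)) := by simp only [hz₂]; ring
    rw [e2, e1]
    simp only [hz₁, he, hb]
    -- The product of the two factors has zeroth order coefficient 2dk² f_a'(φ), so the identity
    -- closes by 2dk² = 1.
    linear_combination ((3 * φ x ^ 2 - 2 * (1 + a) * φ x + a) * z x) * (-hk2)
  · nlinarith [mul_nonneg (mul_nonneg hK₂ (mul_nonneg hK₁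
      (by positivity : 0 ≤ 2 / d ^ 2 * (1 + Cγ * E)))) hG0]
  · calc ∫ x, z x ^ 2 ≤ K₂ * (K₁ * (2 / d ^ 2 * (1 + Cγ * E) * ∫ x, g x ^ 2)) :=
          hzK.trans (by gcongr; exact hyK.trans (by gcongr))
      _ ≤ _ := by nlinarith [mul_nonneg hCγ0 hG0]

end IsLogistic

/-! ### Bounded multiplication operators on `L²` -/

section MulLp

variable {𝕜 : Type*} [RCLike 𝕜]

/-- Multiplication by a bounded function, as an operator on `L²(ℝ)`. -/
noncomputable def mulLp (m : ℝ → 𝕜) (hm : MemLp m ∞ volume) :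
    Lp 𝕜 2 (volume : Measure ℝ) →L[𝕜] Lp 𝕜 2 (volume : Measure ℝ) :=
  (ContinuousLinearMap.mul 𝕜 𝕜).holderL volume ∞ 2 2 (hm.toLp m)

theorem coeFn_mulLp (m : ℝ → 𝕜) (hm : MemLp m ∞ volume) (f : Lp 𝕜 2 (volume : Measure ℝ)) :
    mulLp m hm f =ᵐ[volume] fun x => m x * f x := by
  have h := (ContinuousLinearMap.mul 𝕜 𝕜).coeFn_holder (r := 2) (hm.toLp m) f
  filter_upwards [h, hm.coeFn_toLp] with x h1 h2
  rw [mulLp, ContinuousLinearMap.holderL_apply_apply, h1, h2]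
  rfl

theorem norm_mulLp_apply_le {m : ℝ → 𝕜} (hm : MemLp m ∞ volume) {C : ℝ} (hC : ∀ x, ‖m x‖ ≤ C)
    (f : Lp 𝕜 2 (volume : Measure ℝ)) : ‖mulLp m hm f‖ ≤ C * ‖f‖ := by
  apply Lp.norm_le_mul_norm_of_ae_le_mul
  filter_upwards [coeFn_mulLp m hm f] with x hx
  rw [hx, norm_mul]
  exact mul_le_mul_of_nonneg_right (hC x) (norm_nonneg _)

end MulLp

/-! ### Fourier multipliers on `L²` -/

/-- The Fourier transform on complex `L²(ℝ)`. -/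
noncomputable abbrev fourierL2 :
    Lp ℂ 2 (volume : Measure ℝ) ≃ₗᵢ[ℂ] Lp ℂ 2 (volume : Measure ℝ) :=
  Lp.fourierTransformₗᵢ ℝ ℂ

/-- The Fourier multiplier with bounded symbol `m` on complex `L²(ℝ)`. -/
noncomputable def complexMultiplier (m : ℝ → ℂ) (hm : MemLp m ∞ volume) :
    Lp ℂ 2 (volume : Measure ℝ) →L[ℂ] Lp ℂ 2 (volume : Measure ℝ) :=
  (fourierL2.symm.toContinuousLinearEquiv : _ →L[ℂ] _) ∘L mulLp m hm ∘L
    (fourierL2.toContinuousLinearEquiv : _ →L[ℂ] _)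

theorem coeFn_fourierL2_complexMultiplier (m : ℝ → ℂ) (hm : MemLp m ∞ volume)
    (f : Lp ℂ 2 (volume : Measure ℝ)) :
    fourierL2 (complexMultiplier m hm f) =ᵐ[volume] fun ξ => m ξ * fourierL2 f ξ := by
  have : fourierL2 (complexMultiplier m hm f) = mulLp m hm (fourierL2 f) := by
    simp [complexMultiplier]
  rw [this]
  exact coeFn_mulLp m hm _

theorem norm_complexMultiplier_apply_le {m : ℝ → ℂ} (hm : MemLp m ∞ volume) {C : ℝ}
    (hC : ∀ x, ‖m x‖ ≤ C) (f : Lp ℂ 2 (volume : Measure ℝ)) :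
    ‖complexMultiplier m hm f‖ ≤ C * ‖f‖ := by
  have : ‖complexMultiplier m hm f‖ = ‖mulLp m hm (fourierL2 f)‖ := by
    simp [complexMultiplier]
  rw [this]
  refine (norm_mulLp_apply_le hm hC _).trans_eq ?_
  rw [LinearIsometryEquiv.norm_map]

/-- Embedding of real into complex `L²`. -/
noncomputable def ofRealLp : Lp ℝ 2 (volume : Measure ℝ) →L[ℝ] Lp ℂ 2 (volume : Measure ℝ) :=
  Complex.ofRealCLM.compLpL 2 volume

/-- Real part on complex `L²`. -/
noncomputable def reLp : Lp ℂ 2 (volume : Measure ℝ) →L[ℝ] Lp ℝ 2 (volume : Measure ℝ) :=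
  Complex.reCLM.compLpL 2 volume

theorem coeFn_ofRealLp (f : Lp ℝ 2 (volume : Measure ℝ)) :
    ofRealLp f =ᵐ[volume] fun x => (f x : ℂ) :=
  Complex.ofRealCLM.coeFn_compLpL f

theorem coeFn_reLp (f : Lp ℂ 2 (volume : Measure ℝ)) : reLp f =ᵐ[volume] fun x => (f x).re :=
  Complex.reCLM.coeFn_compLpL f

theorem norm_ofRealLp_le (f : Lp ℝ 2 (volume : Measure ℝ)) : ‖ofRealLp f‖ ≤ ‖f‖ := by
  apply Lp.norm_le_norm_of_ae_le
  filter_upwards [coeFn_ofRealLp f] with x hx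
  rw [hx, Complex.norm_real]

theorem norm_reLp_le (f : Lp ℂ 2 (volume : Measure ℝ)) : ‖reLp f‖ ≤ ‖f‖ := by
  apply Lp.norm_le_norm_of_ae_le
  filter_upwards [coeFn_reLp f] with x hx
  rw [hx]
  exact Complex.abs_re_le_norm _

theorem reLp_ofRealLp (f : Lp ℝ 2 (volume : Measure ℝ)) : reLp (ofRealLp f) = f := by
  apply Lp.ext
  filter_upwards [coeFn_reLp (ofRealLp f), coeFn_ofRealLp f] with x h1 h2
  rw [h1, h2, Complex.ofReal_re]

/-- The real part of the Fourier multiplier with symbol `m`, as an operator on real `L²(ℝ)`. -/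
noncomputable def realMultiplier (m : ℝ → ℂ) (hm : MemLp m ∞ volume) :
    Lp ℝ 2 (volume : Measure ℝ) →L[ℝ] Lp ℝ 2 (volume : Measure ℝ) :=
  reLp ∘L ((complexMultiplier m hm).restrictScalars ℝ) ∘L ofRealLp

theorem realMultiplier_apply (m : ℝ → ℂ) (hm : MemLp m ∞ volume)
    (f : Lp ℝ 2 (volume : Measure ℝ)) :
    realMultiplier m hm f = reLp (complexMultiplier m hm (ofRealLp f)) := rfl

theorem norm_realMultiplier_apply_le {m : ℝ → ℂ} (hm : MemLp m ∞ volume) {C : ℝ} (hC0 : 0 ≤ C)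
    (hC : ∀ x, ‖m x‖ ≤ C) (f : Lp ℝ 2 (volume : Measure ℝ)) :
    ‖realMultiplier m hm f‖ ≤ C * ‖f‖ :=
  (norm_reLp_le _).trans ((norm_complexMultiplier_apply_le hm hC _).trans
    (mul_le_mul_of_nonneg_left (norm_ofRealLp_le f) hC0))

theorem complexMultiplier_sub_apply {m m' : ℝ → ℂ} (hm : MemLp m ∞ volume)
    (hm' : MemLp m' ∞ volume) (f : Lp ℂ 2 (volume : Measure ℝ)) :
    complexMultiplier m hm f - complexMultiplier m' hm' f
      = complexMultiplier (m - m') (hm.sub hm') f := by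
  apply fourierL2.injective
  rw [map_sub]
  apply Lp.ext
  filter_upwards [coeFn_fourierL2_complexMultiplier m hm f,
    coeFn_fourierL2_complexMultiplier m' hm' f,
    coeFn_fourierL2_complexMultiplier _ (hm.sub hm') f,
    Lp.coeFn_sub (fourierL2 (complexMultiplier m hm f)) (fourierL2 (complexMultiplier m' hm' f))]
    with x h1 h2 h3 h4
  rw [h3, h4, Pi.sub_apply, h1, h2, Pi.sub_apply]
  ring

theorem norm_realMultiplier_sub_apply_le {m m' : ℝ → ℂ} (hm : MemLp m ∞ volume)
    (hm' : MemLp m' ∞ volume) {C : ℝ} (hC0 : 0 ≤ C) (hC : ∀ x, ‖m x - m' x‖ ≤ C)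
    (f : Lp ℝ 2 (volume : Measure ℝ)) :
    ‖realMultiplier m hm f - realMultiplier m' hm' f‖ ≤ C * ‖f‖ := by
  rw [realMultiplier_apply, realMultiplier_apply, ← map_sub, complexMultiplier_sub_apply]
  exact norm_realMultiplier_apply_le (hm.sub hm') hC0 hC f

/-! ### Translations -/

/-- Translation `f ↦ f (· + s)` on complex `L²`. -/
noncomputable def translateLp (s : ℝ) :
    Lp ℂ 2 (volume : Measure ℝ) →ₗᵢ[ℂ] Lp ℂ 2 (volume : Measure ℝ) :=
  Lp.compMeasurePreservingₗᵢ ℂ (fun x => x + s) (measurePreserving_add_right volume s)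

theorem coeFn_translateLp (s : ℝ) (f : Lp ℂ 2 (volume : Measure ℝ)) :
    translateLp s f =ᵐ[volume] fun x => f (x + s) :=
  Lp.coeFn_compMeasurePreserving f (measurePreserving_add_right volume s)

/-- The symbol of the translation by `s`. -/
noncomputable def translationSymbol (s ξ : ℝ) : ℂ := Complex.exp (2 * Real.pi * s * ξ * Complex.I)

theorem norm_translationSymbol (s ξ : ℝ) : ‖translationSymbol s ξ‖ = 1 := by
  rw [translationSymbol]
  have := Complex.norm_exp_ofReal_mul_I (2 * Real.pi * s * ξ)
  push_cast at this
  exact this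

theorem continuous_translationSymbol (s : ℝ) : Continuous (translationSymbol s) := by
  unfold translationSymbol
  fun_prop

theorem memLp_top_of_continuous {m : ℝ → ℂ} (hm : Continuous m) {C : ℝ} (hC : ∀ x, ‖m x‖ ≤ C) :
    MemLp m ∞ volume :=
  memLp_top_of_bound hm.aestronglyMeasurable C (Eventually.of_forall hC)

theorem memLp_translationSymbol (s : ℝ) : MemLp (translationSymbol s) ∞ volume :=
  memLp_top_of_continuous (continuous_translationSymbol s) fun ξ => (norm_translationSymbol s ξ).le

-- Both sides are continuous in f, so the identity need only be checked on the dense class of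
-- Schwartz functions, where it is the classical formula.
open FourierTransform in
theorem fourierL2_translateLp (s : ℝ) (f : Lp ℂ 2 (volume : Measure ℝ)) :
    fourierL2 (translateLp s f) = mulLp (translationSymbol s) (memLp_translationSymbol s)
      (fourierL2 f) := by
  have hclosed : IsClosed {f : Lp ℂ 2 (volume : Measure ℝ) | fourierL2 (translateLp s f)
      = mulLp (translationSymbol s) (memLp_translationSymbol s) (fourierL2 f)} := by
    apply isClosed_eq
    · exact fourierL2.continuous.comp (translateLp s).continuous
    · exact (mulLp _ _).continuous.comp fourierL2.continuous
  refine (SchwartzMap.denseRange_toLpCLM (E := ℝ) (F := ℂ) (p := 2) (μ := volume)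
    ENNReal.ofNat_ne_top).induction_on (p := fun f => fourierL2 (translateLp s f)
      = mulLp (translationSymbol s) (memLp_translationSymbol s) (fourierL2 f)) f hclosed ?_
  intro θ
  have e1 : translateLp s (θ.toLp 2) = (SchwartzMap.compSubConstCLM ℂ (-s) θ).toLp 2 := by
    apply Lp.ext
    have h1 := (measurePreserving_add_right volume s).quasiMeasurePreserving.ae_eq_comp
      (θ.coeFn_toLp 2 volume)
    filter_upwards [coeFn_translateLp s (θ.toLp 2),
      (SchwartzMap.compSubConstCLM ℂ (-s) θ).coeFn_toLp 2 volume, h1] with x h2 h3 h4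
    rw [h2, h3, SchwartzMap.compSubConstCLM_apply, sub_neg_eq_add]
    exact h4
  have e2 : fourierL2 ((SchwartzMap.compSubConstCLM ℂ (-s) θ).toLp 2)
      = (𝓕 (SchwartzMap.compSubConstCLM ℂ (-s) θ)).toLp 2 := SchwartzMap.toLp_fourier_eq _
  have e3 : fourierL2 (θ.toLp 2) = (𝓕 θ).toLp 2 := SchwartzMap.toLp_fourier_eq _
  change fourierL2 (translateLp s (θ.toLp 2)) = mulLp _ _ (fourierL2 (θ.toLp 2))
  rw [e1, e2, e3]
  apply Lp.ext
  filter_upwards [coeFn_mulLp (translationSymbol s) (memLp_translationSymbol s) ((𝓕 θ).toLp 2),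
    (𝓕 θ).coeFn_toLp 2 volume,
    (𝓕 (SchwartzMap.compSubConstCLM ℂ (-s) θ)).coeFn_toLp 2 volume] with ξ h1 h2 h3
  rw [h1, h2, h3, SchwartzMap.fourier_coe, SchwartzMap.fourier_coe]
  have e4 : (⇑(SchwartzMap.compSubConstCLM ℂ (-s) θ) : ℝ → ℂ) = θ ∘ fun v => v + s := by
    funext x
    simp [SchwartzMap.compSubConstCLM_apply]
  rw [e4]
  have e5 := congrFun (Fourier.fourierIntegral_comp_add_right Real.fourierChar volume (θ : ℝ → ℂ) s) ξ
  have e6 : ∀ g : ℝ → ℂ, 𝓕 g ξ = Fourier.fourierIntegral Real.fourierChar volume g ξ := fun g => by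
    rw [Real.fourier_eq, Fourier.fourierIntegral_def]
    simp [mul_comm]
  rw [e6, e6, e5, Circle.smul_def, Real.fourierChar_apply, translationSymbol, smul_eq_mul]
  push_cast
  ring_nf

/-! ### Derivatives -/

open FourierTransform in
theorem coeFn_fourierL2_deriv (θ : SchwartzMap ℝ ℂ) :
    fourierL2 ((SchwartzMap.derivCLM ℂ ℂ θ).toLp 2) =ᵐ[volume]
      fun ξ => 2 * Real.pi * Complex.I * ξ * fourierL2 (θ.toLp 2) ξ := by
  have e2 : fourierL2 ((SchwartzMap.derivCLM ℂ ℂ θ).toLp 2)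
      = (𝓕 (SchwartzMap.derivCLM ℂ ℂ θ)).toLp 2 := SchwartzMap.toLp_fourier_eq _
  have e3 : fourierL2 (θ.toLp 2) = (𝓕 θ).toLp 2 := SchwartzMap.toLp_fourier_eq _
  rw [e2, e3]
  filter_upwards [(𝓕 θ).coeFn_toLp 2 volume,
    (𝓕 (SchwartzMap.derivCLM ℂ ℂ θ)).coeFn_toLp 2 volume] with ξ h2 h3
  rw [h2, h3, SchwartzMap.fourier_coe, SchwartzMap.fourier_coe]
  have e4 : (⇑(SchwartzMap.derivCLM ℂ ℂ θ) : ℝ → ℂ) = deriv θ := by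
    funext x
    rw [SchwartzMap.derivCLM_apply]
  have e5 : Integrable (deriv θ) := e4 ▸ (SchwartzMap.derivCLM ℂ ℂ θ).integrable
  rw [e4, Real.fourier_deriv θ.integrable θ.differentiable e5]
  rfl

/-- By Plancherel the factor 2πiξ moves from one side of the inner product to the other; its
conjugation produces the minus sign. -/
theorem inner_deriv_complexMultiplier {m : ℝ → ℂ} (hm : MemLp m ∞ volume)
    (hm' : MemLp (fun ξ : ℝ => 2 * Real.pi * Complex.I * ξ * m ξ) ∞ volume)
    (f : Lp ℂ 2 (volume : Measure ℝ)) (θ : SchwartzMap ℝ ℂ) :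
    inner ℂ ((SchwartzMap.derivCLM ℂ ℂ θ).toLp 2) (complexMultiplier m hm f)
      = - inner ℂ (θ.toLp 2) (complexMultiplier _ hm' f) := by
  rw [← fourierL2.inner_map_map, ← fourierL2.inner_map_map (θ.toLp 2 volume), L2.inner_def, L2.inner_def,
    ← integral_neg]
  apply integral_congr_ae
  filter_upwards [coeFn_fourierL2_deriv θ, coeFn_fourierL2_complexMultiplier _ hm' f,
    coeFn_fourierL2_complexMultiplier _ hm f] with ξ h1 h2 h3
  rw [h1, h2, h3]
  simp only [RCLike.inner_apply, map_mul, Complex.conj_I, Complex.conj_ofReal, map_ofNat]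
  ring

open FourierTransform in
/-- If `v` is the derivative of `u` in the sense of distributions, its Fourier transform is
`2πiξ` times that of `u`. -/
theorem coeFn_fourierL2_of_inner_deriv {u v : Lp ℂ 2 (volume : Measure ℝ)}
    (h : ∀ θ : SchwartzMap ℝ ℂ, inner ℂ ((SchwartzMap.derivCLM ℂ ℂ θ).toLp 2) u
      = - inner ℂ (θ.toLp 2) v) :
    fourierL2 v =ᵐ[volume] fun ξ => 2 * Real.pi * Complex.I * ξ * fourierL2 u ξ := by
  have hli : ∀ w : Lp ℂ 2 (volume : Measure ℝ), LocallyIntegrable w volume := fun w =>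
    (Lp.memLp w).locallyIntegrable (by norm_num)
  refine ae_eq_of_integral_contDiff_smul_eq (hli _) ?_ fun η hη hηs => ?_
  · have hc : Continuous fun ξ : ℝ => 2 * Real.pi * Complex.I * (ξ : ℂ) := by fun_prop
    exact locallyIntegrableOn_univ.1 (LocallyIntegrableOn.continuousOn_mul
      (locallyIntegrableOn_univ.2 (hli (fourierL2 u))) hc.continuousOn isOpen_univ.isLocallyClosed)
  · have hs : HasCompactSupport fun x => (η x : ℂ) := hηs.comp_left (g := ((↑) : ℝ → ℂ)) rfl
    have hc : ContDiff ℝ ∞ fun x => (η x : ℂ) := Complex.ofRealCLM.contDiff.comp hη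
    set Θ : SchwartzMap ℝ ℂ := hs.toSchwartzMap hc with hΘ
    -- Every test function on the frequency side is the Fourier transform of a Schwartz function, so
    -- the hypothesis tests the transforms against all of them.
    obtain ⟨Ξ, hΞ⟩ : ∃ Ξ : SchwartzMap ℝ ℂ, 𝓕 Ξ = Θ := ⟨𝓕⁻ Θ, fourier_fourierInv_eq _⟩
    have e3 : fourierL2 (Ξ.toLp 2) = Θ.toLp 2 := by
      rw [← hΞ]
      exact SchwartzMap.toLp_fourier_eq _
    have h1 := h Ξ
    have h2 := coeFn_fourierL2_deriv Ξ
    rw [← fourierL2.inner_map_map, ← fourierL2.inner_map_map (Ξ.toLp 2 volume), L2.inner_def,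
      L2.inner_def, e3, ← integral_neg] at h1
    rw [e3] at h2
    have hΘe : ∀ x, Θ x = η x := fun x => rfl
    have i1 : ∫ x, η x • (2 * Real.pi * Complex.I * x * fourierL2 u x)
        = -∫ x, inner ℂ (fourierL2 ((SchwartzMap.derivCLM ℂ ℂ Ξ).toLp 2) x)
          (fourierL2 u x) := by
      rw [← integral_neg]
      apply integral_congr_ae
      filter_upwards [h2, Θ.coeFn_toLp 2 volume] with x h3 h4
      rw [h3, h4, hΘe]
      simp only [RCLike.inner_apply, map_mul, Complex.conj_I, Complex.conj_ofReal, map_ofNat,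
        Complex.real_smul]
      ring
    have i2 : ∫ x, η x • fourierL2 v x
        = -∫ x, -inner ℂ ((Θ.toLp 2 volume : Lp ℂ 2 (volume : Measure ℝ)) x) (fourierL2 v x) := by
      rw [← integral_neg]
      apply integral_congr_ae
      filter_upwards [Θ.coeFn_toLp 2 volume] with x h4
      rw [h4, hΘe]
      simp only [RCLike.inner_apply, Complex.conj_ofReal, Complex.real_smul, neg_neg]
      ring
    rw [i1, i2, h1]

/-! ### Weak derivatives and continuous representatives -/

/-- Zero mean makes the primitive started left of the support vanish again to its right. -/
theorem exists_primitive_hasCompactSupport {ζ : ℝ → ℝ} (hζ : ContDiff ℝ ∞ ζ)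
    (hs : HasCompactSupport ζ) (h0 : ∫ x, ζ x = 0) :
    ∃ Θ : ℝ → ℝ, ContDiff ℝ ∞ Θ ∧ HasCompactSupport Θ ∧ deriv Θ = ζ := by
  obtain ⟨R, hR⟩ := hs.isCompact.isBounded.subset_closedBall 0
  have hsupp : ∀ x, R < |x| → ζ x = 0 := fun x hx => by
    by_contra hne
    have := hR (subset_tsupport _ hne)
    rw [mem_closedBall_zero_iff, Real.norm_eq_abs] at this
    linarith
  have hd : ∀ x, HasDerivAt (fun x => ∫ t in -R..x, ζ t) (ζ x) x := fun x =>
    intervalIntegral.integral_hasDerivAt_right (hζ.continuous.intervalIntegrable _ _)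
      (hζ.continuous.stronglyMeasurableAtFilter _ _) hζ.continuous.continuousAt
  have hderiv : deriv (fun x => ∫ t in -R..x, ζ t) = ζ := funext fun x => (hd x).deriv
  refine ⟨fun x => ∫ t in -R..x, ζ t, ?_, ?_, hderiv⟩
  · rw [contDiff_infty_iff_deriv, hderiv]
    exact ⟨fun x => (hd x).differentiableAt, hζ⟩
  · refine HasCompactSupport.intro (isCompact_Icc (a := -R) (b := R)) fun x hx => ?_
    rw [Set.mem_Icc, not_and_or, not_le, not_le] at hx
    rcases hx with hx | hx
    · rw [intervalIntegral.integral_symm, intervalIntegral.integral_of_le hx.le, neg_eq_zero,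
        integral_Ioc_eq_integral_Ioo]
      refine setIntegral_eq_zero_of_forall_eq_zero fun t ht => ?_
      -- A negative `R` is possible; ζ is then identically zero.
      by_cases hR0 : 0 ≤ R
      · apply hsupp
        rw [abs_of_neg (by linarith [ht.2])]
        linarith [ht.2]
      · exact hsupp t (by linarith [abs_nonneg t])
    · rcases le_total (-R) x with hx' | hx'
      · rw [intervalIntegral.integral_of_le hx', ← h0]
        refine setIntegral_eq_integral_of_ae_compl_eq_zero ?_
        filter_upwards [compl_mem_ae_iff.2 (measure_singleton (-R))] with t ht1 ht2
        apply hsupp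
        rw [Set.mem_Ioc, not_and_or, not_lt, not_le] at ht2
        rcases ht2 with ht | ht
        · have : t < -R := lt_of_le_of_ne ht ht1
          exact lt_of_lt_of_le (by linarith) (neg_le_abs t)
        · exact lt_of_lt_of_le (by linarith) (le_abs_self t)
      · rw [intervalIntegral.integral_symm, intervalIntegral.integral_of_le hx', neg_eq_zero]
        exact setIntegral_eq_zero_of_forall_eq_zero fun t _ => hsupp t (by linarith [abs_nonneg t])

/-- The primitive of a locally integrable function is only absolutely continuous, so the integration
by parts is the one for absolutely continuous functions, on an interval reaching beyond the support
of θ. -/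
theorem integral_primitive_mul_deriv {g θ : ℝ → ℝ} (hg : LocallyIntegrable g volume)
    (hθ : ContDiff ℝ ∞ θ) (hs : HasCompactSupport θ) :
    ∫ x, (∫ t in (0 : ℝ)..x, g t) * deriv θ x = - ∫ x, g x * θ x := by
  obtain ⟨R, hR⟩ := hs.isCompact.isBounded.subset_closedBall 0
  have hsupp : ∀ x, R < |x| → x ∉ tsupport θ := fun x hx hne => by
    have := hR hne
    rw [mem_closedBall_zero_iff, Real.norm_eq_abs] at this
    linarith
  set S := |R| + 1 with hS
  have hSR : R < S := by linarith [le_abs_self R]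
  have hS0 : 0 < S := by linarith [abs_nonneg R]
  have hI : ∀ f : ℝ → ℝ, (∀ x, x ∉ tsupport θ → f x = 0) → ∫ x in -S..S, f x = ∫ x, f x := by
    intro f hf
    rw [intervalIntegral.integral_of_le (by linarith)]
    refine setIntegral_eq_integral_of_forall_compl_eq_zero fun x hx => hf x (hsupp x ?_)
    rw [Set.mem_Ioc, not_and_or, not_lt, not_le] at hx
    rcases hx with hx | hx
    · exact lt_of_lt_of_le (by linarith) (neg_le_abs x)
    · exact lt_of_lt_of_le (by linarith) (le_abs_self x)
  have hgi : IntervalIntegrable g volume (-S) S :=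
    (hg.integrableOn_isCompact isCompact_uIcc).intervalIntegrable
  have h1 := (hgi.absolutelyContinuousOnInterval_intervalIntegral (c := 0)
    (by rw [Set.uIcc_of_le (by linarith)]; constructor <;> linarith)
    ).integral_mul_deriv_eq_deriv_mul
    ((hθ.of_le (by exact_mod_cast le_top) : ContDiff ℝ 1 θ).contDiffOn.absolutelyContinuousOnInterval)
  have hθ0 : ∀ x, R < |x| → θ x = 0 := fun x hx => image_eq_zero_of_notMem_tsupport (hsupp x hx)
  have hz1 : θ S = 0 := hθ0 S (by rwa [abs_of_pos hS0])
  have hz2 : θ (-S) = 0 := hθ0 (-S) (by rwa [abs_neg, abs_of_pos hS0])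
  rw [hz1, hz2, mul_zero, mul_zero, sub_zero, zero_sub] at h1
  have h2 : ∫ x in -S..S, deriv (fun x => ∫ v in (0 : ℝ)..x, g v) x * θ x
      = ∫ x in -S..S, g x * θ x := by
    apply intervalIntegral.integral_congr_ae
    filter_upwards [LocallyIntegrable.ae_hasDerivAt_integral hg] with x hx _
    rw [(hx 0).deriv]
  rw [h2, hI _ fun x hx => ?_, hI _ fun x hx => ?_] at h1
  · exact h1
  · rw [image_eq_zero_of_notMem_tsupport hx, mul_zero]
  · rw [image_eq_zero_of_notMem_tsupport fun h => hx (tsupport_deriv_subset h), mul_zero]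

/-- Du Bois-Reymond's lemma: w minus the primitive of g annihilates derivatives of test functions,
that is, test functions of mean zero. Any test function has mean zero after subtracting a multiple
of a fixed normalised bump, so the difference is a constant. -/
theorem IsWeakDeriv.exists_ae_eq_primitive {w g : ℝ → ℝ} (h : IsWeakDeriv w g) :
    ∃ C, w =ᵐ[volume] fun x => C + ∫ t in (0 : ℝ)..x, g t := by
  obtain ⟨hw, hg, hwg⟩ := h
  set G : ℝ → ℝ := fun x => ∫ t in (0 : ℝ)..x, g t with hG
  have hGc : Continuous G := intervalIntegral.continuous_primitive
    (fun a b => (hg.integrableOn_isCompact isCompact_uIcc).intervalIntegrable) 0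
  have hGl : LocallyIntegrable G volume := hGc.locallyIntegrable
  have he : LocallyIntegrable (fun x => w x - G x) volume := hw.sub hGl
  let bump : ContDiffBump (0 : ℝ) := ⟨1, 2, by norm_num, by norm_num⟩
  set θ₀ : ℝ → ℝ := bump.normed volume with hθ₀
  have hθ₀c : ContDiff ℝ ∞ θ₀ := bump.contDiff_normed
  have hθ₀s : HasCompactSupport θ₀ := bump.hasCompactSupport_normed
  have hθ₀1 : ∫ x, θ₀ x = 1 := bump.integral_normed
  have hint : ∀ (f θ : ℝ → ℝ), LocallyIntegrable f volume → ContDiff ℝ ∞ θ → HasCompactSupport θ →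
      Integrable fun x => f x * θ x := fun f θ hf hθ hs => by
    simpa [mul_comm] using hf.integrable_smul_left_of_hasCompactSupport hθ.continuous hs
  set C := ∫ x, (w x - G x) * θ₀ x with hC
  refine ⟨C, ?_⟩
  have key : ∀ᵐ x, w x - G x = C := by
    refine ae_eq_of_integral_contDiff_smul_eq he (locallyIntegrable_const C) fun η hη hηs => ?_
    set I := ∫ x, η x with hI
    set ζ : ℝ → ℝ := fun x => η x - I * θ₀ x with hζ
    have hζc : ContDiff ℝ ∞ ζ := hη.sub (contDiff_const.mul hθ₀c)
    have hζs : HasCompactSupport ζ := hηs.sub hθ₀s.mul_left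
    have hηi : Integrable η := hη.continuous.integrable_of_hasCompactSupport hηs
    have hζ0 : ∫ x, ζ x = 0 := by
      rw [hζ, integral_sub hηi
        ((hθ₀c.continuous.integrable_of_hasCompactSupport hθ₀s).const_mul _), integral_const_mul,
        hθ₀1, mul_one, sub_self]
    obtain ⟨Θ, hΘ, hΘs, hΘd⟩ := exists_primitive_hasCompactSupport hζc hζs hζ0
    have h1 := hwg Θ hΘ hΘs
    have h2 := integral_primitive_mul_deriv hg hΘ hΘs
    rw [hΘd] at h1 h2
    have h3 : ∫ x, (w x - G x) * ζ x = 0 := by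
      have : (fun x => (w x - G x) * ζ x) = fun x => w x * ζ x - G x * ζ x := by
        funext x; ring
      rw [this, integral_sub (hint w ζ hw hζc hζs) (hint G ζ hGl hζc hζs), h1, h2, sub_self]
    have h4 : (fun x => (w x - G x) * ζ x)
        = fun x => (w x - G x) * η x - I * ((w x - G x) * θ₀ x) := by
      funext x; simp only [hζ]; ring
    rw [h4, integral_sub (hint _ η he hη hηs) ((hint _ θ₀ he hθ₀c hθ₀s).const_mul _),
      integral_const_mul, ← hC] at h3
    simp only [smul_eq_mul]
    rw [integral_mul_const, ← hI]
    simp only [mul_comm (η _)]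
    linarith
  filter_upwards [key] with x hx
  linarith

theorem abs_intervalIntegral_le_norm (f : Lp ℝ 2 (volume : Measure ℝ)) {x y : ℝ} (hxy : x ≤ y)
    (hy : y ≤ x + 1) : |∫ t in x..y, f t| ≤ ‖f‖ := by
  rw [intervalIntegral.integral_of_le hxy,
    ← L2.inner_indicatorConstLp_one (𝕜 := ℝ) measurableSet_Ioc (by simp) f]
  refine (abs_real_inner_le_norm _ _).trans (mul_le_of_le_one_left (norm_nonneg _) ?_)
  rw [norm_indicatorConstLp (by norm_num) (by norm_num)]
  simp only [norm_one, one_mul]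
  apply Real.rpow_le_one
  · positivity
  · simp [hxy]
    linarith
  · positivity

/-- A square integrable function with square integrable weak derivative has a continuous
representative, which is bounded by the `H¹` norm. -/
theorem IsWeakDeriv.exists_continuous_rep {w g : Lp ℝ 2 (volume : Measure ℝ)}
    (h : IsWeakDeriv w g) : ∃ W : ℝ → ℝ, Continuous W ∧ w =ᵐ[volume] W ∧
      (∀ x, W x = W 0 + ∫ t in (0 : ℝ)..x, g t) ∧ ∀ x, |W x| ≤ ‖w‖ + ‖g‖ := by
  obtain ⟨C, hC⟩ := h.exists_ae_eq_primitive
  have hgi : ∀ a b, IntervalIntegrable g volume a b := fun a b =>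
    (h.2.1.integrableOn_isCompact isCompact_uIcc).intervalIntegrable
  set W : ℝ → ℝ := fun x => C + ∫ t in (0 : ℝ)..x, g t with hW
  have hWc : Continuous W := continuous_const.add (intervalIntegral.continuous_primitive hgi 0)
  refine ⟨W, hWc, hC, fun x => by simp [hW], fun x => ?_⟩
  have hdiff : ∀ y, W y - W x = ∫ t in x..y, g t := fun y => by
    simp only [hW]
    rw [← intervalIntegral.integral_interval_sub_left (hgi 0 y) (hgi 0 x)]
    ring
  -- W(x) is compared with its average over [x, x + 1]: the average is at most ‖w‖ and the deviation
  -- from it at most ‖g‖, both by Cauchy–Schwarz on a unit interval.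
  have h1 : ∫ y in x..(x + 1), W y = ∫ y in x..(x + 1), w y := by
    apply intervalIntegral.integral_congr_ae
    filter_upwards [hC] with y hy _
    exact hy.symm
  have h2 : ∫ y in x..(x + 1), (W y - W x) = (∫ y in x..(x + 1), W y) - W x := by
    rw [intervalIntegral.integral_sub (hWc.intervalIntegrable _ _) (by simp)]
    simp
  have h3 : |∫ y in x..(x + 1), (W y - W x)| ≤ ‖g‖ := by
    have := intervalIntegral.norm_integral_le_of_norm_le_const (a := x) (b := x + 1)
      (f := fun y => W y - W x) (C := ‖g‖) fun y hy => by
        rw [Set.uIoc_of_le (by linarith)] at hy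
        rw [hdiff, Real.norm_eq_abs]
        exact abs_intervalIntegral_le_norm g hy.1.le hy.2
    simpa using this
  have h4 := abs_intervalIntegral_le_norm w (show x ≤ x + 1 by linarith) le_rfl
  rw [← h1] at h4
  rw [h2] at h3
  rw [abs_le] at *
  constructor <;> linarith [h3.1, h3.2, h4.1, h4.2]

/-! ### Real Fourier multipliers and derivatives -/

theorem isWeakDeriv_realMultiplier {m : ℝ → ℂ} (hm : MemLp m ∞ volume)
    (hm' : MemLp (fun ξ : ℝ => 2 * Real.pi * Complex.I * ξ * m ξ) ∞ volume)
    (f : Lp ℝ 2 (volume : Measure ℝ)) :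
    IsWeakDeriv (realMultiplier m hm f) (realMultiplier _ hm' f) := by
  refine ⟨(Lp.memLp _).locallyIntegrable (by norm_num), (Lp.memLp _).locallyIntegrable (by norm_num),
    fun θ hθ hθs => ?_⟩
  have hs : HasCompactSupport fun x => (θ x : ℂ) := hθs.comp_left (g := ((↑) : ℝ → ℂ)) rfl
  have hc : ContDiff ℝ ∞ fun x => (θ x : ℂ) := Complex.ofRealCLM.contDiff.comp hθ
  set Θ : SchwartzMap ℝ ℂ := hs.toSchwartzMap hc with hΘ
  have hΘe : ∀ x, Θ x = θ x := fun x => rfl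
  have hΘd : ∀ x, SchwartzMap.derivCLM ℂ ℂ Θ x = ((deriv θ x : ℝ) : ℂ) := fun x => by
    rw [SchwartzMap.derivCLM_apply]
    exact ((hθ.differentiable (by simp) x).hasDerivAt.ofReal_comp).deriv
  have h1 := inner_deriv_complexMultiplier hm hm' (ofRealLp f) Θ
  rw [L2.inner_def, L2.inner_def] at h1
  have h2 := congrArg Complex.re h1
  rw [Complex.neg_re] at h2
  have hre : ∀ (F : ℝ → ℂ), Integrable F → (∫ x, F x).re = ∫ x, (F x).re := fun F hF =>
    (Complex.reCLM.integral_comp_comm hF).symm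
  rw [hre _ (L2.integrable_inner _ _), hre _ (L2.integrable_inner _ _)] at h2
  have e1 : ∫ x, realMultiplier m hm f x * deriv θ x = ∫ x, (inner ℂ
      (((SchwartzMap.derivCLM ℂ ℂ Θ).toLp 2 volume : Lp ℂ 2 (volume : Measure ℝ)) x)
      (complexMultiplier m hm (ofRealLp f) x)).re := by
    apply integral_congr_ae
    filter_upwards [coeFn_reLp (complexMultiplier m hm (ofRealLp f)),
      (SchwartzMap.derivCLM ℂ ℂ Θ).coeFn_toLp 2 volume] with x h3 h4
    rw [realMultiplier_apply, h3, h4, hΘd]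
    simp
  have e2 : ∫ x, realMultiplier _ hm' f x * θ x = ∫ x, (inner ℂ
      ((Θ.toLp 2 volume : Lp ℂ 2 (volume : Measure ℝ)) x)
      (complexMultiplier _ hm' (ofRealLp f) x)).re := by
    apply integral_congr_ae
    filter_upwards [coeFn_reLp (complexMultiplier _ hm' (ofRealLp f)),
      Θ.coeFn_toLp 2 volume] with x h3 h4
    rw [realMultiplier_apply, h3, h4, hΘe]
    simp
  rw [e1, e2, h2]

/-- Integration by parts against Schwartz functions has no boundary terms, since all the products
involved are integrable. -/
theorem coeFn_fourierL2_of_hasDerivAt {z z₁ : ℝ → ℝ} (hz : ∀ x, HasDerivAt z (z₁ x) x)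
    (hz2 : MemLp z 2 volume) (hz₁2 : MemLp z₁ 2 volume) :
    fourierL2 (ofRealLp (hz₁2.toLp z₁)) =ᵐ[volume]
      fun ξ => 2 * Real.pi * Complex.I * ξ * fourierL2 (ofRealLp (hz2.toLp z)) ξ := by
  apply coeFn_fourierL2_of_inner_deriv
  intro θ
  rw [L2.inner_def, L2.inner_def]
  have e1 : ∀ (η : SchwartzMap ℝ ℂ) (y : ℝ → ℝ) (hy : MemLp y 2 volume),
      (fun x => inner ℂ ((η.toLp 2 volume : Lp ℂ 2 (volume : Measure ℝ)) x)
        (ofRealLp (hy.toLp y) x)) =ᵐ[volume] fun x => (y x : ℂ) * star (η x) := by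
    intro η y hy
    filter_upwards [coeFn_ofRealLp (hy.toLp y), hy.coeFn_toLp, η.coeFn_toLp 2 volume]
      with x h1 h2 h3
    rw [h1, h2, h3]
    simp
  have i1 : ∀ (η : SchwartzMap ℝ ℂ) (y : ℝ → ℝ) (hy : MemLp y 2 volume),
      Integrable fun x => (y x : ℂ) * star (η x) := fun η y hy =>
    (L2.integrable_inner (𝕜 := ℂ) (η.toLp 2 volume) (ofRealLp (hy.toLp y))).congr (e1 η y hy)
  rw [integral_congr_ae (e1 _ z hz2), integral_congr_ae (e1 _ z₁ hz₁2)]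
  refine integral_mul_deriv_eq_deriv_mul_of_integrable (fun x _ => (hz x).ofReal_comp)
    (fun x _ => ?_) (i1 _ z hz2) (i1 _ z₁ hz₁2) (i1 _ z hz2)
  rw [SchwartzMap.derivCLM_apply]
  exact (θ.hasDerivAt x).star

/-- The resolvent of the constant coefficient operator inverts it on `C²` functions. -/
theorem realMultiplier_resolvent {c d : ℝ} {z z₁ z₂ : ℝ → ℝ} (hz : ∀ x, HasDerivAt z (z₁ x) x)
    (hz₁ : ∀ x, HasDerivAt z₁ (z₂ x) x) (hz2 : MemLp z 2 volume) (hz₁2 : MemLp z₁ 2 volume)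
    (hz₂2 : MemLp z₂ 2 volume) {m : ℝ → ℂ} (hm : MemLp m ∞ volume)
    (hmul : ∀ ξ : ℝ, m ξ * (1 + c * (2 * Real.pi * Complex.I * ξ)
      - d * (2 * Real.pi * Complex.I * ξ) ^ 2) = 1) :
    realMultiplier m hm (c • hz₁2.toLp z₁ - d • hz₂2.toLp z₂ + hz2.toLp z) = hz2.toLp z := by
  rw [realMultiplier_apply]
  have : complexMultiplier m hm (ofRealLp (c • hz₁2.toLp z₁ - d • hz₂2.toLp z₂ + hz2.toLp z))
      = ofRealLp (hz2.toLp z) := by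
    apply fourierL2.injective
    apply Lp.ext
    set u := ofRealLp (hz2.toLp z)
    set u₁ := ofRealLp (hz₁2.toLp z₁)
    set u₂ := ofRealLp (hz₂2.toLp z₂)
    have e1 : ofRealLp (c • hz₁2.toLp z₁ - d • hz₂2.toLp z₂ + hz2.toLp z)
        = (c : ℂ) • u₁ - (d : ℂ) • u₂ + u := by
      rw [map_add, map_sub, map_smul, map_smul]
      rfl
    rw [e1]
    have e2 : fourierL2 ((c : ℂ) • u₁ - (d : ℂ) • u₂ + u)
        = (c : ℂ) • fourierL2 u₁ - (d : ℂ) • fourierL2 u₂ + fourierL2 u := by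
      rw [map_add, map_sub, map_smul, map_smul]
    filter_upwards [coeFn_fourierL2_complexMultiplier m hm ((c : ℂ) • u₁ - (d : ℂ) • u₂ + u),
      coeFn_fourierL2_of_hasDerivAt hz hz2 hz₁2, coeFn_fourierL2_of_hasDerivAt hz₁ hz₁2 hz₂2,
      Lp.coeFn_add ((c : ℂ) • fourierL2 u₁ - (d : ℂ) • fourierL2 u₂) (fourierL2 u),
      Lp.coeFn_sub ((c : ℂ) • fourierL2 u₁) ((d : ℂ) • fourierL2 u₂),
      Lp.coeFn_smul (c : ℂ) (fourierL2 u₁), Lp.coeFn_smul (d : ℂ) (fourierL2 u₂)]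
      with ξ h1 h2 h3 h4 h5 h6 h7
    rw [h1, e2, h4, Pi.add_apply, h5, Pi.sub_apply, h6, h7, Pi.smul_apply, Pi.smul_apply, h3, h2,
      smul_eq_mul, smul_eq_mul]
    linear_combination (fourierL2 u ξ) * hmul ξ
  rw [this, reLp_ofRealLp]

/-! ### The lattice resolvent -/

/-- The symbol of the lattice operator. -/
noncomputable def latticeSymbol (d₁ d₂ ε ξ : ℝ) : ℂ :=
  1 / (ε : ℂ) ^ 2 * (d₁ * (translationSymbol ε ξ - 2 + translationSymbol (-ε) ξ)
    + d₂ * (translationSymbol (2 * ε) ξ - 2 + translationSymbol (-(2 * ε)) ξ))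

/-- On the Fourier side A_ε multiplies by its symbol, so `hmul` gives the identity for the complex
multipliers. Real parts may then be taken because the operator has real coefficients; the multiplier
itself need not preserve real functions. -/
theorem ae_lattice_resolvent {c d₁ d₂ ε : ℝ} {m : ℝ → ℂ} (hm : MemLp m ∞ volume)
    (hm' : MemLp (fun ξ : ℝ => 2 * Real.pi * Complex.I * ξ * m ξ) ∞ volume)
    (hmul : ∀ ξ : ℝ, m ξ * (1 + c * (2 * Real.pi * Complex.I * ξ) - latticeSymbol d₁ d₂ ε ξ) = 1)
    (f : Lp ℝ 2 (volume : Measure ℝ)) :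
    ∀ᵐ x, c * realMultiplier _ hm' f x - latticeOp d₁ d₂ ε (realMultiplier m hm f) x
      + realMultiplier m hm f x = f x := by
  set F := ofRealLp f
  set u := complexMultiplier m hm F
  set v := complexMultiplier _ hm' F
  set e : ℂ := 1 / (ε : ℂ) ^ 2 with he
  have key : (c : ℂ) • v - ((e * d₁) • (translateLp ε u - (2 : ℂ) • u + translateLp (-ε) u)
      + (e * d₂) • (translateLp (2 * ε) u - (2 : ℂ) • u + translateLp (-(2 * ε)) u)) + u = F := by
    apply fourierL2.injective
    simp only [map_add, map_sub, map_smul, fourierL2_translateLp]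
    apply Lp.ext
    have t := fun s => coeFn_mulLp (translationSymbol s) (memLp_translationSymbol s) (fourierL2 u)
    set U := fourierL2 u
    set V := fourierL2 v
    have ad := fun a b : Lp ℂ 2 (volume : Measure ℝ) => Lp.coeFn_add a b
    have sb := fun a b : Lp ℂ 2 (volume : Measure ℝ) => Lp.coeFn_sub a b
    have sm := fun (r : ℂ) (b : Lp ℂ 2 (volume : Measure ℝ)) => Lp.coeFn_smul r b
    set T := fun s => mulLp (translationSymbol s) (memLp_translationSymbol s) U
    filter_upwards [t ε, t (-ε), t (2 * ε), t (-(2 * ε)),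
      coeFn_fourierL2_complexMultiplier m hm F, coeFn_fourierL2_complexMultiplier _ hm' F,
      ad ((c : ℂ) • V - ((e * d₁) • (T ε - (2 : ℂ) • U + T (-ε))
        + (e * d₂) • (T (2 * ε) - (2 : ℂ) • U + T (-(2 * ε))))) U,
      sb ((c : ℂ) • V) ((e * d₁) • (T ε - (2 : ℂ) • U + T (-ε))
        + (e * d₂) • (T (2 * ε) - (2 : ℂ) • U + T (-(2 * ε)))),
      ad ((e * d₁) • (T ε - (2 : ℂ) • U + T (-ε)))
        ((e * d₂) • (T (2 * ε) - (2 : ℂ) • U + T (-(2 * ε)))),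
      sm c V, sm 2 U,
      sm (e * d₁) (T ε - (2 : ℂ) • U + T (-ε)),
      sm (e * d₂) (T (2 * ε) - (2 : ℂ) • U + T (-(2 * ε))),
      ad (T ε - (2 : ℂ) • U) (T (-ε)), ad (T (2 * ε) - (2 : ℂ) • U) (T (-(2 * ε))),
      sb (T ε) ((2 : ℂ) • U), sb (T (2 * ε)) ((2 : ℂ) • U)] with
      ξ t1 t2 t3 t4 m1 m2 a1 a2 a3 a4 a5 a6 a7 a8 a9 a10 a11
    have t1' : T ε ξ = translationSymbol ε ξ * U ξ := t1
    have t2' : T (-ε) ξ = translationSymbol (-ε) ξ * U ξ := t2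
    have t3' : T (2 * ε) ξ = translationSymbol (2 * ε) ξ * U ξ := t3
    have t4' : T (-(2 * ε)) ξ = translationSymbol (-(2 * ε)) ξ * U ξ := t4
    have m1' : U ξ = m ξ * fourierL2 F ξ := m1
    have m2' : V ξ = 2 * Real.pi * Complex.I * ξ * m ξ * fourierL2 F ξ := m2
    refine a1.trans ?_
    rw [Pi.add_apply, a2, Pi.sub_apply, a3, Pi.add_apply, a4, Pi.smul_apply, a6, a7,
      Pi.smul_apply, Pi.smul_apply, a8, a9, Pi.add_apply, Pi.add_apply, a10, a11, Pi.sub_apply,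
      Pi.sub_apply, a5, Pi.smul_apply, t1', t2', t3', t4', m2', m1']
    simp only [smul_eq_mul]
    have h0 := hmul ξ
    unfold latticeSymbol at h0
    rw [← he] at h0
    linear_combination (fourierL2 F ξ) * h0
  have hae : ∀ s : ℝ, (fun x => (translateLp s u x).re) =ᵐ[volume]
      fun x => realMultiplier m hm f (x + s) := fun s => by
    have h1 := (measurePreserving_add_right (volume : Measure ℝ)
      s).quasiMeasurePreserving.ae_eq_comp (coeFn_reLp u)
    filter_upwards [coeFn_translateLp s u, h1] with x h2 h3
    rw [h2]
    exact h3.symm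
  set A := translateLp ε u
  set A' := translateLp (-ε) u
  set B := translateLp (2 * ε) u
  set B' := translateLp (-(2 * ε)) u
  have ad := fun a b : Lp ℂ 2 (volume : Measure ℝ) => Lp.coeFn_add a b
  have sb := fun a b : Lp ℂ 2 (volume : Measure ℝ) => Lp.coeFn_sub a b
  have sm := fun (r : ℂ) (b : Lp ℂ 2 (volume : Measure ℝ)) => Lp.coeFn_smul r b
  filter_upwards [hae ε, hae (-ε), hae (2 * ε), hae (-(2 * ε)), coeFn_reLp u, coeFn_reLp v,
    coeFn_ofRealLp f,
    ad ((c : ℂ) • v - ((e * d₁) • (A - (2 : ℂ) • u + A') + (e * d₂) • (B - (2 : ℂ) • u + B'))) u,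
    sb ((c : ℂ) • v) ((e * d₁) • (A - (2 : ℂ) • u + A') + (e * d₂) • (B - (2 : ℂ) • u + B')),
    ad ((e * d₁) • (A - (2 : ℂ) • u + A')) ((e * d₂) • (B - (2 : ℂ) • u + B')),
    sm c v, sm 2 u, sm (e * d₁) (A - (2 : ℂ) • u + A'), sm (e * d₂) (B - (2 : ℂ) • u + B'),
    ad (A - (2 : ℂ) • u) A', ad (B - (2 : ℂ) • u) B',
    sb A ((2 : ℂ) • u), sb B ((2 : ℂ) • u)] with
    x r1 r2 r3 r4 ru rv rf a1 a2 a3 a4 a5 a6 a7 a8 a9 a10 a11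
  rw [key] at a1
  rw [Pi.add_apply, a2, Pi.sub_apply, a3, Pi.add_apply, a4, Pi.smul_apply, a6, a7,
      Pi.smul_apply, Pi.smul_apply, a8, a9, Pi.add_apply, Pi.add_apply, a10, a11, Pi.sub_apply,
      Pi.sub_apply, a5, Pi.smul_apply, rf] at a1
  have hE : e = ((1 / ε ^ 2 : ℝ) : ℂ) := by rw [he]; push_cast; rfl
  rw [hE] at a1
  have a1' := congrArg Complex.re a1
  simp only [smul_eq_mul, Complex.ofReal_re, Complex.add_re, Complex.sub_re, ← Complex.ofReal_mul,
    Complex.re_ofReal_mul] at a1'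
  have h2re : ∀ w : ℂ, (2 * w).re = 2 * w.re := fun w => by simp
  rw [h2re, r1, r2, r3, r4, ← ru, ← rv] at a1'
  unfold latticeOp
  rw [a1']
  change c * reLp v x - 1 / ε ^ 2 * (d₁ * (reLp u (x + ε) - 2 * reLp u x + reLp u (x - ε))
    + d₂ * (reLp u (x + 2 * ε) - 2 * reLp u x + reLp u (x - 2 * ε))) + reLp u x = _
  rw [sub_eq_add_neg x ε, sub_eq_add_neg x (2 * ε)]
  change _ = c * reLp v x - (1 / ε ^ 2 * d₁ * (reLp u (x + ε) - 2 * reLp u x + reLp u (x + -ε))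
    + 1 / ε ^ 2 * d₂ * (reLp u (x + 2 * ε) - 2 * reLp u x + reLp u (x + -(2 * ε)))) + reLp u x
  ring

/-! ### Estimates for the resolvent symbols -/

theorem abs_cos_sub_one_add_sq_div_two_le (x : ℝ) : |Real.cos x - 1 + x ^ 2 / 2| ≤ x ^ 4 / 2 := by
  rcases le_total |x| 1 with h | h
  · have := Real.cos_bound h
    rw [show Real.cos x - (1 - x ^ 2 / 2) = Real.cos x - 1 + x ^ 2 / 2 by ring] at this
    refine this.trans ?_
    rw [show |x| ^ 4 = x ^ 4 by rw [← abs_pow]; exact abs_of_nonneg (by positivity)]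
    nlinarith [show (0 : ℝ) ≤ x ^ 4 by positivity]
  · have h1 := Real.one_sub_sq_div_two_le_cos (x := x)
    have h2 := Real.cos_le_one x
    have h3 : 1 ≤ x ^ 2 := by rw [← sq_abs]; nlinarith
    rw [abs_le]
    constructor <;> nlinarith [sq_nonneg (x ^ 2)]

theorem translationSymbol_add_neg (s ξ : ℝ) :
    translationSymbol s ξ - 2 + translationSymbol (-s) ξ
      = ((2 * (Real.cos (s * (2 * Real.pi * ξ)) - 1) : ℝ) : ℂ) := by
  unfold translationSymbol
  have e1 : 2 * (Real.pi : ℂ) * s * ξ * Complex.I = ((s * (2 * Real.pi * ξ) : ℝ) : ℂ) * Complex.I := by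
    push_cast; ring
  have e2 : 2 * (Real.pi : ℂ) * ((-s : ℝ) : ℂ) * ξ * Complex.I
      = -((s * (2 * Real.pi * ξ) : ℝ) : ℂ) * Complex.I := by
    push_cast; ring
  rw [e1, e2]
  push_cast
  rw [show ∀ z w : ℂ, z - 2 + w = (z + w) - 2 from fun z w => by ring, ← Complex.two_cos]
  ring

/-- The real value of the lattice symbol. -/
noncomputable def latticeSymbolRe (d₁ d₂ ε ζ : ℝ) : ℝ :=
  1 / ε ^ 2 * (d₁ * (2 * (Real.cos (ε * ζ) - 1)) + d₂ * (2 * (Real.cos (2 * ε * ζ) - 1)))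

theorem latticeSymbol_eq (d₁ d₂ ε ξ : ℝ) :
    latticeSymbol d₁ d₂ ε ξ = (latticeSymbolRe d₁ d₂ ε (2 * Real.pi * ξ) : ℂ) := by
  unfold latticeSymbol latticeSymbolRe
  rw [translationSymbol_add_neg, translationSymbol_add_neg]
  push_cast
  rfl

/-- Fourth order Taylor remainder of the cosine, valid at every frequency; the 16 is 2⁴, from the
step 2ε. -/
theorem abs_latticeSymbolRe_add_le (d₁ d₂ : ℝ) {ε : ℝ} (hε : 0 < ε) (ζ : ℝ) :
    |latticeSymbolRe d₁ d₂ ε ζ + (d₁ + 4 * d₂) * ζ ^ 2| ≤ (|d₁| + 16 * |d₂|) * (ε ^ 2 * ζ ^ 4) := by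
  have e : latticeSymbolRe d₁ d₂ ε ζ + (d₁ + 4 * d₂) * ζ ^ 2
      = 1 / ε ^ 2 * (2 * d₁ * (Real.cos (ε * ζ) - 1 + (ε * ζ) ^ 2 / 2)
        + 2 * d₂ * (Real.cos (2 * ε * ζ) - 1 + (2 * ε * ζ) ^ 2 / 2)) := by
    unfold latticeSymbolRe
    field_simp
    ring
  have h1 : |2 * d₁ * (Real.cos (ε * ζ) - 1 + (ε * ζ) ^ 2 / 2)| ≤ 2 * |d₁| * ((ε * ζ) ^ 4 / 2) := by
    rw [abs_mul, abs_mul, abs_two]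
    gcongr
    exact abs_cos_sub_one_add_sq_div_two_le _
  have h2 : |2 * d₂ * (Real.cos (2 * ε * ζ) - 1 + (2 * ε * ζ) ^ 2 / 2)|
      ≤ 2 * |d₂| * ((2 * ε * ζ) ^ 4 / 2) := by
    rw [abs_mul, abs_mul, abs_two]
    gcongr
    exact abs_cos_sub_one_add_sq_div_two_le _
  rw [e, abs_mul, abs_of_pos (by positivity : 0 < 1 / ε ^ 2)]
  calc 1 / ε ^ 2 * _ ≤ 1 / ε ^ 2 * (2 * |d₁| * ((ε * ζ) ^ 4 / 2)
        + 2 * |d₂| * ((2 * ε * ζ) ^ 4 / 2)) := by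
        gcongr
        exact (abs_add_le _ _).trans (add_le_add h1 h2)
    _ = (|d₁| + 16 * |d₂|) * (ε ^ 2 * ζ ^ 4) := by
        field_simp
        ring

/-- The symbol of `1 + c ∂ - A_ε`. -/
noncomputable def latticeDenom (c d₁ d₂ ε ξ : ℝ) : ℂ :=
  1 + c * (2 * Real.pi * Complex.I * ξ) - latticeSymbol d₁ d₂ ε ξ

/-- The symbol of `1 + c ∂ - d ∂²`. -/
noncomputable def limitDenom (c d ξ : ℝ) : ℂ :=
  1 + c * (2 * Real.pi * Complex.I * ξ) - d * (2 * Real.pi * Complex.I * ξ) ^ 2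

theorem latticeDenom_eq (c d₁ d₂ ε ξ : ℝ) : latticeDenom c d₁ d₂ ε ξ
    = ((1 - latticeSymbolRe d₁ d₂ ε (2 * Real.pi * ξ) : ℝ) : ℂ)
      + ((c * (2 * Real.pi * ξ) : ℝ) : ℂ) * Complex.I := by
  rw [latticeDenom, latticeSymbol_eq]
  push_cast
  ring

theorem limitDenom_eq (c d ξ : ℝ) : limitDenom c d ξ
    = ((1 + d * (2 * Real.pi * ξ) ^ 2 : ℝ) : ℂ)
      + ((c * (2 * Real.pi * ξ) : ℝ) : ℂ) * Complex.I := by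
  rw [limitDenom]
  push_cast
  linear_combination (-(d : ℂ) * (2 * Real.pi * ξ) ^ 2) * Complex.I_sq

/-- The symbol of A_ε is real, so the imaginary part of the denominator is c · 2πξ. The bound is
independent of ε and survives where the real part vanishes. -/
theorem abs_mul_le_norm_latticeDenom (c d₁ d₂ ε ξ : ℝ) :
    |c| * |2 * Real.pi * ξ| ≤ ‖latticeDenom c d₁ d₂ ε ξ‖ := by
  have := Complex.abs_im_le_norm (latticeDenom c d₁ d₂ ε ξ)
  rw [latticeDenom_eq] at this ⊢
  rwa [Complex.add_im, Complex.ofReal_im, Complex.im_ofReal_mul, Complex.I_im, mul_one, zero_add,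
    abs_mul] at this

theorem abs_mul_le_norm_limitDenom (c d ξ : ℝ) :
    |c| * |2 * Real.pi * ξ| ≤ ‖limitDenom c d ξ‖ := by
  have := Complex.abs_im_le_norm (limitDenom c d ξ)
  rw [limitDenom_eq] at this ⊢
  rwa [Complex.add_im, Complex.ofReal_im, Complex.im_ofReal_mul, Complex.I_im, mul_one, zero_add,
    abs_mul] at this

theorem one_le_norm_limitDenom (c : ℝ) {d : ℝ} (hd : 0 < d) (ξ : ℝ) :
    1 ≤ ‖limitDenom c d ξ‖ := by
  have := Complex.abs_re_le_norm (limitDenom c d ξ)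
  rw [limitDenom_eq] at this ⊢
  rw [Complex.add_re, Complex.ofReal_re, Complex.re_ofReal_mul, Complex.I_re, mul_zero,
    add_zero] at this
  have h2 : 0 ≤ d * (2 * Real.pi * ξ) ^ 2 := by positivity
  rw [abs_of_nonneg (by linarith)] at this
  linarith

/-- For |2πξ| ≤ 1 the real part is at least 1/2 by consistency and d > 0; for |2πξ| ≥ 1 the
imaginary part is at least |c|. -/
theorem eventually_le_norm_latticeDenom {c d₁ d₂ : ℝ} (hd : 0 < d₁ + 4 * d₂) :
    ∀ᶠ ε in 𝓝[>] (0 : ℝ), ∀ ξ, min (1 / 2) |c| ≤ ‖latticeDenom c d₁ d₂ ε ξ‖ := by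
  have h0 : Tendsto (fun ε : ℝ => (|d₁| + 16 * |d₂|) * ε ^ 2) (𝓝[>] 0) (𝓝 0) := by
    have : Continuous fun ε : ℝ => (|d₁| + 16 * |d₂|) * ε ^ 2 := by fun_prop
    simpa using (this.tendsto 0).mono_left nhdsWithin_le_nhds
  filter_upwards [h0.eventually_le_const (show (0 : ℝ) < 1 / 2 by norm_num), self_mem_nhdsWithin]
    with ε h1 hε ξ
  have hε : 0 < ε := hε
  rcases le_total |2 * Real.pi * ξ| 1 with h | h
  · have h2 := abs_latticeSymbolRe_add_le d₁ d₂ hε (2 * Real.pi * ξ)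
    have h3 := Complex.abs_re_le_norm (latticeDenom c d₁ d₂ ε ξ)
    refine (min_le_left _ _).trans (le_trans ?_ h3)
    rw [latticeDenom_eq, Complex.add_re, Complex.ofReal_re, Complex.re_ofReal_mul, Complex.I_re,
      mul_zero, add_zero]
    refine le_trans ?_ (le_abs_self _)
    have h4 : (2 * Real.pi * ξ) ^ 4 ≤ 1 := by
      rw [← abs_of_nonneg (by positivity : 0 ≤ (2 * Real.pi * ξ) ^ 4), abs_pow]
      exact pow_le_one₀ (abs_nonneg _) h
    have h5 : (|d₁| + 16 * |d₂|) * (ε ^ 2 * (2 * Real.pi * ξ) ^ 4) ≤ (|d₁| + 16 * |d₂|) * ε ^ 2 := by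
      gcongr
      exact mul_le_of_le_one_right (by positivity) h4
    have h6 := (abs_le.1 h2).2
    have h7 : 0 ≤ (d₁ + 4 * d₂) * (2 * Real.pi * ξ) ^ 2 := by positivity
    linarith
  · refine (min_le_right _ _).trans (le_trans ?_ (abs_mul_le_norm_latticeDenom c d₁ d₂ ε ξ))
    exact le_mul_of_one_le_right (abs_nonneg _) h

theorem continuous_latticeDenom (c d₁ d₂ ε : ℝ) : Continuous (latticeDenom c d₁ d₂ ε) := by
  unfold latticeDenom latticeSymbol translationSymbol
  fun_prop

theorem continuous_limitDenom (c d : ℝ) : Continuous (limitDenom c d) := by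
  unfold limitDenom
  fun_prop

/-- The lattice resolvent symbols converge uniformly to the limit resolvent symbol. -/
theorem eventually_norm_inv_latticeDenom_sub_le {c d₁ d₂ : ℝ} (hd : 0 < d₁ + 4 * d₂) (hc : c ≠ 0)
    {δ : ℝ} (hδ : 0 < δ) : ∀ᶠ ε in 𝓝[>] (0 : ℝ), ∀ ξ,
      ‖(latticeDenom c d₁ d₂ ε ξ)⁻¹ - (limitDenom c (d₁ + 4 * d₂) ξ)⁻¹‖ ≤ δ := by
  set κ := min (1 / 2) |c| with hκ
  have hc' : 0 < |c| := abs_pos.2 hc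
  have hκ0 : 0 < κ := lt_min (by norm_num) hc'
  -- Beyond this frequency each inverse is at most δ/2, by the imaginary parts. Below it the
  -- denominators differ by O(ε² R⁴).
  set R := 2 / (|c| * δ) with hR
  have hR0 : 0 < R := by positivity
  have h0 : Tendsto (fun ε : ℝ => (|d₁| + 16 * |d₂|) * (ε ^ 2 * R ^ 4) / κ) (𝓝[>] 0) (𝓝 0) := by
    have : Continuous fun ε : ℝ => (|d₁| + 16 * |d₂|) * (ε ^ 2 * R ^ 4) / κ := by fun_prop
    simpa using (this.tendsto 0).mono_left nhdsWithin_le_nhds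
  filter_upwards [h0.eventually_le_const hδ, self_mem_nhdsWithin,
    eventually_le_norm_latticeDenom (c := c) hd] with ε h1 hε h2 ξ
  have hε : 0 < ε := hε
  have hN := h2 ξ
  have hN0 := one_le_norm_limitDenom c hd ξ
  rcases le_total |2 * Real.pi * ξ| R with h | h
  · have hne : latticeDenom c d₁ d₂ ε ξ ≠ 0 := norm_pos_iff.1 (hκ0.trans_le hN)
    have hne0 : limitDenom c (d₁ + 4 * d₂) ξ ≠ 0 := norm_pos_iff.1 (by linarith)
    rw [inv_sub_inv hne hne0, norm_div, norm_mul]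
    have e1 : limitDenom c (d₁ + 4 * d₂) ξ - latticeDenom c d₁ d₂ ε ξ
        = ((latticeSymbolRe d₁ d₂ ε (2 * Real.pi * ξ)
          + (d₁ + 4 * d₂) * (2 * Real.pi * ξ) ^ 2 : ℝ) : ℂ) := by
      rw [limitDenom_eq, latticeDenom_eq]
      push_cast
      ring
    rw [e1, Complex.norm_real, Real.norm_eq_abs]
    refine le_trans ?_ h1
    refine div_le_div₀ (by positivity) ?_ hκ0 ?_
    · refine (abs_latticeSymbolRe_add_le d₁ d₂ hε _).trans ?_
      have : (2 * Real.pi * ξ) ^ 4 ≤ R ^ 4 := by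
        rw [← abs_of_nonneg (by positivity : 0 ≤ (2 * Real.pi * ξ) ^ 4), abs_pow]
        gcongr
      gcongr
    · nlinarith
  · have hb : ∀ z : ℂ, |c| * |2 * Real.pi * ξ| ≤ ‖z‖ → ‖z⁻¹‖ ≤ δ / 2 := fun z hz => by
      have h3 : |c| * R ≤ ‖z‖ := le_trans (by gcongr) hz
      rw [norm_inv]
      have h4 : |c| * R = (δ / 2)⁻¹ := by
        rw [hR]
        field_simp
      rw [h4] at h3
      exact inv_le_of_inv_le₀ (by positivity) h3
    refine (norm_sub_le _ _).trans ?_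
    linarith [hb _ (abs_mul_le_norm_latticeDenom c d₁ d₂ ε ξ),
      hb _ (abs_mul_le_norm_limitDenom c (d₁ + 4 * d₂) ξ)]

theorem memLp_top_inv {N : ℝ → ℂ} (hN : Continuous N) {κ : ℝ} (hκ : 0 < κ) (h : ∀ ξ, κ ≤ ‖N ξ‖) :
    MemLp (fun ξ => (N ξ)⁻¹) ∞ volume :=
  memLp_top_of_continuous (C := κ⁻¹) (hN.inv₀ fun ξ => norm_pos_iff.1 (hκ.trans_le (h ξ)))
    fun ξ => by
      rw [norm_inv]
      exact inv_anti₀ hκ (h ξ)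

theorem norm_mul_inv_le {N : ℝ → ℂ} {c : ℝ} (hc : c ≠ 0)
    (h : ∀ ξ, |c| * |2 * Real.pi * ξ| ≤ ‖N ξ‖) (ξ : ℝ) :
    ‖2 * Real.pi * Complex.I * ξ * (N ξ)⁻¹‖ ≤ |c|⁻¹ := by
  have hc' : 0 < |c| := abs_pos.2 hc
  have e1 : ‖(2 * Real.pi * Complex.I * ξ : ℂ)‖ = |2 * Real.pi * ξ| := by
    have : (2 * Real.pi * Complex.I * ξ : ℂ) = ((2 * Real.pi * ξ : ℝ) : ℂ) * Complex.I := by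
      push_cast; ring
    rw [this, norm_mul, Complex.norm_real, Complex.norm_I, mul_one, Real.norm_eq_abs]
  rw [norm_mul, e1, norm_inv]
  rcases eq_or_lt_of_le (norm_nonneg (N ξ)) with h0 | h0
  · rw [← h0]
    simp [hc'.le]
  · rw [← div_eq_mul_inv, div_le_iff₀ h0, ← div_eq_inv_mul, le_div_iff₀ hc']
    linarith [h ξ]

theorem memLp_top_mul_inv {N : ℝ → ℂ} (hN : Continuous N) {κ c : ℝ} (hκ : 0 < κ)
    (hκN : ∀ ξ, κ ≤ ‖N ξ‖) (hc : c ≠ 0) (h : ∀ ξ, |c| * |2 * Real.pi * ξ| ≤ ‖N ξ‖) :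
    MemLp (fun ξ : ℝ => 2 * Real.pi * Complex.I * ξ * (N ξ)⁻¹) ∞ volume :=
  memLp_top_of_continuous
    (Continuous.mul (by fun_prop) (hN.inv₀ fun ξ => norm_pos_iff.1 (hκ.trans_le (hκN ξ))))
    (norm_mul_inv_le hc h)

/-! ### Consistency of the lattice operator on logistic profiles -/

/-- The mean value inequality is applied three times in the step size, each function vanishing at
step 0. The bound on the third derivative is required only on the window between the neighbours,
which keeps the estimate local. -/
theorem abs_second_difference_sub_le {f f₁ f₂ f₃ : ℝ → ℝ} (h₁ : ∀ x, HasDerivAt f (f₁ x) x)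
    (h₂ : ∀ x, HasDerivAt f₁ (f₂ x) x) (h₃ : ∀ x, HasDerivAt f₂ (f₃ x) x) {x h M : ℝ} (hh : 0 ≤ h)
    (hM : ∀ y ∈ Set.Icc (x - h) (x + h), |f₃ y| ≤ M) :
    |f (x + h) - 2 * f x + f (x - h) - h ^ 2 * f₂ x| ≤ 2 * M * h ^ 3 := by
  have hM0 : 0 ≤ M := (abs_nonneg _).trans (hM x ⟨by linarith, by linarith⟩)
  have mv : ∀ (F F' : ℝ → ℝ) (L : ℝ), (∀ t, HasDerivAt F (F' t) t) → F 0 = 0 → 0 ≤ L →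
      (∀ t ∈ Set.Icc 0 h, |F' t| ≤ L) → ∀ t ∈ Set.Icc 0 h, |F t| ≤ L * h := by
    intro F F' L hF h0 hL hF' t ht
    have := Convex.norm_image_sub_le_of_norm_hasDerivWithin_le (s := Set.Icc 0 h) (C := L)
      (fun z _ => (hF z).hasDerivWithinAt) hF' (convex_Icc 0 h) (Set.left_mem_Icc.2 hh) ht
    rw [h0, sub_zero, sub_zero, Real.norm_eq_abs, Real.norm_eq_abs, abs_of_nonneg ht.1] at this
    exact this.trans (mul_le_mul_of_nonneg_left ht.2 hL)
  have hp : ∀ (F F' : ℝ → ℝ), (∀ x, HasDerivAt F (F' x) x) → ∀ t,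
      HasDerivAt (fun t => F (x + t)) (F' (x + t)) t := fun F F' hF t => by
    simpa using (hF (x + t)).comp_const_add x t
  have hm : ∀ (F F' : ℝ → ℝ), (∀ x, HasDerivAt F (F' x) x) → ∀ t,
      HasDerivAt (fun t => F (x - t)) (-F' (x - t)) t := fun F F' hF t => by
    simpa using (hF (x - t)).comp_const_sub x t
  have b2 : ∀ t ∈ Set.Icc 0 h, |f₂ (x + t) + f₂ (x - t) - 2 * f₂ x| ≤ 2 * M * h := by
    refine mv _ (fun t => f₃ (x + t) - f₃ (x - t)) (2 * M) (fun t => ?_) (by simp; ring)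
      (by positivity) fun t ht => ?_
    · exact (((hp _ _ h₃ t).add (hm _ _ h₃ t)).sub_const _).congr_deriv (by ring)
    · refine (abs_sub _ _).trans ?_
      have e1 := hM (x + t) ⟨by linarith [ht.1], by linarith [ht.2]⟩
      have e2 := hM (x - t) ⟨by linarith [ht.2], by linarith [ht.1]⟩
      linarith
  have b1 : ∀ t ∈ Set.Icc 0 h, |f₁ (x + t) - f₁ (x - t) - 2 * f₂ x * t| ≤ 2 * M * h * h := by
    refine mv _ (fun t => f₂ (x + t) + f₂ (x - t) - 2 * f₂ x) (2 * M * h) (fun t => ?_) (by simp)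
      (by positivity) b2
    exact (((hp _ _ h₂ t).sub (hm _ _ h₂ t)).sub
      ((hasDerivAt_id t).const_mul _)).congr_deriv (by ring)
  have b0 : ∀ t ∈ Set.Icc 0 h, |f (x + t) - 2 * f x + f (x - t) - t ^ 2 * f₂ x|
      ≤ 2 * M * h * h * h := by
    refine mv _ (fun t => f₁ (x + t) - f₁ (x - t) - 2 * f₂ x * t) (2 * M * h * h) (fun t => ?_)
      (by simp; ring) (by positivity) b1
    exact ((((hp _ _ h₁ t).sub_const _).add (hm _ _ h₁ t)).sub
      (((hasDerivAt_id t).pow 2).mul_const _)).congr_deriv (by simp; ring)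
  have := b0 h ⟨hh, le_rfl⟩
  linarith

namespace IsLogistic

variable {k : ℝ} {φ : ℝ → ℝ}

theorem hasDerivAt₂ (h : IsLogistic k φ) (x : ℝ) :
    HasDerivAt (fun x => k * (φ x * (1 - φ x))) (k ^ 2 * (1 - 2 * φ x) * (φ x * (1 - φ x))) x :=
  ((h.hasDerivAt_mul_one_sub x).const_mul k).congr_deriv (by ring)

theorem hasDerivAt₃ (h : IsLogistic k φ) (x : ℝ) :
    HasDerivAt (fun x => k ^ 2 * (1 - 2 * φ x) * (φ x * (1 - φ x)))
      (k ^ 3 * ((1 - 2 * φ x) ^ 2 - 2 * (φ x * (1 - φ x))) * (φ x * (1 - φ x))) x :=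
  (((((h.hasDerivAt x).const_mul 2).const_sub 1).const_mul (k ^ 2)).mul
    (h.hasDerivAt_mul_one_sub x)).congr_deriv (by ring)

/-- Harnack inequality: the logarithmic derivative of φ(1 - φ) lies in [-k, k], so e^(kx) φ(1 - φ)
increases and e^(-kx) φ(1 - φ) decreases. -/
theorem mul_one_sub_le_exp (h : IsLogistic k φ) (hk : 0 < k) {x y r : ℝ} (hxy : |y - x| ≤ r) :
    φ y * (1 - φ y) ≤ Real.exp (k * r) * (φ x * (1 - φ x)) := by
  have hd : ∀ s z, HasDerivAt (fun z => Real.exp (s * z) * (φ z * (1 - φ z)))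
      ((s + k * (1 - 2 * φ z)) * (Real.exp (s * z) * (φ z * (1 - φ z)))) z := fun s z => by
    have h1 : HasDerivAt (fun y : ℝ => Real.exp (s * y)) (Real.exp (s * z) * (s * 1)) z :=
      ((hasDerivAt_id z).const_mul _).exp
    exact (h1.mul (h.hasDerivAt_mul_one_sub z)).congr_deriv (by ring)
  have hp := h.mul_one_sub_pos
  have hmono : Monotone fun z => Real.exp (k * z) * (φ z * (1 - φ z)) := by
    apply monotone_of_deriv_nonneg fun z => (hd k z).differentiableAt
    intro z
    rw [(hd k z).deriv]
    refine mul_nonneg ?_ (mul_pos (Real.exp_pos _) (hp z)).le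
    nlinarith [h.lt_one z]
  have hanti : Antitone fun z => Real.exp (-k * z) * (φ z * (1 - φ z)) := by
    apply antitone_of_deriv_nonpos fun z => (hd (-k) z).differentiableAt
    intro z
    rw [(hd (-k) z).deriv]
    refine mul_nonpos_of_nonpos_of_nonneg ?_ (mul_pos (Real.exp_pos _) (hp z)).le
    nlinarith [h.pos z]
  have hr : Real.exp (k * |y - x|) ≤ Real.exp (k * r) := by gcongr
  have key : φ y * (1 - φ y) ≤ Real.exp (k * |y - x|) * (φ x * (1 - φ x)) := by
    rcases le_total x y with hle | hle
    · have h1 := hanti hle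
      simp only at h1
      rw [abs_of_nonneg (sub_nonneg.2 hle)]
      have e1 : Real.exp (k * (y - x)) = Real.exp (k * y) * Real.exp (-k * x) := by
        rw [← Real.exp_add]; ring_nf
      have e2 : Real.exp (k * y) * Real.exp (-k * y) = 1 := by
        rw [← Real.exp_add]
        simp
      rw [e1, mul_assoc]
      calc φ y * (1 - φ y) = Real.exp (k * y) * (Real.exp (-k * y) * (φ y * (1 - φ y))) := by
            rw [← mul_assoc, e2, one_mul]
        _ ≤ _ := mul_le_mul_of_nonneg_left h1 (Real.exp_pos _).le
    · have h1 := hmono hle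
      simp only at h1
      rw [abs_of_nonpos (sub_nonpos.2 hle)]
      have e1 : Real.exp (k * -(y - x)) = Real.exp (-k * y) * Real.exp (k * x) := by
        rw [← Real.exp_add]; ring_nf
      have e2 : Real.exp (-k * y) * Real.exp (k * y) = 1 := by
        rw [← Real.exp_add]
        simp
      rw [e1, mul_assoc]
      calc φ y * (1 - φ y) = Real.exp (-k * y) * (Real.exp (k * y) * (φ y * (1 - φ y))) := by
            rw [← mul_assoc, e2, one_mul]
        _ ≤ _ := mul_le_mul_of_nonneg_left h1 (Real.exp_pos _).le
  exact key.trans (mul_le_mul_of_nonneg_right hr (hp x).le)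

/-- The third derivative on the window is controlled by φ(1 - φ) at the centre, so the residual is
bounded pointwise by a square integrable function. The exponent 2 bounds the largest displacement
2ε. -/
theorem abs_latticeOp_sub_le (h : IsLogistic k φ) (hk : 0 < k) (d₁ d₂ : ℝ) {ε : ℝ} (hε : 0 < ε)
    (hε1 : ε ≤ 1) (x : ℝ) :
    |latticeOp d₁ d₂ ε φ x - (d₁ + 4 * d₂) * (k ^ 2 * (1 - 2 * φ x) * (φ x * (1 - φ x)))|
      ≤ ε * ((2 * |d₁| + 16 * |d₂|) * k ^ 3 * Real.exp (k * 2) * (φ x * (1 - φ x))) := by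
  set M := k ^ 3 * (Real.exp (k * 2) * (φ x * (1 - φ x))) with hM
  set D := k ^ 2 * (1 - 2 * φ x) * (φ x * (1 - φ x)) with hD
  have hp := h.mul_one_sub_pos x
  have hsd : ∀ s, 0 ≤ s → s ≤ 2 → |φ (x + s) - 2 * φ x + φ (x - s) - s ^ 2 * D| ≤ 2 * M * s ^ 3 := by
    intro s hs hs2
    refine abs_second_difference_sub_le h.hasDerivAt h.hasDerivAt₂ h.hasDerivAt₃ hs fun y hy => ?_
    have h1 := h.mul_one_sub_le_exp hk (x := x) (y := y) (r := 2)
      (abs_le.2 ⟨by linarith [hy.1], by linarith [hy.2]⟩)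
    have h2 := h.mul_one_sub_pos y
    rw [abs_mul, abs_mul, abs_of_pos (pow_pos hk 3), abs_of_pos h2, hM, mul_assoc]
    refine mul_le_mul_of_nonneg_left (le_trans ?_ h1) (pow_pos hk 3).le
    refine mul_le_of_le_one_left h2.le (abs_le.2 ⟨?_, ?_⟩) <;> nlinarith [h.pos y, h.lt_one y]
  have h1 := hsd ε hε.le (by linarith)
  have h2 := hsd (2 * ε) (by linarith) (by linarith)
  have e : latticeOp d₁ d₂ ε φ x - (d₁ + 4 * d₂) * D
      = 1 / ε ^ 2 * (d₁ * (φ (x + ε) - 2 * φ x + φ (x - ε) - ε ^ 2 * D)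
        + d₂ * (φ (x + 2 * ε) - 2 * φ x + φ (x - 2 * ε) - (2 * ε) ^ 2 * D)) := by
    unfold latticeOp
    field_simp
    ring
  rw [e, abs_mul, abs_of_pos (by positivity : 0 < 1 / ε ^ 2)]
  calc 1 / ε ^ 2 * _ ≤ 1 / ε ^ 2 * (|d₁| * (2 * M * ε ^ 3) + |d₂| * (2 * M * (2 * ε) ^ 3)) := by
        gcongr
        refine (abs_add_le _ _).trans ?_
        rw [abs_mul, abs_mul]
        gcongr
    _ = _ := by
        rw [hM]
        field_simp
        ring

end IsLogistic

/-! ### A fixed point theorem on a ball -/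

/-- The last bound comes from ‖x‖ ≤ ‖Ψ x - Ψ 0‖ + ‖Ψ 0‖ ≤ ‖x‖/2 + ‖Ψ 0‖. It makes the solution as
small as the residual, not merely of size r. -/
theorem exists_fixedPoint_of_contraction {E : Type*} [NormedAddCommGroup E] [CompleteSpace E]
    {Ψ : E → E} {r : ℝ} (hlip : ∀ x y, ‖x‖ ≤ r → ‖y‖ ≤ r → ‖Ψ x - Ψ y‖ ≤ 1 / 2 * ‖x - y‖)
    (h0 : ‖Ψ 0‖ ≤ r / 2) : ∃ x, ‖x‖ ≤ r ∧ Ψ x = x ∧ ‖x‖ ≤ 2 * ‖Ψ 0‖ := by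
  have hr : 0 ≤ r := by linarith [norm_nonneg (Ψ 0)]
  have hmaps : Set.MapsTo Ψ (Metric.closedBall 0 r) (Metric.closedBall 0 r) := by
    intro x hx
    rw [mem_closedBall_zero_iff] at *
    have h1 := hlip x 0 hx (by simpa using hr)
    rw [sub_zero] at h1
    have h2 : ‖Ψ x‖ ≤ ‖Ψ x - Ψ 0‖ + ‖Ψ 0‖ := by
      simpa using norm_add_le (Ψ x - Ψ 0) (Ψ 0)
    linarith
  have hcontr : ContractingWith (1 / 2) (hmaps.restrict Ψ _ _) := by
    refine ⟨by norm_num, LipschitzWith.of_dist_le_mul fun x y => ?_⟩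
    have hx := mem_closedBall_zero_iff.1 x.2
    have hy := mem_closedBall_zero_iff.1 y.2
    have := hlip x y hx hy
    rw [Subtype.dist_eq, Subtype.dist_eq, dist_eq_norm, dist_eq_norm]
    simpa using this
  obtain ⟨x, hx, hfix, -⟩ := hcontr.exists_fixedPoint' Metric.isClosed_closedBall.isComplete hmaps
    (x := 0) (by simpa using hr) (edist_ne_top _ _)
  have hxr := mem_closedBall_zero_iff.1 hx
  refine ⟨x, hxr, hfix, ?_⟩
  have h1 := hlip x 0 hxr (by simpa using hr)
  rw [hfix.eq, sub_zero] at h1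
  have h2 : ‖x‖ ≤ ‖x - Ψ 0‖ + ‖Ψ 0‖ := by simpa using norm_add_le (x - Ψ 0) (Ψ 0)
  linarith

/-! ### Bounded right inverses of bordered operators -/

-- By duality, solvability with uniform bounds on a dense set gives ‖χ‖ ≤ C (‖S* χ‖ + |⟨e, χ⟩|).
-- Hence L = S S* + ⟨e, ·⟩ e is coercive and invertible by Lax–Milgram, and J = S* L⁻¹, l = ⟨e, L⁻¹
-- ·⟩ form a linear right inverse.
open ContinuousLinearMap in
theorem exists_rightInverse_of_dense_solvability {H : Type*} [NormedAddCommGroup H]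
    [InnerProductSpace ℝ H] [CompleteSpace H] (S : H →L[ℝ] H) (e : H) {C : ℝ} (hC : 0 ≤ C)
    (hS : ∀ χ : H, ∀ δ > 0, ∃ g, ‖χ - g‖ ≤ δ ∧ ∃ (h : H) (γ : ℝ), S h + γ • e = g ∧
      ‖h‖ ≤ C * ‖g‖ ∧ |γ| ≤ C * ‖g‖) :
    ∃ (J : H →L[ℝ] H) (l : H →L[ℝ] ℝ), ∀ g, S (J g) + l g • e = g := by
  have bound : ∀ χ, ‖χ‖ ≤ C * (‖adjoint S χ‖ + |inner ℝ e χ|) := by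
    intro χ
    set Q := ‖adjoint S χ‖ + |inner ℝ e χ| with hQ
    have hQ0 : 0 ≤ Q := by positivity
    have h1 : ∀ δ > 0, ‖χ‖ ^ 2 ≤ C * ‖χ‖ * Q + δ * (‖χ‖ + C * Q) := by
      intro δ hδ
      obtain ⟨g, hg, h, γ, hgeq, hh, hγ⟩ := hS χ δ hδ
      have e1 : inner ℝ g χ = inner ℝ h (adjoint S χ) + γ * inner ℝ e χ := by
        rw [← hgeq, inner_add_left, inner_smul_left, adjoint_inner_right]
        rfl
      have e2 : inner ℝ g χ ≤ C * ‖g‖ * Q := by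
        rw [e1, hQ, mul_add]
        refine add_le_add ?_ ?_
        · exact (real_inner_le_norm _ _).trans (mul_le_mul_of_nonneg_right hh (norm_nonneg _))
        · refine (le_abs_self _).trans ?_
          rw [abs_mul]
          exact mul_le_mul_of_nonneg_right hγ (abs_nonneg _)
      have e3 : inner ℝ (χ - g) χ ≤ δ * ‖χ‖ :=
        (real_inner_le_norm _ _).trans (mul_le_mul_of_nonneg_right hg (norm_nonneg _))
      have e4 : ‖χ‖ ^ 2 = inner ℝ (χ - g) χ + inner ℝ g χ := by
        rw [← inner_add_left, sub_add_cancel, real_inner_self_eq_norm_sq]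
      have e5 : ‖g‖ ≤ ‖χ‖ + δ := by
        have := norm_sub_le χ (χ - g)
        rw [sub_sub_cancel] at this
        linarith
      have e6 : C * ‖g‖ * Q ≤ C * (‖χ‖ + δ) * Q := by gcongr
      linarith
    have h2 : ‖χ‖ ^ 2 ≤ C * ‖χ‖ * Q := by
      refine le_of_forall_pos_le_add fun η hη => ?_
      set A := ‖χ‖ + C * Q with hA
      have hA0 : 0 ≤ A := by positivity
      refine (h1 (η / (A + 1)) (by positivity)).trans ?_
      have : η / (A + 1) * A ≤ η := by
        rw [div_mul_eq_mul_div, div_le_iff₀ (by positivity)]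
        nlinarith
      linarith
    rcases eq_or_lt_of_le (norm_nonneg χ) with h0 | h0
    · rw [← h0]; positivity
    · nlinarith
  set K : H →L[ℝ] H := S ∘L adjoint S + (innerSL ℝ e).smulRight e with hK
  have hKe : ∀ χ, inner ℝ (K χ) χ = ‖adjoint S χ‖ ^ 2 + (inner ℝ e χ) ^ 2 := by
    intro χ
    rw [hK, add_apply, inner_add_left, comp_apply, smulRight_apply, inner_smul_left,
      ← adjoint_inner_right, real_inner_self_eq_norm_sq, innerSL_apply_apply]
    simp [sq]
  have hco : IsCoercive ((innerSL ℝ).comp K : H →L[ℝ] H →L[ℝ] ℝ) := by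
    refine ⟨1 / (2 * C ^ 2 + 1), by positivity, fun χ => ?_⟩
    change _ ≤ inner ℝ (K χ) χ
    rw [hKe, mul_assoc, div_mul_eq_mul_div, one_mul, div_le_iff₀ (by positivity), ← sq]
    have h1 := bound χ
    have h2 : ‖χ‖ ^ 2 ≤ (C * (‖adjoint S χ‖ + |inner ℝ e χ|)) ^ 2 := by gcongr
    have h3 : (‖adjoint S χ‖ + |inner ℝ e χ|) ^ 2
        ≤ 2 * (‖adjoint S χ‖ ^ 2 + (inner ℝ e χ) ^ 2) := by
      rw [← sq_abs (inner ℝ e χ)]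
      nlinarith [sq_nonneg (‖adjoint S χ‖ - |inner ℝ e χ|)]
    rw [mul_pow] at h2
    nlinarith [mul_le_mul_of_nonneg_left h3 (sq_nonneg C), sq_nonneg (‖adjoint S χ‖),
      sq_nonneg (inner ℝ e χ)]
  set L := hco.continuousLinearEquivOfBilin with hL
  have hLK : ∀ χ, L χ = K χ := by
    intro χ
    refine ext_inner_right ℝ fun w => ?_
    rw [hL, hco.continuousLinearEquivOfBilin_apply]
    rfl
  refine ⟨adjoint S ∘L (L.symm : H →L[ℝ] H), (innerSL ℝ e) ∘L (L.symm : H →L[ℝ] H), fun g => ?_⟩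
  have h1 := hLK (L.symm g)
  rw [L.apply_symm_apply] at h1
  conv_rhs => rw [h1]
  rfl

/-! ### The linearisation at the limit front -/

theorem memLp_two_of_sq {f : ℝ → ℝ} (hf : Continuous f) (h : Integrable fun x => f x ^ 2) :
    MemLp f 2 volume :=
  (memLp_two_iff_integrable_sq hf.aestronglyMeasurable).2 h

theorem norm_toLp_sq {f : ℝ → ℝ} (hf : MemLp f 2 volume) :
    ‖hf.toLp f‖ ^ 2 = ∫ x, f x ^ 2 := by
  rw [← real_inner_self_eq_norm_sq, L2.inner_def]
  apply integral_congr_ae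
  filter_upwards [hf.coeFn_toLp] with x hx
  rw [hx]
  simp [sq]

namespace IsLogistic

variable {k d a : ℝ} {φ : ℝ → ℝ}

theorem memLp_deriv (h : IsLogistic k φ) (hk : 0 < k) :
    MemLp (fun x => k * (φ x * (1 - φ x))) 2 volume := by
  have := h.continuous
  refine memLp_two_of_sq (by fun_prop) ?_
  simp only [mul_pow k]
  exact (h.integrable_mul_one_sub_sq hk).const_mul _

/-- The potential `f_a'(φ) - 1` of the linearisation. -/
theorem abs_potential_le (h : IsLogistic k φ) (ha₀ : 0 < a) (ha₁ : a < 1) (x : ℝ) :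
    ‖3 * φ x ^ 2 - 2 * (1 + a) * φ x + a - 1‖ ≤ 5 := by
  have h0 := h.pos x
  have h1 := h.lt_one x
  rw [Real.norm_eq_abs, abs_le]
  constructor <;> nlinarith [mul_pos ha₀ h0]

theorem memLp_potential (h : IsLogistic k φ) (ha₀ : 0 < a) (ha₁ : a < 1) :
    MemLp (fun x => 3 * φ x ^ 2 - 2 * (1 + a) * φ x + a - 1) ∞ volume := by
  have := h.continuous
  exact memLp_top_of_bound (by fun_prop : Continuous _).aestronglyMeasurable 5
    (Eventually.of_forall fun x => h.abs_potential_le ha₀ ha₁ x)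

/-- With v = (1 + c ∂ - d ∂²) z, that is z = T v, the linearised equation becomes v + B T v + γ φ' =
g with bounded operators on L². Solvability for compactly supported g then suffices. -/
theorem exists_rightInverse (h : IsLogistic k φ) (hk : 0 < k) (hd : 0 < d)
    (hk2 : 2 * d * k ^ 2 = 1) (ha₀ : 0 < a) (ha₁ : a < 1)
    {m : ℝ → ℂ} (hm : MemLp m ∞ volume)
    (hmul : ∀ ξ : ℝ, m ξ * (1 + ((d * k * (1 - 2 * a) : ℝ) : ℂ) * (2 * Real.pi * Complex.I * ξ)
      - d * (2 * Real.pi * Complex.I * ξ) ^ 2) = 1) :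
    ∃ (J : Lp ℝ 2 (volume : Measure ℝ) →L[ℝ] Lp ℝ 2 (volume : Measure ℝ))
      (l : Lp ℝ 2 (volume : Measure ℝ) →L[ℝ] ℝ), ∀ g,
      J g + mulLp _ (h.memLp_potential ha₀ ha₁) (realMultiplier m hm (J g))
        + l g • (h.memLp_deriv hk).toLp _ = g := by
  set B := mulLp _ (h.memLp_potential ha₀ ha₁) with hB
  set e := (h.memLp_deriv hk).toLp _ with he
  set T := realMultiplier m hm with hT
  obtain ⟨C, hC, hsol⟩ := h.exists_linearised_solution hk hd hk2 ha₀ ha₁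
  have key := exists_rightInverse_of_dense_solvability
    (ContinuousLinearMap.id ℝ (Lp ℝ 2 (volume : Measure ℝ)) + B ∘L T) e
    -- The first three terms bound v = g - γ φ' - B z, where 5 bounds the potential; the last one
    -- bounds γ.
    (C := 1 + Real.sqrt C * ‖e‖ + 5 * Real.sqrt C + Real.sqrt C) (by positivity) ?_
  · obtain ⟨J, l, hJl⟩ := key
    exact ⟨J, l, fun g => hJl g⟩
  intro χ δ hδ
  obtain ⟨g, hgs, hgχ, hgc, hgL⟩ := (Lp.memLp χ).exists_hasCompactSupport_eLpNorm_sub_le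
    (by norm_num) (ε := ENNReal.ofReal δ) (by simpa using hδ)
  obtain ⟨γ, z, z₁, z₂, hz, hz₁, hz₂c, hz2, hz₁2, hz₂2, heq, hγ, hzC⟩ := hsol g hgc hgs
  have hzL : MemLp z 2 volume :=
    memLp_two_of_sq (continuous_iff_continuousAt.2 fun x => (hz x).continuousAt) hz2
  have hz₁L : MemLp z₁ 2 volume :=
    memLp_two_of_sq (continuous_iff_continuousAt.2 fun x => (hz₁ x).continuousAt) hz₁2
  have hz₂L : MemLp z₂ 2 volume := memLp_two_of_sq hz₂c hz₂2
  set v := (d * k * (1 - 2 * a)) • hz₁L.toLp z₁ - d • hz₂L.toLp z₂ + hzL.toLp z with hv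
  have hTv : T v = hzL.toLp z := realMultiplier_resolvent hz hz₁ hzL hz₁L hz₂L hm hmul
  have hsum : v + B (hzL.toLp z) + γ • e = hgL.toLp g := by
    apply Lp.ext
    set Z := hzL.toLp z
    set Z₁ := hz₁L.toLp z₁
    set Z₂ := hz₂L.toLp z₂
    filter_upwards [hzL.coeFn_toLp, hz₁L.coeFn_toLp, hz₂L.coeFn_toLp, hgL.coeFn_toLp,
      (h.memLp_deriv hk).coeFn_toLp, coeFn_mulLp _ (h.memLp_potential ha₀ ha₁) Z,
      Lp.coeFn_add (v + B Z) (γ • e), Lp.coeFn_add v (B Z),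
      Lp.coeFn_add ((d * k * (1 - 2 * a)) • Z₁ - d • Z₂) Z,
      Lp.coeFn_sub ((d * k * (1 - 2 * a)) • Z₁) (d • Z₂),
      Lp.coeFn_smul (d * k * (1 - 2 * a)) Z₁, Lp.coeFn_smul d Z₂, Lp.coeFn_smul γ e]
      with x h1 h2 h3 h4 h5 h6 h7 h8 h9 h10 h11 h12 h13
    rw [h7, Pi.add_apply, h8, Pi.add_apply, hv, h9, Pi.add_apply, h10, Pi.sub_apply, h11, h12,
      h13, hB, h6, Pi.smul_apply, Pi.smul_apply, Pi.smul_apply, h1, h2, h3, h4, he, h5, ← heq x]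
    simp only [smul_eq_mul]
    ring
  have hgn : ‖hgL.toLp g‖ ^ 2 = ∫ x, g x ^ 2 := norm_toLp_sq hgL
  have hzn : ‖hzL.toLp z‖ ≤ Real.sqrt C * ‖hgL.toLp g‖ := by
    rw [← hgn, ← norm_toLp_sq hzL] at hzC
    refine abs_le_of_sq_le_sq' ?_ (by positivity) |>.2
    rw [mul_pow, Real.sq_sqrt hC]
    exact hzC
  have hγn : |γ| ≤ Real.sqrt C * ‖hgL.toLp g‖ := by
    rw [← hgn] at hγ
    refine abs_le_of_sq_le_sq ?_ (by positivity)
    rw [mul_pow, Real.sq_sqrt hC]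
    exact hγ
  refine ⟨hgL.toLp g, ?_, v, γ, ?_, ?_, ?_⟩
  · rw [← Lp.toLp_coeFn χ (Lp.memLp χ), ← MemLp.toLp_sub, Lp.norm_toLp]
    exact ENNReal.toReal_le_of_le_ofReal hδ.le hgχ
  · change v + B (T v) + γ • e = _
    rw [hTv, hsum]
  · have e1 : v = hgL.toLp g - γ • e - B (hzL.toLp z) := by rw [← hsum]; abel
    have e2 : ‖B (hzL.toLp z)‖ ≤ 5 * ‖hzL.toLp z‖ :=
      norm_mulLp_apply_le _ (h.abs_potential_le ha₀ ha₁) _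
    have e3 : ‖γ • e‖ ≤ Real.sqrt C * ‖hgL.toLp g‖ * ‖e‖ := by
      rw [norm_smul, Real.norm_eq_abs]
      gcongr
    have e4 : ‖v‖ ≤ ‖hgL.toLp g‖ + ‖γ • e‖ + ‖B (hzL.toLp z)‖ := by
      rw [e1]
      exact (norm_sub_le _ _).trans (add_le_add (norm_sub_le _ _) le_rfl)
    have e5 : 0 ≤ Real.sqrt C * ‖hgL.toLp g‖ := by positivity
    linarith
  · have e1 : 0 ≤ ‖hgL.toLp g‖ * (1 + Real.sqrt C * ‖e‖ + 5 * Real.sqrt C) := by positivity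
    linarith

end IsLogistic

/-! ### The bordered nonlinear equation -/

/-- Putting h = J g and γ = l g inverts the part with T₀ exactly and leaves a fixed point equation
for g. Its Lipschitz constant is at most 1/4 from the nonlinear terms, by smallness of r, plus 1/4
from replacing T₀ by T. -/
theorem exists_bordered_solution {E : Type*} [NormedAddCommGroup E] [NormedSpace ℝ E]
    [CompleteSpace E] {J B T T₀ D : E →L[ℝ] E} {l : E →L[ℝ] ℝ} {e R : E} {N : E → E}
    (hJ : ∀ g, J g + B (T₀ (J g)) + l g • e = g) {K L M₀ δ r : ℝ} (hL : 0 ≤ L)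
    (hD : ∀ h, ‖D h‖ ≤ K * ‖h‖) (hT : ∀ h, ‖T h - T₀ h‖ ≤ δ * ‖h‖) (hN0 : N 0 = 0)
    (hN : ∀ M ≤ M₀, ∀ h h', ‖h‖ ≤ M → ‖h'‖ ≤ M → ‖N (T h) - N (T h')‖ ≤ L * M * ‖h - h'‖)
    (hr : ‖J‖ * r ≤ M₀) (hr4 : (2 * ‖l‖ * K * ‖J‖ + L * ‖J‖ ^ 2) * r ≤ 1 / 4)
    (hK : 0 ≤ K) (hδ0 : 0 ≤ δ) (hδ : ‖B‖ * δ * ‖J‖ ≤ 1 / 4) (hR : ‖R‖ ≤ r / 2) :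
    ∃ g, ‖g‖ ≤ 2 * ‖R‖ ∧
      J g + B (T (J g)) + l g • e = R - l g • D (J g) - N (T (J g)) := by
  set Ψ : E → E := fun g => R - l g • D (J g) - N (T (J g)) - B (T (J g) - T₀ (J g)) with hΨ
  have hr0 : 0 ≤ r := by linarith [norm_nonneg R]
  have hΨ0 : Ψ 0 = R := by simp [hΨ, hN0]
  have hlip : ∀ x y, ‖x‖ ≤ r → ‖y‖ ≤ r → ‖Ψ x - Ψ y‖ ≤ 1 / 2 * ‖x - y‖ := by
    intro x y hx hy
    have hJx : ∀ z, ‖z‖ ≤ r → ‖J z‖ ≤ ‖J‖ * r := fun z hz =>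
      (J.le_opNorm z).trans (mul_le_mul_of_nonneg_left hz (norm_nonneg _))
    have hJxy : ‖J x - J y‖ ≤ ‖J‖ * ‖x - y‖ := by
      rw [← map_sub]
      exact J.le_opNorm _
    have e1 : Ψ x - Ψ y = -(l (x - y) • D (J x)) - l y • D (J x - J y)
        - (N (T (J x)) - N (T (J y))) - B (T (J x - J y) - T₀ (J x - J y)) := by
      simp only [hΨ, map_sub, sub_smul, smul_sub]
      abel
    have b1 : ‖l (x - y) • D (J x)‖ ≤ (‖l‖ * ‖x - y‖) * (K * (‖J‖ * r)) := by
      rw [norm_smul]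
      exact mul_le_mul (l.le_opNorm _) ((hD _).trans (mul_le_mul_of_nonneg_left (hJx x hx) hK))
        (norm_nonneg _) (by positivity)
    have b2 : ‖l y • D (J x - J y)‖ ≤ (‖l‖ * r) * (K * (‖J‖ * ‖x - y‖)) := by
      rw [norm_smul]
      exact mul_le_mul ((l.le_opNorm _).trans (mul_le_mul_of_nonneg_left hy (norm_nonneg _)))
        ((hD _).trans (mul_le_mul_of_nonneg_left hJxy hK)) (norm_nonneg _) (by positivity)
    have b3 : ‖N (T (J x)) - N (T (J y))‖ ≤ L * (‖J‖ * r) * (‖J‖ * ‖x - y‖) :=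
      (hN _ hr _ _ (hJx x hx) (hJx y hy)).trans
        (mul_le_mul_of_nonneg_left hJxy (by positivity))
    have b4 : ‖B (T (J x - J y) - T₀ (J x - J y))‖ ≤ ‖B‖ * (δ * (‖J‖ * ‖x - y‖)) :=
      (B.le_opNorm _).trans (mul_le_mul_of_nonneg_left
        ((hT _).trans (mul_le_mul_of_nonneg_left hJxy hδ0)) (norm_nonneg _))
    have t1 := norm_sub_le (-(l (x - y) • D (J x)) - l y • D (J x - J y)
        - (N (T (J x)) - N (T (J y)))) (B (T (J x - J y) - T₀ (J x - J y)))
    have t2 := norm_sub_le (-(l (x - y) • D (J x)) - l y • D (J x - J y))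
      (N (T (J x)) - N (T (J y)))
    have t3 := norm_sub_le (-(l (x - y) • D (J x))) (l y • D (J x - J y))
    rw [norm_neg] at t3
    rw [e1]
    have m1 := mul_le_mul_of_nonneg_right hr4 (norm_nonneg (x - y))
    have m2 := mul_le_mul_of_nonneg_right hδ (norm_nonneg (x - y))
    nlinarith
  obtain ⟨g, -, hfix, hg⟩ := exists_fixedPoint_of_contraction hlip (by rw [hΨ0]; exact hR)
  rw [hΨ0] at hg
  refine ⟨g, hg, ?_⟩
  have h1 : R - l g • D (J g) - N (T (J g)) - B (T (J g) - T₀ (J g)) = g := hfix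
  have h2 := hJ g
  rw [map_sub] at h1
  have h3 : J g + B (T (J g)) + l g • e
      = (J g + B (T₀ (J g)) + l g • e) + (B (T (J g)) - B (T₀ (J g))) := by abel
  rw [h3, h2]
  nth_rewrite 1 [← h1]
  abel

/-! ### The nonlinear remainder -/

open Classical in
/-- The superposition operator `w ↦ q w² + w³`, extended by zero where it leaves `L²`. -/
noncomputable def quadraticRemainder (q : ℝ → ℝ) (w : Lp ℝ 2 (volume : Measure ℝ)) :
    Lp ℝ 2 (volume : Measure ℝ) :=
  if h : MemLp (fun x => q x * w x ^ 2 + w x ^ 3) 2 volume then h.toLp _ else 0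

section Remainder

variable {q : ℝ → ℝ} {w v : Lp ℝ 2 (volume : Measure ℝ)} {M : ℝ}

theorem coeFn_quadraticRemainder (hq : Continuous q) (hq2 : ∀ x, |q x| ≤ 2)
    (hw : ∀ᵐ x, |w x| ≤ 1) :
    quadraticRemainder q w =ᵐ[volume] fun x => q x * w x ^ 2 + w x ^ 3 := by
  have hmem : MemLp (fun x => q x * w x ^ 2 + w x ^ 3) 2 volume := by
    refine (Lp.memLp w).of_le_mul (c := 3) ?_ ?_
    · have := (Lp.aestronglyMeasurable w)
      exact (hq.aestronglyMeasurable.mul (this.pow 2)).add (this.pow 3)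
    · filter_upwards [hw] with x hx
      have e : q x * w x ^ 2 + w x ^ 3 = (q x + w x) * w x * w x := by ring
      rw [Real.norm_eq_abs, Real.norm_eq_abs, e, abs_mul, abs_mul]
      have h1 : |q x + w x| ≤ 3 := (abs_add_le _ _).trans (by linarith [hq2 x])
      refine mul_le_mul_of_nonneg_right ?_ (abs_nonneg _)
      nlinarith [abs_nonneg (w x), abs_nonneg (q x + w x)]
  rw [quadraticRemainder, dif_pos hmem]
  exact hmem.coeFn_toLp

theorem quadraticRemainder_zero (hq : Continuous q) (hq2 : ∀ x, |q x| ≤ 2) :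
    quadraticRemainder q 0 = 0 := by
  have h0 := Lp.coeFn_zero ℝ 2 (volume : Measure ℝ)
  apply Lp.ext
  filter_upwards [h0, coeFn_quadraticRemainder (w := 0) hq hq2 (by
    filter_upwards [h0] with x hx
    rw [hx]
    simp)] with x h1 h2
  rw [h2, h1]
  simp

theorem norm_quadraticRemainder_sub_le (hq : Continuous q) (hq2 : ∀ x, |q x| ≤ 2) (hM : M ≤ 1)
    (hw : ∀ᵐ x, |w x| ≤ M) (hv : ∀ᵐ x, |v x| ≤ M) :
    ‖quadraticRemainder q w - quadraticRemainder q v‖ ≤ 7 * M * ‖w - v‖ := by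
  apply Lp.norm_le_mul_norm_of_ae_le_mul
  filter_upwards [hw, hv, Lp.coeFn_sub w v,
    Lp.coeFn_sub (quadraticRemainder q w) (quadraticRemainder q v),
    coeFn_quadraticRemainder hq hq2 (hw.mono fun x hx => hx.trans hM),
    coeFn_quadraticRemainder hq hq2 (hv.mono fun x hx => hx.trans hM)] with x h1 h2 h3 h4 h5 h6
  rw [h4, h3, Pi.sub_apply, Pi.sub_apply, h5, h6]
  -- The 7 is 4 from q (w + v) plus 1 for each of the three quadratic products, where M² ≤ M.
  have e : q x * w x ^ 2 + w x ^ 3 - (q x * v x ^ 2 + v x ^ 3)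
      = (q x * (w x + v x) + (w x * w x + w x * v x + v x * v x)) * (w x - v x) := by ring
  rw [Real.norm_eq_abs, Real.norm_eq_abs, e, abs_mul]
  refine mul_le_mul_of_nonneg_right ?_ (abs_nonneg _)
  have hM0 : 0 ≤ M := (abs_nonneg _).trans h1
  have hp : ∀ s t : ℝ, |s| ≤ M → |t| ≤ M → |s * t| ≤ M := fun s t hs ht => by
    rw [abs_mul]
    nlinarith [abs_nonneg s, abs_nonneg t]
  have hqq : |q x * (w x + v x)| ≤ 4 * M := by
    rw [abs_mul]
    have := (abs_add_le (w x) (v x))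
    nlinarith [abs_nonneg (q x), abs_nonneg (w x + v x), hq2 x]
  refine (abs_add_le _ _).trans ?_
  have := abs_add_three (w x * w x) (w x * v x) (v x * v x)
  linarith [hp _ _ h1 h1, hp _ _ h1 h2, hp _ _ h2 h2]

end Remainder

/-! ### Sobolev functions -/

theorem eH1Norm_le {W g : ℝ → ℝ} (h : IsWeakDeriv W g) (hW : MemLp W 2 volume)
    (hg : MemLp g 2 volume) :
    eH1Norm W ≤ ENNReal.ofReal (‖hW.toLp W‖ + ‖hg.toLp g‖) := by
  refine (iInf₂_le g h).trans ?_
  have h1 : eLpNorm W 2 volume = ENNReal.ofReal ‖hW.toLp W‖ := by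
    rw [Lp.norm_toLp, ENNReal.ofReal_toReal hW.2.ne]
  have h2 : eLpNorm g 2 volume = ENNReal.ofReal ‖hg.toLp g‖ := by
    rw [Lp.norm_toLp, ENNReal.ofReal_toReal hg.2.ne]
  rw [h1, h2, ENNReal.ofReal_add (norm_nonneg _) (norm_nonneg _)]
  set x := ENNReal.ofReal ‖hW.toLp W‖
  set y := ENNReal.ofReal ‖hg.toLp g‖
  calc (x ^ 2 + y ^ 2) ^ (1 / 2 : ℝ) ≤ ((x + y) ^ 2) ^ (1 / 2 : ℝ) := by
        refine ENNReal.rpow_le_rpow ?_ (by norm_num)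
        rw [add_sq]
        calc x ^ 2 + y ^ 2 ≤ x ^ 2 + y ^ 2 + 2 * x * y := le_self_add
          _ = _ := by ring
    _ = x + y := by
        rw [← ENNReal.rpow_natCast, ← ENNReal.rpow_mul]
        norm_num

theorem IsWeakDeriv.congr {w g W G : ℝ → ℝ} (h : IsWeakDeriv w g) (hw : w =ᵐ[volume] W)
    (hg : g =ᵐ[volume] G) : IsWeakDeriv W G := by
  refine ⟨h.1.congr hw, h.2.1.congr hg, fun θ hθ hθs => ?_⟩
  have h1 : ∫ x, W x * deriv θ x = ∫ x, w x * deriv θ x :=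
    integral_congr_ae (hw.mono fun x hx => by simp only [hx])
  have h2 : ∫ x, G x * θ x = ∫ x, g x * θ x :=
    integral_congr_ae (hg.mono fun x hx => by simp only [hx])
  rw [h1, h2, h.2.2 θ hθ hθs]

/-- Both W² and its derivative 2 W W' are integrable, which forces W² to vanish at infinity. -/
theorem tendsto_zero_of_memLp_two {W G : ℝ → ℝ} (hW : ∀ x, HasDerivAt W (G x) x)
    (h1 : MemLp W 2 volume) (h2 : MemLp G 2 volume) :
    Tendsto W atBot (𝓝 0) ∧ Tendsto W atTop (𝓝 0) := by
  have hd : ∀ x, HasDerivAt (fun y => W y ^ 2) (2 * (W x * G x)) x := fun x =>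
    ((hW x).pow 2).congr_deriv (by ring)
  have i1 : Integrable (fun y => W y ^ 2) := h1.integrable_sq
  have i2 : Integrable (fun x => 2 * (W x * G x)) := (h1.integrable_mul h2).const_mul 2
  have key : ∀ l : Filter ℝ, Tendsto (fun y => W y ^ 2) l (𝓝 0) → Tendsto W l (𝓝 0) := by
    intro l hl
    have := hl.sqrt
    simp only [Real.sqrt_sq_eq_abs, Real.sqrt_zero] at this
    exact (tendsto_zero_iff_abs_tendsto_zero _).2 this
  exact ⟨key _ (tendsto_zero_of_hasDerivAt_of_integrableOn_Iic (a := 0) (fun x _ => hd x)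
      i2.integrableOn i1.integrableOn),
    key _ (tendsto_zero_of_hasDerivAt_of_integrableOn_Ioi (a := 0) (fun x _ => hd x)
      i2.integrableOn i1.integrableOn)⟩

theorem continuous_latticeOp {u : ℝ → ℝ} (hu : Continuous u) (d₁ d₂ ε : ℝ) :
    Continuous (latticeOp d₁ d₂ ε u) := by
  unfold latticeOp
  fun_prop

theorem ae_latticeOp_congr {w W : ℝ → ℝ} (h : w =ᵐ[volume] W) (d₁ d₂ ε : ℝ) :
    latticeOp d₁ d₂ ε w =ᵐ[volume] latticeOp d₁ d₂ ε W := by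
  have hs : ∀ s : ℝ, ∀ᵐ x, w (x + s) = W (x + s) := fun s =>
    (measurePreserving_add_right volume s).quasiMeasurePreserving.ae_eq_comp h
  filter_upwards [h, hs ε, hs (-ε), hs (2 * ε), hs (-(2 * ε))] with x h0 h1 h2 h3 h4
  rw [← sub_eq_add_neg] at h2 h4
  simp only [latticeOp, h0, h1, h2, h3, h4]

/-- A perturbation in `H¹` that satisfies the lattice equation almost everywhere gives a classical
lattice front. -/
theorem exists_isLatticeFront_of_ae {a d₁ d₂ ε c : ℝ} {φ φ' : ℝ → ℝ}
    (hφ : ∀ x, HasDerivAt φ (φ' x) x) (hφ' : Continuous φ') (hbot : Tendsto φ atBot (𝓝 0))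
    (htop : Tendsto φ atTop (𝓝 1)) (hc : c ≠ 0) {w g : Lp ℝ 2 (volume : Measure ℝ)}
    (hw : IsWeakDeriv w g)
    (heq : ∀ᵐ x, c * (φ' x + g x) - (latticeOp d₁ d₂ ε φ x + latticeOp d₁ d₂ ε w x)
      + cubic a (φ x + w x) = 0) :
    ∃ u, IsLatticeFront a d₁ d₂ ε c u ∧ MemH1 (fun x => u x - φ x) ∧
      eH1Norm (fun x => u x - φ x) ≤ ENNReal.ofReal (‖w‖ + ‖g‖) := by
  obtain ⟨W, hWc, hWw, hWint, -⟩ := hw.exists_continuous_rep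
  have hφc : Continuous φ := continuous_iff_continuousAt.2 fun x => (hφ x).continuousAt
  set u : ℝ → ℝ := fun x => φ x + W x with hu
  have huc : Continuous u := hφc.add hWc
  -- G is the value of w' dictated by the equation, and it is continuous. It agrees almost
  -- everywhere with the weak derivative, so W, a primitive of g, is also a primitive of G and hence
  -- C¹.
  set G : ℝ → ℝ := fun x => (latticeOp d₁ d₂ ε u x - cubic a (u x)) / c - φ' x with hG
  have hGc : Continuous G := by
    have h1 := continuous_latticeOp huc d₁ d₂ ε
    have h2 : Continuous fun x => cubic a (u x) := by
      unfold cubic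
      fun_prop
    exact ((h1.sub h2).div_const c).sub hφ'
  have hgG : g =ᵐ[volume] G := by
    filter_upwards [heq, hWw, ae_latticeOp_congr hWw d₁ d₂ ε] with x h1 h2 h3
    rw [h2, h3] at h1
    have h4 : latticeOp d₁ d₂ ε u x = latticeOp d₁ d₂ ε φ x + latticeOp d₁ d₂ ε W x := by
      simp only [latticeOp, hu]
      ring
    rw [hG]
    simp only
    rw [h4, eq_sub_iff_add_eq, eq_div_iff hc]
    linarith
  have hWd : ∀ x, HasDerivAt W (G x) x := by
    intro x
    have h1 : W = fun x => W 0 + ∫ t in (0 : ℝ)..x, G t := by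
      funext y
      rw [hWint y]
      congr 1
      exact intervalIntegral.integral_congr_ae (hgG.mono fun t ht _ => ht)
    rw [h1]
    exact (hGc.integral_hasStrictDerivAt 0 x).hasDerivAt.const_add _
  have hud : ∀ x, HasDerivAt u ((latticeOp d₁ d₂ ε u x - cubic a (u x)) / c) x := fun x =>
    ((hφ x).add (hWd x)).congr_deriv (by simp [hG])
  have hud' : deriv u = fun x => (latticeOp d₁ d₂ ε u x - cubic a (u x)) / c :=
    funext fun x => (hud x).deriv
  have hWmem : MemLp W 2 volume := (Lp.memLp w).ae_eq hWw
  have hGmem : MemLp G 2 volume := (Lp.memLp g).ae_eq hgG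
  obtain ⟨t1, t2⟩ := tendsto_zero_of_memLp_two hWd hWmem hGmem
  have hWG : IsWeakDeriv W G := hw.congr hWw hgG
  have hsub : (fun x => u x - φ x) = W := by
    funext x
    simp [hu]
  refine ⟨u, ?_⟩
  rw [hsub]
  refine ⟨⟨?_, ?_, ?_, ?_⟩, ⟨hWmem, G, hWG, hGmem⟩, ?_⟩
  · refine contDiff_one_iff_deriv.2 ⟨fun x => (hud x).differentiableAt, ?_⟩
    rw [hud']
    have : (fun x => (latticeOp d₁ d₂ ε u x - cubic a (u x)) / c) = fun x => G x + φ' x := by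
      funext x
      simp [hG]
    rw [this]
    exact hGc.add hφ'
  · intro x
    rw [hud']
    simp only
    rw [mul_div_cancel₀ _ hc]
    ring
  · simpa using hbot.add t1
  · simpa using htop.add t2
  · have e1 : hWmem.toLp W = w := by
      apply Lp.ext
      exact hWmem.coeFn_toLp.trans hWw.symm
    have e2 : hGmem.toLp G = g := by
      apply Lp.ext
      exact hGmem.coeFn_toLp.trans hgG.symm
    have := eH1Norm_le hWG hWmem hGmem
    rwa [e1, e2] at this

/-! ### Existence of lattice fronts -/

theorem eventually_mul_lt (A : ℝ) {b : ℝ} (hb : 0 < b) : ∀ᶠ ε : ℝ in 𝓝[>] 0, A * ε < b := by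
  have h : Tendsto (fun ε : ℝ => A * ε) (𝓝[>] 0) (𝓝 (A * 0)) :=
    ((continuous_const.mul continuous_id).tendsto 0).mono_left nhdsWithin_le_nhds
  rw [mul_zero] at h
  exact h.eventually_lt_const hb

theorem ae_abs_le_of_isWeakDeriv {w g : Lp ℝ 2 (volume : Measure ℝ)} (h : IsWeakDeriv w g) :
    ∀ᵐ x, |w x| ≤ ‖w‖ + ‖g‖ := by
  obtain ⟨W, -, hw, -, hb⟩ := h.exists_continuous_rep
  filter_upwards [hw] with x hx
  rw [hx]
  exact hb x

namespace IsLogistic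

variable {k d c a d₁ d₂ : ℝ} {φ : ℝ → ℝ}

/-- The residual of a PDE front in the lattice equation is `O(ε)` in `L²`. -/
theorem exists_norm_residual_le (h : IsLogistic k φ) (hk : 0 < k) (d₁ d₂ : ℝ) :
    ∃ C, 0 ≤ C ∧ ∀ ε, 0 < ε → ε ≤ 1 → ∃ R : Lp ℝ 2 (volume : Measure ℝ), ‖R‖ ≤ C * ε ∧
      R =ᵐ[volume] fun x => latticeOp d₁ d₂ ε φ x
        - (d₁ + 4 * d₂) * (k ^ 2 * (1 - 2 * φ x) * (φ x * (1 - φ x))) := by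
  set e := (h.memLp_deriv hk).toLp _ with he
  set C := (2 * |d₁| + 16 * |d₂|) * k ^ 2 * Real.exp (k * 2) with hC
  have hC0 : 0 ≤ C := by positivity
  refine ⟨C * ‖e‖, by positivity, fun ε hε hε1 => ?_⟩
  set ρ : ℝ → ℝ := fun x => latticeOp d₁ d₂ ε φ x
        - (d₁ + 4 * d₂) * (k ^ 2 * (1 - 2 * φ x) * (φ x * (1 - φ x))) with hρ
  have hφ := h.continuous
  have hρc : Continuous ρ := by
    have := continuous_latticeOp hφ d₁ d₂ ε
    fun_prop
  have hb : ∀ x, |ρ x| ≤ (C * ε) * (k * (φ x * (1 - φ x))) := fun x =>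
    (h.abs_latticeOp_sub_le hk d₁ d₂ hε hε1 x).trans_eq (by rw [hC]; ring)
  have hb' : ∀ x, ‖ρ x‖ ≤ (C * ε) * ‖k * (φ x * (1 - φ x))‖ := fun x =>
    (hb x).trans (mul_le_mul_of_nonneg_left (le_abs_self _) (by positivity))
  have hρm : MemLp ρ 2 volume :=
    (h.memLp_deriv hk).of_le_mul hρc.aestronglyMeasurable (Eventually.of_forall hb')
  refine ⟨hρm.toLp ρ, ?_, hρm.coeFn_toLp⟩
  have : ‖hρm.toLp ρ‖ ≤ (C * ε) * ‖e‖ := by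
    apply Lp.norm_le_mul_norm_of_ae_le_mul
    filter_upwards [hρm.coeFn_toLp, (h.memLp_deriv hk).coeFn_toLp] with x h1 h2
    rw [h1, he, h2]
    exact hb' x
  exact this.trans_eq (by ring)

theorem eventually_exists_isLatticeFront (h : IsLogistic k φ) (hk : 0 < k)
    (hd : 0 < d₁ + 4 * d₂) (hk2 : 2 * (d₁ + 4 * d₂) * k ^ 2 = 1) (ha₀ : 0 < a) (ha₁ : a < 1)
    (hceq : c = (d₁ + 4 * d₂) * k * (1 - 2 * a)) (hc : c ≠ 0) :
    ∃ C, 0 ≤ C ∧ ∀ᶠ ε in 𝓝[>] (0 : ℝ), ∃ c' u, IsLatticeFront a d₁ d₂ ε c' u ∧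
      MemH1 (fun x => u x - φ x) ∧ |c' - c| ≤ C * ε ∧
      eH1Norm (fun x => u x - φ x) ≤ ENNReal.ofReal (C * ε) := by
  have hc' : 0 < |c| := abs_pos.2 hc
  have hφ := h.continuous
  have hlim : ∀ ξ, 1 ≤ ‖limitDenom c (d₁ + 4 * d₂) ξ‖ := one_le_norm_limitDenom c hd
  have hm₀ := memLp_top_inv (continuous_limitDenom c (d₁ + 4 * d₂)) one_pos hlim
  obtain ⟨J, l, hJ⟩ := h.exists_rightInverse hk hd hk2 ha₀ ha₁ hm₀ (fun ξ => by
    rw [← hceq]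
    exact inv_mul_cancel₀ (norm_pos_iff.1 (one_pos.trans_le (hlim ξ))))
  set B := mulLp _ (h.memLp_potential ha₀ ha₁) with hB
  set e := (h.memLp_deriv hk).toLp _ with he
  obtain ⟨C₁, hC₁, hR⟩ := h.exists_norm_residual_le hk d₁ d₂
  set κ := min (1 / 2) |c| with hκ
  have hκ0 : 0 < κ := lt_min (by norm_num) hc'
  set K := |c|⁻¹ with hK
  have hK0 : 0 < K := inv_pos.2 hc'
  -- S bounds the sum of the L² norms of T f and its derivative by ‖f‖, and therefore also the
  -- supremum of |T f|.
  set S := κ⁻¹ + K with hS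
  have hS0 : 0 < S := by positivity
  set L := 7 * S * κ⁻¹ with hL
  have hL0 : 0 ≤ L := by positivity
  set Q := 2 * ‖l‖ * K * ‖J‖ + L * ‖J‖ ^ 2 with hQ
  have hQ0 : 0 ≤ Q := by positivity
  -- The first entry keeps |T h| ≤ 1, where the superposition operator is controlled; the second
  -- makes the Lipschitz constant of the nonlinear terms at most 1/4.
  set r := min (S⁻¹ / (‖J‖ + 1)) (1 / (4 * (Q + 1))) with hr
  have hr0 : 0 < r := lt_min (by positivity) (by positivity)
  set δ := 1 / (4 * (‖B‖ * ‖J‖ + 1)) with hδ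
  have hδ0 : 0 < δ := by positivity
  have hr1 : ‖J‖ * r ≤ S⁻¹ := by
    have h1 : r ≤ S⁻¹ / (‖J‖ + 1) := min_le_left _ _
    rw [le_div_iff₀ (by positivity)] at h1
    linarith
  have hr2 : Q * r ≤ 1 / 4 := by
    have h1 : r ≤ 1 / (4 * (Q + 1)) := min_le_right _ _
    rw [le_div_iff₀ (by positivity)] at h1
    linarith
  have hδ1 : ‖B‖ * δ * ‖J‖ ≤ 1 / 4 := by
    have h1 : δ * (4 * (‖B‖ * ‖J‖ + 1)) = 1 := by
      rw [hδ]
      exact one_div_mul_cancel (by positivity)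
    linarith
  -- This is f_a''(φ)/2, so that f_a(φ + w) = f_a(φ) + f_a'(φ) w + q w² + w³.
  set q : ℝ → ℝ := fun x => 3 * φ x - (1 + a) with hq
  have hqc : Continuous q := by fun_prop
  have hq2 : ∀ x, |q x| ≤ 2 := fun x =>
    abs_le.2 ⟨by simp only [hq]; linarith [h.pos x], by simp only [hq]; linarith [h.lt_one x]⟩
  refine ⟨2 * C₁ * (‖l‖ + S * ‖J‖), by positivity, ?_⟩
  filter_upwards [self_mem_nhdsWithin, eventually_le_norm_latticeDenom (c := c) hd,
    eventually_norm_inv_latticeDenom_sub_le hd hc hδ0, eventually_mul_lt 1 one_pos,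
    eventually_mul_lt C₁ (half_pos hr0), eventually_mul_lt (‖l‖ * (2 * C₁)) hc']
    with ε hε hN hNδ hε1 hεr hεc
  obtain ⟨R, hRn, hRe⟩ := hR ε hε (by linarith)
  have hcN := continuous_latticeDenom c d₁ d₂ ε
  have hcξ := abs_mul_le_norm_latticeDenom c d₁ d₂ ε
  have hm := memLp_top_inv hcN hκ0 hN
  have hm' := memLp_top_mul_inv hcN hκ0 hN hc hcξ
  set T := realMultiplier _ hm with hT
  set D := realMultiplier _ hm' with hD
  have hTn : ∀ f, ‖T f‖ ≤ κ⁻¹ * ‖f‖ :=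
    norm_realMultiplier_apply_le hm (by positivity) fun ξ => by
      rw [norm_inv]
      exact inv_anti₀ hκ0 (hN ξ)
  have hDn : ∀ f, ‖D f‖ ≤ K * ‖f‖ :=
    norm_realMultiplier_apply_le hm' hK0.le (norm_mul_inv_le hc hcξ)
  have hTD : ∀ f, IsWeakDeriv (T f) (D f) := isWeakDeriv_realMultiplier hm hm'
  have hsum : ∀ f, ‖T f‖ + ‖D f‖ ≤ S * ‖f‖ := fun f => by
    rw [hS, add_mul]
    exact add_le_add (hTn f) (hDn f)
  have hsup : ∀ f M, ‖f‖ ≤ M → ∀ᵐ x, |T f x| ≤ S * M := fun f M hM =>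
    (ae_abs_le_of_isWeakDeriv (hTD f)).mono fun x hx =>
      hx.trans ((hsum f).trans (mul_le_mul_of_nonneg_left hM hS0.le))
  have hSM : ∀ M ≤ S⁻¹, S * M ≤ 1 := fun M hM =>
    (mul_le_mul_of_nonneg_left hM hS0.le).trans_eq (mul_inv_cancel₀ hS0.ne')
  have hNlip : ∀ M ≤ S⁻¹, ∀ f f', ‖f‖ ≤ M → ‖f'‖ ≤ M →
      ‖quadraticRemainder q (T f) - quadraticRemainder q (T f')‖ ≤ L * M * ‖f - f'‖ := by
    intro M hM f f' hf hf'
    have hM0 : 0 ≤ M := (norm_nonneg f).trans hf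
    refine (norm_quadraticRemainder_sub_le hqc hq2 (hSM M hM) (hsup f M hf)
      (hsup f' M hf')).trans ?_
    rw [← map_sub]
    calc 7 * (S * M) * ‖T (f - f')‖ ≤ 7 * (S * M) * (κ⁻¹ * ‖f - f'‖) :=
          mul_le_mul_of_nonneg_left (hTn _) (by positivity)
      _ = L * M * ‖f - f'‖ := by rw [hL]; ring
  obtain ⟨g, hg, hgeq⟩ := exists_bordered_solution (T := T) (D := D) (R := R)
    (N := quadraticRemainder q) hJ hL0 hDn
    (norm_realMultiplier_sub_apply_le hm hm₀ hδ0.le hNδ) (quadraticRemainder_zero hqc hq2) hNlip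
    hr1 hr2 hK0.le hδ0.le hδ1 (by linarith)
  have hgε : ‖g‖ ≤ 2 * C₁ * ε := by linarith
  have hJg : ‖J g‖ ≤ ‖J‖ * (2 * C₁ * ε) :=
    (J.le_opNorm g).trans (mul_le_mul_of_nonneg_left hgε (norm_nonneg _))
  have hlg : |l g| ≤ ‖l‖ * (2 * C₁ * ε) :=
    (l.le_opNorm g).trans (mul_le_mul_of_nonneg_left hgε (norm_nonneg _))
  have hε0 : 0 < ε := hε
  have hJr : ‖J g‖ ≤ S⁻¹ :=
    (hJg.trans (mul_le_mul_of_nonneg_left (by linarith) (norm_nonneg _))).trans hr1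
  -- Small ε gives |l g| < |c|, so the new speed stays nonzero and u' can be solved for.
  have hcγ : c + l g ≠ 0 := by
    intro h0
    have h1 : |l g| = |c| := by rw [eq_neg_of_add_eq_zero_right h0, abs_neg]
    linarith
  have hae : ∀ᵐ x, (c + l g) * (k * (φ x * (1 - φ x)) + D (J g) x)
      - (latticeOp d₁ d₂ ε φ x + latticeOp d₁ d₂ ε (T (J g)) x)
      + cubic a (φ x + T (J g) x) = 0 := by
    have hres := ae_lattice_resolvent (c := c) (d₁ := d₁) (d₂ := d₂) (ε := ε) hm hm'
      (fun ξ => inv_mul_cancel₀ (norm_pos_iff.1 (hκ0.trans_le (hN ξ)))) (J g)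
    have hgae : ⇑(J g + B (T (J g)) + l g • e) =ᵐ[volume]
        ⇑(R - l g • D (J g) - quadraticRemainder q (T (J g))) := by rw [hgeq]
    filter_upwards [hres, hgae, hRe, Lp.coeFn_add (J g + B (T (J g))) (l g • e),
      Lp.coeFn_add (J g) (B (T (J g))), Lp.coeFn_smul (l g) e, (h.memLp_deriv hk).coeFn_toLp,
      coeFn_mulLp _ (h.memLp_potential ha₀ ha₁) (T (J g)),
      Lp.coeFn_sub (R - l g • D (J g)) (quadraticRemainder q (T (J g))),
      Lp.coeFn_sub R (l g • D (J g)), Lp.coeFn_smul (l g) (D (J g)),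
      coeFn_quadraticRemainder hqc hq2 ((hsup (J g) _ le_rfl).mono fun x hx =>
        hx.trans (hSM _ hJr))] with x h1 h2 h3 h4 h5 h6 h7 h8 h9 h10 h11 h12
    rw [h4, h9, Pi.add_apply, h5, Pi.add_apply, h6, Pi.smul_apply, he, h7, hB, h8, Pi.sub_apply,
      h10, Pi.sub_apply, h11, Pi.smul_apply, h12, h3] at h2
    simp only [hq, smul_eq_mul] at h2
    rw [← hT, ← hD] at h1
    simp only [cubic]
    -- The lattice equation is the sum of the bordered equation, the resolvent identity and the
    -- limit equation for φ; the last two terms encode c φ' - d φ'' + f_a(φ) = 0.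
    linear_combination h2 + h1 + (k * (φ x * (1 - φ x))) * hceq
      + (φ x * (1 - φ x) * (φ x - a)) * hk2
  obtain ⟨u, hu, hu1, hun⟩ := exists_isLatticeFront_of_ae h.hasDerivAt (by fun_prop)
    h.tendsto_atBot h.tendsto_atTop hcγ (hTD (J g)) hae
  refine ⟨c + l g, u, hu, hu1, ?_, hun.trans (ENNReal.ofReal_le_ofReal ?_)⟩
  · rw [add_sub_cancel_left]
    have : 0 ≤ S * ‖J‖ * (2 * C₁ * ε) := by positivity
    linarith
  · have h1 := mul_le_mul_of_nonneg_left hJg hS0.le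
    have h2 := hsum (J g)
    have : 0 ≤ ‖l‖ * (2 * C₁ * ε) := by positivity
    linarith

end IsLogistic

theorem theorem4p1 (a d₁ d₂ : ℝ) (ha₀ : 0 < a) (ha₁ : a < 1) (hd : 0 < d₁ + 4 * d₂)
    (c₀ : ℝ) (φ₀ : ℝ → ℝ) (hφ₀ : IsPDEFront a (d₁ + 4 * d₂) c₀ φ₀) (hc₀ : c₀ ≠ 0) :
    ∃ εstar : ℝ, 0 < εstar ∧ ∃ (c : ℝ → ℝ) (φ : ℝ → ℝ → ℝ),
      (∀ ε ∈ Set.Ioo 0 εstar,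
        IsLatticeFront a d₁ d₂ ε (c ε) (φ ε) ∧ MemH1 (fun x => φ ε x - φ₀ x)) ∧
      Tendsto c (𝓝[>] 0) (𝓝 c₀) ∧
      Tendsto (fun ε => eH1Norm (fun x => φ ε x - φ₀ x)) (𝓝[>] 0) (𝓝 0) := by
  obtain ⟨k, hk, hk2⟩ : ∃ k : ℝ, 0 < k ∧ 2 * (d₁ + 4 * d₂) * k ^ 2 = 1 := by
    refine ⟨Real.sqrt (1 / (2 * (d₁ + 4 * d₂))), Real.sqrt_pos.2 (by positivity), ?_⟩
    rw [Real.sq_sqrt (by positivity)]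
    exact mul_one_div_cancel (by positivity)
  have hlog := hφ₀.isLogistic hd ha₀ ha₁ hk hk2
  obtain ⟨C, -, hev⟩ := hlog.eventually_exists_isLatticeFront hk hd hk2 ha₀ ha₁
    (hφ₀.speed_eq hd ha₀ ha₁ hk hk2) hc₀
  obtain ⟨εstar, hε, hsub⟩ := mem_nhdsGT_iff_exists_Ioo_subset.1 hev
  have hex : ∀ ε, ∃ p : ℝ × (ℝ → ℝ), ε ∈ Set.Ioo 0 εstar →
      IsLatticeFront a d₁ d₂ ε p.1 p.2 ∧ MemH1 (fun x => p.2 x - φ₀ x) ∧ |p.1 - c₀| ≤ C * ε ∧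
        eH1Norm (fun x => p.2 x - φ₀ x) ≤ ENNReal.ofReal (C * ε) := by
    intro ε
    by_cases h : ε ∈ Set.Ioo 0 εstar
    · obtain ⟨c', u, hu⟩ := hsub h
      exact ⟨(c', u), fun _ => hu⟩
    -- Outside (0, ε*) the pair is arbitrary; nothing is claimed there and the limits do not see it.
    · exact ⟨(0, 0), fun h' => absurd h' h⟩
  choose p hp using hex
  have hmem : Set.Ioo 0 εstar ∈ 𝓝[>] (0 : ℝ) := Ioo_mem_nhdsGT hε
  have hlim : Tendsto (fun ε : ℝ => C * ε) (𝓝[>] 0) (𝓝 0) := by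
    have h : Tendsto (fun ε : ℝ => C * ε) (𝓝[>] 0) (𝓝 (C * 0)) :=
      ((continuous_const.mul continuous_id).tendsto 0).mono_left nhdsWithin_le_nhds
    rwa [mul_zero] at h
  refine ⟨εstar, hε, fun ε => (p ε).1, fun ε => (p ε).2,
    fun ε h => ⟨(hp ε h).1, (hp ε h).2.1⟩, ?_, ?_⟩
  · rw [tendsto_iff_dist_tendsto_zero]
    refine squeeze_zero' (Eventually.of_forall fun _ => dist_nonneg) ?_ hlim
    filter_upwards [hmem] with ε h
    exact (hp ε h).2.2.1
  · have h0 := ENNReal.tendsto_ofReal hlim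
    rw [ENNReal.ofReal_zero] at h0
    refine tendsto_of_tendsto_of_tendsto_of_le_of_le' tendsto_const_nhds h0
      (Eventually.of_forall fun _ => zero_le) ?_
    filter_upwards [hmem] with ε h
    exact (hp ε h).2.2.2
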